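/- Let $D$ be a $(3,n)$-distribution, i.e. a smooth rank $3$ subbundle of the tangent bundle of an $n$-dimensional smooth manifold $M$, and let $q\in M$ be a point at which $\dim D^2(q)=6$, where $D^2=D+[D,D]$. Let $W_D=\{\lambda\in D^\perp\subset T^*M:\dim\ker(\hat\sigma|_{D^\perp}(\lambda))=1\}$ ($\hat\sigma$ the canonical symplectic form). The set $\mathbb PW_D$ is foliated by the regular abnormal extremals $\gamma$ of $D$ (the integral curves of these kernels). On the quotient $\mathcal N$ of $\mathbb PW_D$ by this foliation there is the contact distribution $\Delta$ induced by the Liouville form, and $\Delta(\gamma)$ carries the conformal symplectic structure induced by $\hat\sigma$. The extended Jacobi curve of $\gamma$ is $\lambda\mapsto\{J^i(\lambda)\}_{i\in\mathbb Z}$, where $J^0(\lambda)\subset\Delta(\gamma)$ is the image of the lift of $D$ to $W_D$, $J^{-i}$ $(i>0)$ is its $i$-th osculating subspace, and $J^{i}=(J^{1-i})^\angle$ (skew-orthogonal complement) for $i>0$. A point $\lambda$ is of maximal class if $J^\nu(\lambda)=\Delta(\gamma)$ for some $\nu$. The symplectic flag symbol at $\lambda$ is the line of degree $-1$ endomorphisms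 of the graded conformal symplectic space $\bigoplus_i J^i(\lambda)/J^{i+1}(\lambda)$ defined by the tangent line of the curve, up to graded conformal symplectic isomorphism. The distribution is of maximal class at $q$ if the points of a nonempty Zariski open subset of the fibre of $\mathbb PW_D$ over $q$ are of maximal class, and its Jacobi symbol at $q$ is the common isomorphism class of the symplectic flag symbols at the points of a nonempty Zariski open subset of this fibre (regular points of the extended Jacobi curves). For integers $s\ge 0$, $0\le l\le 2s$, let $\delta_{s,l}$ be the endomorphism $e_i\mapsto e_{i-1}$, $f_i\mapsto f_{i-1}$ (with $e_{s-l}\mapsto0$, $f_{-s}\mapsto 0$) of the graded symplectic space $X_{s,l}$ with basis $e_{s-l},\dots,e_s,f_{-s},\dots,f_{l-s}$ ($e_i$, $f_i$ of degree $i$) whose only nonzero products of basis vectors are $\sigma(e_i,f_{-i})=-\sigma(f_{-i},e_i)=(-1)^{s-i}$. Every $\mathbb Z$-graded symplectic flag symbol is a direct sum of such symbols. Its skew Young diagram has, for every summand $\mathbb R\delta_{s,l}$, one row of boxes in the columns $s-l,\dots,s$ and one row in the columns $-s,\dots,l-s$; it is rectangular if all rows occupy the same columns. For a symbol $\mathbb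 R\delta$ on $X$ let $\mathfrak u^F(\delta)=\bigoplus_{k\ge-1}\mathfrak u_k\subset\mathfrak{csp}(X)$ with $\mathfrak u_{-1}=\mathbb R\delta$ and $\mathfrak u_k=\{v\in\mathfrak{csp}^k(X):[v,\delta]\in\mathfrak u_{k-1}\}$ for $k\ge0$. Let $\eta=\eta^{-1}\oplus\eta^{-2}$, $\eta^{-1}=X$, $\eta^{-2}=\mathbb R$, be the Heisenberg algebra with $[x,y]=\sigma(x,y)\in\eta^{-2}$ for $x,y\in X$. For a subalgebra $\mathfrak g^0\subset\mathfrak{csp}(X)$ let $\mathfrak u(\eta,\mathfrak g^0)$ be the universal algebraic prolongation of $(\eta,\mathfrak g^0)$, i.e. the maximal graded Lie algebra with non-positive part $\eta\oplus\mathfrak g^0$ in which no nonzero element of non-negative degree commutes with $\eta$, and let $$\mathfrak u^1(\eta,\mathfrak g^0)=\{f\in\mathrm{Hom}(\eta^{-1},\mathfrak g^0)\oplus\mathrm{Hom}(\eta^{-2},\eta^{-1}): f([v_1,v_2])=[f(v_1),v_2]+[v_1,f(v_2)]\ \ \forall v_1,v_2\in\eta\}$$ be its first prolongation. **Theorem.**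 Assume that $D$ is of maximal class at $q$, that $\dim D^2(q)=6$, and that the Jacobi symbol $\mathbb R\delta$ of $D$ at $q$, represented on a graded conformal symplectic space $X$, has a rectangular skew Young diagram. Then: 1. $n$ is even, and the Jacobi symbol is isomorphic to $\mathbb R\delta_{s,2s}$ with $s=\frac{n-4}{2}$. 2. Let $E_1$ be the span of the vectors $e_i$. There is an identification $X\cong E_1\otimes\mathbb R^2$, under which $e_i\otimes\varepsilon_1$ and $e_i\otimes\varepsilon_2$ ($\varepsilon_1,\varepsilon_2$ the standard basis of $\mathbb R^2$) correspond to $e_i$ and $f_i$, and an isomorphism $\mathfrak u^F(\delta)\cong\mathfrak{sl}_2(\mathbb R)\times\mathfrak{gl}_2(\mathbb R)$ such that $\mathfrak{sl}_2\times\mathfrak{gl}_2$ acts on $E_1\otimes\mathbb R^2$ componentwise, the action of $\mathfrak{sl}_2$ on $E_1$ being irreducible and the action of $\mathfrak{gl}_2$ on $\mathbb R^2$ being the standard one. 3. If $n=6$, then $\mathfrak u(\eta,\mathfrak u^F(\delta))$ is isomorphic to $\mathfrak{so}(4,3)$. 4. If $n>6$, then $\mathfrak u^1(\eta,\mathfrak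 u^F(\delta))=0$, and $\mathfrak u(\eta,\mathfrak u^F(\delta))$ is isomorphic to the semidirect sum of $\mathfrak{sl}_2\times\mathfrak{gl}_2$ with the Heisenberg algebra $\eta$, where $\mathfrak{sl}_2\times\mathfrak{gl}_2$ acts on $\eta$ by the derivations which extend its action on $\eta^{-1}=X\cong E_1\otimes\mathbb R^2$ described in 2. -/

import Mathlib

open scoped Manifold ContDiff TensorProduct

attribute [local instance 100] LieRing.ofAssociativeRing

/-! ## Symplectic flag symbols of `ℤ`-graded conformal symplectic spaces -/

/-- A symplectic flag symbol in the `ℤ`-graded case: a finite-dimensional graded real vector space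
`X = ⨁ X^i` with a conformal symplectic structure (the class of `σ` up to nonzero factors) such that
`X^i` and `X^j` are skew-orthogonal for `i + j ≠ 0`, together with the line `ℝ δ` spanned by
a degree `-1` element `δ` of the conformal symplectic algebra.
(Morphisms, see `FlagSymbol.Iso`, only see `σ` and `δ` up to nonzero factors.) -/
structure FlagSymbol where
  X : Type
  addCommGroup : AddCommGroup X
  module : Module ℝ X
  finite : FiniteDimensional ℝ X
  gr : ℤ → Submodule ℝ X
  isInternal : DirectSum.IsInternal gr
  σ : X →ₗ[ℝ] X →ₗ[ℝ] ℝ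
  σ_self : ∀ x, σ x x = 0
  σ_nondeg : ∀ x, (∀ y, σ x y = 0) → x = 0
  σ_gr : ∀ i j x y, x ∈ gr i → y ∈ gr j → i + j ≠ 0 → σ x y = 0
  δ : Module.End ℝ X
  δ_gr : ∀ i x, x ∈ gr i → δ x ∈ gr (i - 1)
  δ_csp : ∃ c : ℝ, ∀ x y, σ (δ x) y + σ x (δ y) = c * σ x y

attribute [instance] FlagSymbol.addCommGroup FlagSymbol.module FlagSymbol.finite

namespace FlagSymbol

/-- An isomorphism of symplectic flag symbols: a graded conformal symplectic isomorphism which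
conjugates the line `ℝ δ` to the line `ℝ δ'`. -/
structure Iso (S T : FlagSymbol) where
  toEquiv : S.X ≃ₗ[ℝ] T.X
  map_gr : ∀ i, (S.gr i).map (toEquiv : S.X →ₗ[ℝ] T.X) = T.gr i
  map_σ : ∃ c : ℝ, c ≠ 0 ∧ ∀ x y, T.σ (toEquiv x) (toEquiv y) = c * S.σ x y
  map_δ : ∃ c : ℝ, c ≠ 0 ∧ ∀ x, toEquiv (S.δ x) = c • T.δ (toEquiv x)

end FlagSymbol

/-! ### Direct sums of the indecomposable symbols `δ_{s,l}` and their skew Young diagrams -/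

/-- The boxes of the skew Young diagram of `⨁ⱼ δ_{sⱼ,lⱼ}`. The box `(j, true, a)` carries the vector
`e_{sⱼ - a}` and the box `(j, false, a)` carries the vector `f_{lⱼ - sⱼ - a}` of the `j`-th summand
`X_{s,l} = span {e_{s-l}, …, e_s, f_{-s}, …, f_{l-s}}`. -/
abbrev YoungBox {k : ℕ} (l : Fin k → ℕ) : Type := Σ j : Fin k, Bool × Fin (l j + 1)

namespace YoungBox

variable {k : ℕ} {l : Fin k → ℕ}

/-- The degree (that is, the column) of a box. -/
def weight (s : Fin k → ℕ) (b : YoungBox l) : ℤ :=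
  if b.2.1 then (s b.1 : ℤ) - (b.2.2 : ℕ) else (l b.1 : ℤ) - s b.1 - (b.2.2 : ℕ)

/-- The centrally symmetric box. -/
def opp (b : YoungBox l) : YoungBox l := ⟨b.1, !b.2.1, b.2.2.rev⟩

/-- `σ(e_i, f_{-i}) = (-1)^{s-i}` and `σ(f_{-i}, e_i) = -(-1)^{s-i}`. -/
def sgn (b : YoungBox l) : ℝ :=
  if b.2.1 then (-1) ^ (b.2.2 : ℕ) else -(-1) ^ (b.2.2.rev : ℕ)

theorem opp_opp (b : YoungBox l) : b.opp.opp = b := by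
  obtain ⟨j, e, a⟩ := b
  simp [opp]

theorem sgn_opp (b : YoungBox l) : b.opp.sgn = -b.sgn := by
  obtain ⟨j, e, a⟩ := b
  cases e <;> simp [opp, sgn]

theorem sgn_ne_zero (b : YoungBox l) : b.sgn ≠ 0 := by
  obtain ⟨j, e, a⟩ := b
  cases e <;> simp [sgn]

theorem weight_opp (s : Fin k → ℕ) (b : YoungBox l) : b.opp.weight s = -b.weight s := by
  obtain ⟨j, e, a⟩ := b
  have h : ((a.rev : ℕ) : ℤ) = l j - (a : ℕ) := by
    have := a.2
    rw [Fin.val_rev]; omega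
  cases e
  · simp only [opp, weight, Bool.not_false, h]
    simp
    ring
  · simp only [opp, weight, Bool.not_true, h]
    simp

/-- The span of the vectors in the boxes of the column of weight `i`. -/
def column (s : Fin k → ℕ) (i : ℤ) : Submodule ℝ (YoungBox l → ℝ) where
  carrier := {f | ∀ b, b.weight s ≠ i → f b = 0}
  zero_mem' := by simp
  add_mem' := by
    intro f g hf hg b hb
    simp [hf b hb, hg b hb]
  smul_mem' := by
    intro c f hf b hb
    simp [hf b hb]

theorem column_isInternal (s : Fin k → ℕ) :
    DirectSum.IsInternal (column (l := l) s) := by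
  rw [DirectSum.isInternal_submodule_iff_iSupIndep_and_iSup_eq_top]
  constructor
  · rw [iSupIndep_def]
    intro i
    rw [Submodule.disjoint_def]
    intro f hf hf'
    have hle : (⨆ (j : ℤ) (_ : j ≠ i), column (l := l) s j) ≤
        { carrier := {f | ∀ b : YoungBox l, b.weight s = i → f b = 0}
          zero_mem' := by simp
          add_mem' := by
            intro f g hf hg b hb
            simp [hf b hb, hg b hb]
          smul_mem' := by
            intro c f hf b hb
            simp [hf b hb] } := by
      refine iSup₂_le fun j hj g hg b hb => hg b ?_
      rw [hb]; exact hj.symm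
    have h2 := hle hf'
    funext b
    by_cases hb : b.weight s = i
    · exact h2 b hb
    · exact hf b hb
  · rw [eq_top_iff]
    intro f _
    have : f = ∑ b, Pi.single b (f b) := by
      classical
      exact (Finset.univ_sum_single f).symm
    rw [this]
    refine Submodule.sum_mem _ fun b _ => ?_
    refine Submodule.mem_iSup_of_mem (b.weight s) ?_
    intro b' hb'
    rw [Pi.single_eq_of_ne]
    rintro rfl
    exact hb' rfl

/-- The symplectic form. -/
def form (l : Fin k → ℕ) : (YoungBox l → ℝ) →ₗ[ℝ] (YoungBox l → ℝ) →ₗ[ℝ] ℝ :=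
  LinearMap.mk₂ ℝ (fun f g => ∑ b : YoungBox l, b.sgn * f b * g b.opp)
    (by intro f f' g; simp [mul_add, add_mul, Finset.sum_add_distrib])
    (by
      intro c f g
      simp only [Pi.smul_apply, smul_eq_mul, Finset.mul_sum]
      exact Finset.sum_congr rfl fun b _ => by ring)
    (by intro f f' g; simp [mul_add, Finset.sum_add_distrib])
    (by
      intro c f g
      simp only [Pi.smul_apply, smul_eq_mul, Finset.mul_sum]
      exact Finset.sum_congr rfl fun b _ => by ring)

theorem form_apply (f g : YoungBox l → ℝ) :
    form l f g = ∑ b : YoungBox l, b.sgn * f b * g b.opp := rfl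

/-- The right shift `e_i ↦ e_{i-1}`, `f_i ↦ f_{i-1}` along the rows of the tableau. -/
def shift (l : Fin k → ℕ) : Module.End ℝ (YoungBox l → ℝ) where
  toFun f b := Fin.cases (motive := fun _ => ℝ) 0 (fun a => f ⟨b.1, b.2.1, a.castSucc⟩) b.2.2
  map_add' f g := by
    funext ⟨j, e, a⟩
    refine Fin.cases ?_ (fun a => ?_) a <;> simp
  map_smul' c f := by
    funext ⟨j, e, a⟩
    refine Fin.cases ?_ (fun a => ?_) a <;> simp

theorem shift_zero (f : YoungBox l → ℝ) (j : Fin k) (e : Bool) :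
    shift l f ⟨j, e, 0⟩ = 0 := rfl

theorem shift_succ (f : YoungBox l → ℝ) (j : Fin k) (e : Bool) (a : Fin (l j)) :
    shift l f ⟨j, e, a.succ⟩ = f ⟨j, e, a.castSucc⟩ := rfl

theorem form_self (f : YoungBox l → ℝ) : form l f f = 0 := by
  have h : form l f f = -form l f f := by
    conv_lhs => rw [form_apply]
    rw [form_apply, ← Finset.sum_neg_distrib]
    have hinv : Function.Involutive (opp : YoungBox l → YoungBox l) := opp_opp
    refine Fintype.sum_equiv hinv.toPerm _ _ fun b => ?_
    simp only [Function.Involutive.coe_toPerm, opp_opp, sgn_opp]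
    ring
  linarith

theorem form_nondeg (f : YoungBox l → ℝ) (h : ∀ g, form l f g = 0) : f = 0 := by
  classical
  funext b
  have := h (Pi.single b.opp 1)
  rw [form_apply, Finset.sum_eq_single b] at this
  · simpa [sgn_ne_zero] using this
  · intro b' _ hb'
    rw [Pi.single_eq_of_ne, mul_zero]
    intro h'
    exact hb' (by rw [← opp_opp b', h', opp_opp])
  · simp

theorem form_shift (f g : YoungBox l → ℝ) :
    form l (shift l f) g + form l f (shift l g) = 0 := by
  simp only [form_apply, Fintype.sum_sigma, Fintype.sum_prod_type, ← Finset.sum_add_distrib]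
  refine Finset.sum_eq_zero fun j _ => Finset.sum_eq_zero fun e _ => ?_
  rw [Finset.sum_add_distrib, Fin.sum_univ_succ, Fin.sum_univ_castSucc (n := l j)
    (f := fun a => sgn ⟨j, e, a⟩ * f ⟨j, e, a⟩ * shift l g (opp ⟨j, e, a⟩))]
  have h0 : shift l g (opp ⟨j, e, Fin.last (l j)⟩) = 0 := by
    simp only [opp, Fin.rev_last]; rfl
  rw [shift_zero, h0]
  simp only [mul_zero, zero_mul, zero_add, add_zero, ← Finset.sum_add_distrib]
  refine Finset.sum_eq_zero fun a _ => ?_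
  have h1 : shift l g (opp ⟨j, e, a.castSucc⟩) = g (opp ⟨j, e, a.succ⟩) := by
    simp only [opp, Fin.rev_castSucc, Fin.rev_succ]; rfl
  have h2 : sgn (⟨j, e, a.succ⟩ : YoungBox l) = -sgn (⟨j, e, a.castSucc⟩ : YoungBox l) := by
    cases e
    · have h3 : ((a.castSucc).rev : ℕ) = (a.succ.rev : ℕ) + 1 := by
        simp only [Fin.val_rev, Fin.val_castSucc, Fin.val_succ]; omega
      simp only [sgn, h3, pow_succ]; simp
    · simp [sgn, pow_succ]
  rw [shift_succ, h1, h2]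
  ring

end YoungBox

/-- The direct sum `⨁ⱼ δ_{sⱼ,lⱼ}` of indecomposable symplectic flag symbols. -/
def youngSymbol {k : ℕ} (s l : Fin k → ℕ) : FlagSymbol where
  X := YoungBox l → ℝ
  addCommGroup := inferInstance
  module := inferInstance
  finite := inferInstance
  gr := YoungBox.column s
  isInternal := YoungBox.column_isInternal s
  σ := YoungBox.form l
  σ_self := YoungBox.form_self
  σ_nondeg := YoungBox.form_nondeg
  σ_gr := by
    intro i j f g hf hg hij
    rw [YoungBox.form_apply]
    refine Finset.sum_eq_zero fun b _ => ?_
    by_cases hb : b.weight s = i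
    · rw [hg b.opp (by rw [YoungBox.weight_opp]; omega), mul_zero]
    · rw [hf b hb]; ring
  δ := YoungBox.shift l
  δ_gr := by
    intro i f hf
    rintro ⟨j, e, a⟩
    refine Fin.cases (fun _ => rfl) (fun a hb => ?_) a
    rw [YoungBox.shift_succ]
    refine hf _ fun h => hb ?_
    rw [← h]
    cases e <;> simp [YoungBox.weight] <;> ring
  δ_csp := ⟨0, fun f g => by rw [YoungBox.form_shift]; ring⟩

/-- The indecomposable symplectic flag symbol `ℝ δ_{s,l}` on the graded symplectic space
`X_{s,l}`. -/
def indecSymbol (s l : ℕ) : FlagSymbol := youngSymbol (fun _ : Fin 1 => s) (fun _ => l)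

/-- The box of `e_{s-a}` in the tableau of `δ_{s,l}`. -/
def eBox {s l : ℕ} (a : Fin (l + 1)) : (indecSymbol s l).X :=
  Pi.single (M := fun _ : YoungBox (fun _ : Fin 1 => l) => ℝ) ⟨0, true, a⟩ 1

/-- The box of `f_{l-s-a}` in the tableau of `δ_{s,l}`. -/
def fBox {s l : ℕ} (a : Fin (l + 1)) : (indecSymbol s l).X :=
  Pi.single (M := fun _ : YoungBox (fun _ : Fin 1 => l) => ℝ) ⟨0, false, a⟩ 1

/-- The columns (weights) occupied by the two rows of the skew Young diagram of `δ_{s,l}`: the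
upper row occupies the weights `s-l, …, s`, the lower row the weights `-s, …, l-s`. -/
noncomputable def rowColumns (s l : ℕ) (upper : Bool) : Finset ℤ :=
  if upper then Finset.Icc ((s : ℤ) - l) s else Finset.Icc (-(s : ℤ)) ((l : ℤ) - s)

/-- The symbol has a rectangular skew Young diagram: it is a direct sum of indecomposable symbols
`δ_{sⱼ,lⱼ}`, `0 ≤ lⱼ ≤ 2 sⱼ`, such that all rows of the diagram obtained by putting the diagrams of
the summands below one another (boxes of the same weight being in the same column) occupy the same
columns. -/
def FlagSymbol.IsRectangular (S : FlagSymbol) : Prop :=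
  ∃ (k : ℕ) (s l : Fin k → ℕ), (∀ j, l j ≤ 2 * s j) ∧
    Nonempty (FlagSymbol.Iso (youngSymbol s l) S) ∧
    ∃ C : Finset ℤ, ∀ (j : Fin k) (upper : Bool), rowColumns (s j) (l j) upper = C

namespace FlagSymbol

/-! ### The conformal symplectic algebra and the universal algebraic prolongation of a symbol -/

variable (S : FlagSymbol)

/-- The conformal symplectic Lie algebra `csp(X)`. -/
def csp : LieSubalgebra ℝ (Module.End ℝ S.X) where
  carrier := {A | ∃ c : ℝ, ∀ x y, S.σ (A x) y + S.σ x (A y) = c * S.σ x y}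
  zero_mem' := ⟨0, by simp⟩
  add_mem' := by
    rintro A B ⟨a, ha⟩ ⟨b, hb⟩
    refine ⟨a + b, fun x y => ?_⟩
    simp only [LinearMap.add_apply, map_add]
    linear_combination ha x y + hb x y
  smul_mem' := by
    rintro r A ⟨a, ha⟩
    refine ⟨r * a, fun x y => ?_⟩
    simp only [LinearMap.smul_apply, map_smul, smul_eq_mul]
    linear_combination r * ha x y
  lie_mem' := by
    rintro A B ⟨a, ha⟩ ⟨b, hb⟩
    refine ⟨0, fun x y => ?_⟩
    simp only [LieRing.of_associative_ring_bracket, LinearMap.sub_apply, Module.End.mul_apply,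
      map_sub]
    linear_combination ha (B x) y - hb (A x) y + ha x (B y) - hb x (A y) + a * hb x y
      - b * ha x y

/-- The degree `k` component `csp^k(X)`. -/
def cspDeg (k : ℤ) : Submodule ℝ (Module.End ℝ S.X) where
  carrier := {A | A ∈ S.csp ∧ ∀ i x, x ∈ S.gr i → A x ∈ S.gr (i + k)}
  zero_mem' := ⟨S.csp.zero_mem, by simp⟩
  add_mem' := by
    rintro A B ⟨hA, hA'⟩ ⟨hB, hB'⟩
    exact ⟨S.csp.add_mem hA hB, fun i x hx => Submodule.add_mem _ (hA' i x hx) (hB' i x hx)⟩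
  smul_mem' := by
    rintro c A ⟨hA, hA'⟩
    exact ⟨S.csp.smul_mem c hA, fun i x hx => Submodule.smul_mem _ c (hA' i x hx)⟩

/-- The algebraic prolongations of the symbol `ℝ δ`, the index being shifted by one:
`prolong 0 = 𝔲_{-1} = ℝ δ` and
`prolong (k + 1) = 𝔲_k = {v ∈ csp^k(X) : [v, δ] ∈ 𝔲_{k-1}}` for `k ≥ 0`. -/
def prolong : ℕ → Submodule ℝ (Module.End ℝ S.X)
  | 0 => Submodule.span ℝ {S.δ}
  | k + 1 =>
    { carrier := {v | v ∈ S.cspDeg k ∧ ⁅v, S.δ⁆ ∈ prolong k}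
      zero_mem' := ⟨Submodule.zero_mem _, by rw [zero_lie]; exact Submodule.zero_mem _⟩
      add_mem' := fun ha hb =>
        ⟨Submodule.add_mem _ ha.1 hb.1, by rw [add_lie]; exact Submodule.add_mem _ ha.2 hb.2⟩
      smul_mem' := fun c _ ha =>
        ⟨Submodule.smul_mem _ c ha.1, by rw [smul_lie]; exact Submodule.smul_mem _ c ha.2⟩ }

theorem lie_mem_cspDeg {a b : ℤ} {v w : Module.End ℝ S.X} (hv : v ∈ S.cspDeg a)
    (hw : w ∈ S.cspDeg b) : ⁅v, w⁆ ∈ S.cspDeg (a + b) := by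
  refine ⟨S.csp.lie_mem hv.1 hw.1, fun i x hx => ?_⟩
  rw [LieRing.of_associative_ring_bracket]
  refine Submodule.sub_mem _ ?_ ?_
  · have := hv.2 _ _ (hw.2 i x hx)
    rwa [add_assoc, add_comm b a] at this
  · have := hw.2 _ _ (hv.2 i x hx)
    rwa [add_assoc] at this

theorem lie_mem_prolong (N : ℕ) : ∀ (a b : ℕ) (v w : Module.End ℝ S.X), a + b ≤ N →
    v ∈ S.prolong a → w ∈ S.prolong b → ⁅v, w⁆ ∈ S.prolong (a + b - 1) := by
  induction N with
  | zero =>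
    intro a b v w hab hv hw
    obtain ⟨rfl, rfl⟩ : a = 0 ∧ b = 0 := by omega
    obtain ⟨c, rfl⟩ := Submodule.mem_span_singleton.1 hv
    obtain ⟨d, rfl⟩ := Submodule.mem_span_singleton.1 hw
    simp
  | succ N ih =>
    intro a b v w hab hv hw
    match a, b with
    | 0, 0 =>
      obtain ⟨c, rfl⟩ := Submodule.mem_span_singleton.1 hv
      obtain ⟨d, rfl⟩ := Submodule.mem_span_singleton.1 hw
      simp
    | 0, b + 1 =>
      obtain ⟨c, rfl⟩ := Submodule.mem_span_singleton.1 hv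
      rw [smul_lie, ← lie_skew, zero_add, Nat.add_sub_cancel]
      exact Submodule.smul_mem _ _ (Submodule.neg_mem _ hw.2)
    | a + 1, 0 =>
      obtain ⟨c, rfl⟩ := Submodule.mem_span_singleton.1 hw
      rw [lie_smul, add_zero, Nat.add_sub_cancel]
      exact Submodule.smul_mem _ _ hv.2
    | a + 1, b + 1 =>
      have e : a + 1 + (b + 1) - 1 = (a + b) + 1 := by omega
      rw [e]
      refine ⟨?_, ?_⟩
      · have := S.lie_mem_cspDeg hv.1 hw.1
        exact_mod_cast this
      · have h1 := ih (a + 1) b v _ (by omega) hv hw.2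
        have h2 := ih (b + 1) a w _ (by omega) hw hv.2
        rw [show a + 1 + b - 1 = a + b by omega] at h1
        rw [show b + 1 + a - 1 = a + b by omega] at h2
        rw [lie_lie]
        exact Submodule.sub_mem _ h1 h2

/-- The universal algebraic prolongation `𝔲^F(δ) = ⨁_{k ≥ -1} 𝔲_k` of the symbol in `csp(X)`. -/
def uF : LieSubalgebra ℝ (Module.End ℝ S.X) where
  toSubmodule := ⨆ k, S.prolong k
  lie_mem' := by
    intro v w hv hw
    change v ∈ ⨆ k, S.prolong k at hv
    change w ∈ ⨆ k, S.prolong k at hw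
    change ⁅v, w⁆ ∈ ⨆ k, S.prolong k
    induction hv using Submodule.iSup_induction' with
    | mem a v hv =>
      induction hw using Submodule.iSup_induction' with
      | mem b w hw => exact Submodule.mem_iSup_of_mem _ (S.lie_mem_prolong _ a b v w le_rfl hv hw)
      | zero => simp
      | add w w' _ _ h h' => rw [lie_add]; exact Submodule.add_mem _ h h'
    | zero => simp
    | add v v' _ _ h h' => rw [add_lie]; exact Submodule.add_mem _ h h'

/-! ### The Heisenberg algebra and universal Tanaka prolongations -/

/-- The Heisenberg algebra `η = η^{-1} ⊕ η^{-2}` with `η^{-1} = X` and `η^{-2} = ℝ`, with bracket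
`[x, y] = σ(x, y) ∈ η^{-2}` for `x, y ∈ X`. -/
def Heis : Type := S.X × ℝ

namespace Heis

instance : AddCommGroup (Heis S) := inferInstanceAs (AddCommGroup (S.X × ℝ))

instance : Module ℝ (Heis S) := inferInstanceAs (Module ℝ (S.X × ℝ))

/-- The inclusion `X = η^{-1} → η`. -/
def ofX : S.X →ₗ[ℝ] Heis S := LinearMap.inl ℝ S.X ℝ

/-- The inclusion `ℝ = η^{-2} → η`. -/
def ofR : ℝ →ₗ[ℝ] Heis S := LinearMap.inr ℝ S.X ℝ

instance : Bracket (Heis S) (Heis S) where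
  bracket u v := ofR S (S.σ u.1 v.1)

theorem bracket_def (u v : Heis S) : ⁅u, v⁆ = ofR S (S.σ u.1 v.1) := rfl

theorem add_fst (u v : Heis S) : (u + v).1 = u.1 + v.1 := rfl

theorem smul_fst (c : ℝ) (u : Heis S) : (c • u).1 = c • u.1 := rfl

theorem ofR_fst (c : ℝ) : (ofR S c).1 = 0 := rfl

instance : LieRing (Heis S) where
  add_lie u v w := by simp only [bracket_def, add_fst, map_add, LinearMap.add_apply]
  lie_add u v w := by simp only [bracket_def, add_fst, map_add]
  lie_self u := by simp only [bracket_def, S.σ_self, map_zero]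
  leibniz_lie u v w := by
    simp only [bracket_def, ofR_fst, map_zero, LinearMap.zero_apply, add_zero]

instance : LieAlgebra ℝ (Heis S) where
  lie_smul c u v := by simp only [bracket_def, smul_fst, map_smul]

end Heis

/-- Let `𝔤⁰` be a Lie subalgebra of `csp(X)`, acting on `η` by grading-preserving derivations.
`ProlongationAlgebra S 𝔤⁰ L` is the structure on `L` of a graded Lie algebra
`L = ⨁_{i ∈ ℤ} L^i` whose non-positive part is (identified with) the graded Lie algebra
`η^{-2} ⊕ η^{-1} ⊕ 𝔤⁰` and which is non-degenerate: for every nonzero `x ∈ L^i` with `i ≥ 0`, there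
is `y ∈ η` with `[x, y] ≠ 0`. Since `X = η^{-1}` generates `η`, the action of `𝔤⁰` on `η`
is determined by its action on `X`, which is the given one. -/
structure ProlongationAlgebra (g0 : LieSubalgebra ℝ (Module.End ℝ S.X)) (L : Type)
    [LieRing L] [LieAlgebra ℝ L] where
  gr : ℤ → Submodule ℝ L
  isInternal : DirectSum.IsInternal gr
  lie_mem : ∀ i j x y, x ∈ gr i → y ∈ gr j → ⁅x, y⁆ ∈ gr (i + j)
  incl : Heis S →ₗ⁅ℝ⁆ L
  incl_injective : Function.Injective incl
  incl0 : g0 →ₗ⁅ℝ⁆ L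
  incl0_injective : Function.Injective incl0
  gr_lt : ∀ i, i < -2 → gr i = ⊥
  gr_neg_two : gr (-2) = LinearMap.range ((incl : Heis S →ₗ[ℝ] L) ∘ₗ Heis.ofR S)
  gr_neg_one : gr (-1) = LinearMap.range ((incl : Heis S →ₗ[ℝ] L) ∘ₗ Heis.ofX S)
  gr_zero : gr 0 = LinearMap.range (incl0 : g0 →ₗ[ℝ] L)
  lie_incl : ∀ (A : g0) (x : S.X),
    ⁅incl0 A, incl (Heis.ofX S x)⁆ = incl (Heis.ofX S ((A : Module.End ℝ S.X) x))
  nondegenerate : ∀ i, 0 ≤ i → ∀ x ∈ gr i, (∀ y : Heis S, ⁅x, incl y⁆ = 0) → x = 0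

/-- `L` is (isomorphic to) the universal algebraic prolongation `𝔲(η, 𝔤⁰)` of the pair `(η, 𝔤⁰)`,
that is, the maximal non-degenerate graded Lie algebra containing `η ⊕ 𝔤⁰` as its non-positive
part: `L` carries such a structure, and every other graded Lie algebra of this kind embeds in `L`
by a homomorphism of graded Lie algebras which is the identity on `η ⊕ 𝔤⁰`. -/
def IsUniversalProlongation (g0 : LieSubalgebra ℝ (Module.End ℝ S.X)) (L : Type)
    [LieRing L] [LieAlgebra ℝ L] : Prop :=
  ∃ P : ProlongationAlgebra S g0 L,
    ∀ (L' : Type) [LieRing L'] [LieAlgebra ℝ L'] (Q : ProlongationAlgebra S g0 L'),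
      ∃ f : L' →ₗ⁅ℝ⁆ L, Function.Injective f ∧ (∀ i, ∀ x ∈ Q.gr i, f x ∈ P.gr i) ∧
        (∀ y, f (Q.incl y) = P.incl y) ∧ ∀ A, f (Q.incl0 A) = P.incl0 A

/-- The first Tanaka algebraic prolongation `𝔲^1(η, 𝔤⁰)`: the space of all
`f ∈ Hom(η^{-1}, 𝔤⁰) ⊕ Hom(η^{-2}, η^{-1})` with `f [v₁, v₂] = [f v₁, v₂] + [v₁, f v₂]` for
`v₁, v₂ ∈ η`.
The first condition is this identity for `v₁ = x` and `v₂ = y` in `X`. The second is the identity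
for `v₁ = x ∈ X` and `v₂ ∈ η^{-2}`, namely `0 = [f x, v₂] + [x, f v₂]`, written for `v₂ = [y, y']`,
where `[A, [y, y']] = [A y, y'] + [y, A y']` for `A ∈ 𝔤⁰`. For `v₁, v₂ ∈ η^{-2}` it is trivial. -/
def firstProlongation (g0 : LieSubalgebra ℝ (Module.End ℝ S.X)) :
    Submodule ℝ ((S.X →ₗ[ℝ] g0) × (ℝ →ₗ[ℝ] S.X)) where
  carrier := {f |
    (∀ x y, f.2 (S.σ x y) = (f.1 x : Module.End ℝ S.X) y - (f.1 y : Module.End ℝ S.X) x) ∧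
    ∀ x y y', 0 = (S.σ ((f.1 x : Module.End ℝ S.X) y) y' + S.σ y ((f.1 x : Module.End ℝ S.X) y'))
      + S.σ x (f.2 (S.σ y y'))}
  zero_mem' := by simp
  add_mem' := by
    rintro f g ⟨hf, hf'⟩ ⟨hg, hg'⟩
    constructor
    · intro x y
      simp only [Prod.fst_add, Prod.snd_add, LinearMap.add_apply, AddMemClass.coe_add, hf, hg]
      abel
    · intro x y y'
      simp only [Prod.fst_add, Prod.snd_add, LinearMap.add_apply, AddMemClass.coe_add, map_add]
      linear_combination hf' x y y' + hg' x y y'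
  smul_mem' := by
    rintro c f ⟨hf, hf'⟩
    constructor
    · intro x y
      simp only [Prod.smul_fst, Prod.smul_snd, LinearMap.smul_apply, SetLike.val_smul, hf,
        smul_sub]
    · intro x y y'
      simp only [Prod.smul_fst, Prod.smul_snd, LinearMap.smul_apply, SetLike.val_smul,
        map_smul, smul_eq_mul]
      linear_combination c * hf' x y y'

end FlagSymbol

/-! ## Distributions on open subsets of `ℝⁿ` and their abnormal extremals -/

/-- The cotangent bundle of `ℝⁿ`; its points are the pairs `(q, p)`, and it is also its own
tangent space at each of its points. -/
abbrev Cot (n : ℕ) : Type :=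
  EuclideanSpace ℝ (Fin n) × (EuclideanSpace ℝ (Fin n) →L[ℝ] ℝ)

namespace LocalDist

variable {n : ℕ} (U : Set (EuclideanSpace ℝ (Fin n)))
  (D : EuclideanSpace ℝ (Fin n) → Submodule ℝ (EuclideanSpace ℝ (Fin n)))

/-- `D` is a smooth distribution of rank `r` on the open set `U`. -/
def IsDistribution (r : ℕ) : Prop :=
  ∀ q ∈ U, ∃ V : Set (EuclideanSpace ℝ (Fin n)), IsOpen V ∧ q ∈ V ∧ V ⊆ U ∧
    ∃ X : Fin r → EuclideanSpace ℝ (Fin n) → EuclideanSpace ℝ (Fin n),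
      (∀ a, ContDiffOn ℝ ∞ (X a) V) ∧
      ∀ y ∈ V, LinearIndependent ℝ (fun a => X a y) ∧
        Submodule.span ℝ (Set.range fun a => X a y) = D y

/-- Smooth sections of `D` over `U`. -/
def IsSection (X : EuclideanSpace ℝ (Fin n) → EuclideanSpace ℝ (Fin n)) : Prop :=
  ContDiffOn ℝ ∞ X U ∧ ∀ y ∈ U, X y ∈ D y

/-- The square `D²(q) = (D + [D, D])(q)`. -/
def square (q : EuclideanSpace ℝ (Fin n)) : Submodule ℝ (EuclideanSpace ℝ (Fin n)) :=
  Submodule.span ℝ {v | (∃ X, IsSection U D X ∧ v = X q) ∨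
    ∃ X Y, IsSection U D X ∧ IsSection U D Y ∧ v = VectorField.lieBracket ℝ X Y q}

/-- The canonical symplectic form `σ̂ = dς` of the cotangent bundle, `ς = p dq` being the Liouville
form: `σ̂((v, w), (v', w')) = w v' - w' v`. -/
noncomputable def sympl (n : ℕ) : Cot n →ₗ[ℝ] Cot n →ₗ[ℝ] ℝ :=
  LinearMap.mk₂ ℝ (fun u u' => u.2 u'.1 - u'.2 u.1)
    (by intro u u' v; simp; ring)
    (by intro c u v; simp; ring)
    (by intro u v v'; simp; ring)
    (by intro c u v; simp; ring)

/-- The quasi-impulse `H_X(q, p) = p (X q)` of a vector field. -/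
noncomputable def impulse (X : EuclideanSpace ℝ (Fin n) → EuclideanSpace ℝ (Fin n)) (μ : Cot n) : ℝ :=
  μ.2 (X μ.1)

/-- The annihilator `D^⊥` in the cotangent bundle of `U`, that is, the common zero set of
the functions `H_X`, `X` a section of `D`. -/
def ann : Set (Cot n) := {μ | μ.1 ∈ U ∧ ∀ v ∈ D μ.1, μ.2 v = 0}

/-- The tangent space of the submanifold `D^⊥` at `μ ∈ D^⊥`: the common kernel of the differentials
of the functions `H_X`, `X` a section of `D`. -/
noncomputable def tangentAnn (μ : Cot n) : Submodule ℝ (Cot n) :=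
  ⨅ (X : EuclideanSpace ℝ (Fin n) → EuclideanSpace ℝ (Fin n)) (_ : IsSection U D X),
    LinearMap.ker (fderiv ℝ (impulse X) μ : Cot n →ₗ[ℝ] ℝ)

/-- The kernel of the restriction of `σ̂` to the tangent space of `D^⊥` at `μ`; on `W_D` this is the
characteristic line. -/
noncomputable def charKer (μ : Cot n) : Submodule ℝ (Cot n) where
  carrier := {u | u ∈ tangentAnn U D μ ∧ ∀ u' ∈ tangentAnn U D μ, sympl n u u' = 0}
  zero_mem' := ⟨Submodule.zero_mem _, by simp⟩
  add_mem' := by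
    rintro u v ⟨hu, hu'⟩ ⟨hv, hv'⟩
    refine ⟨Submodule.add_mem _ hu hv, fun w hw => ?_⟩
    rw [map_add, LinearMap.add_apply, hu' w hw, hv' w hw, add_zero]
  smul_mem' := by
    rintro c u ⟨hu, hu'⟩
    refine ⟨Submodule.smul_mem _ c hu, fun w hw => ?_⟩
    rw [map_smul, LinearMap.smul_apply, hu' w hw, smul_zero]

/-- The set `W_D` of a distribution of odd rank (where the degeneracy locus of `σ̂` restricted to
`D^⊥` is the whole of `D^⊥`): the points of `D^⊥` at which this kernel is one-dimensional. -/
def regularSet : Set (Cot n) :=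
  {μ | μ ∈ ann U D ∧ Module.finrank ℝ (charKer U D μ) = 1}

/-- The lift `Ĵ` of `D` to `W_D`: the tangent vectors of `D^⊥` whose projection to `ℝⁿ` is
in `D`. -/
noncomputable def lift (μ : Cot n) : Submodule ℝ (Cot n) :=
  tangentAnn U D μ ⊓
    (D μ.1).comap (LinearMap.fst ℝ (EuclideanSpace ℝ (Fin n))
      (EuclideanSpace ℝ (Fin n) →L[ℝ] ℝ))

/-- The kernel of the Liouville form `ς` on the tangent space of `D^⊥` at `μ`. -/
noncomputable def liouvilleKer (μ : Cot n) : Submodule ℝ (Cot n) :=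
  tangentAnn U D μ ⊓
    LinearMap.ker ((μ.2 : EuclideanSpace ℝ (Fin n) →ₗ[ℝ] ℝ) ∘ₗ
      LinearMap.fst ℝ (EuclideanSpace ℝ (Fin n)) (EuclideanSpace ℝ (Fin n) →L[ℝ] ℝ))

/-! ### The space of regular abnormal extremals and Jacobi curves -/

/-- Local data at a point `μ₀ ∈ W_D` which exhibit the space `𝒩` of regular abnormal extremals near
the extremal `γ` through `μ₀`.

`Ψ` is the composition of the projectivization `W_D → ℙW_D` (whose fibres are tangent to the
Euler field `(0, p)`), and of the quotient map of `ℙW_D` by the characteristic foliation, in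
local coordinates on `𝒩`: it is a submersion of a neighbourhood `O ∩ W_D` of `μ₀` to
`ℝᵐ` such that the kernel of its differential is spanned by the characteristic line and the Euler
field. `γ` is a parametrized segment of the regular abnormal extremal through `μ₀`. `form` is a
bilinear form on `T_γ 𝒩 = ℝᵐ` which represents the canonical conformal symplectic structure of the
contact hyperplane `Δ(γ) = dΨ(ker ς)`, i.e. the form induced by `σ̂`. -/
structure ExtremalChart (μ₀ : Cot n) where
  m : ℕ
  O : Set (Cot n)
  isOpen_O : IsOpen O
  mem_O : μ₀ ∈ O
  Ψ : Cot n → EuclideanSpace ℝ (Fin m)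
  smooth_Ψ : ContDiffOn ℝ ∞ Ψ O
  map_Ψ : ∀ μ ∈ O ∩ regularSet U D,
    (tangentAnn U D μ).map (fderiv ℝ Ψ μ : Cot n →ₗ[ℝ] EuclideanSpace ℝ (Fin m)) = ⊤
  ker_Ψ : ∀ μ ∈ O ∩ regularSet U D, ∀ u ∈ tangentAnn U D μ,
    fderiv ℝ Ψ μ u = 0 ↔ u ∈ charKer U D μ ⊔ Submodule.span ℝ {((0, μ.2) : Cot n)}
  ε : ℝ
  ε_pos : 0 < ε
  γ : ℝ → Cot n
  smooth_γ : ContDiffOn ℝ ∞ γ (Set.Ioo (-ε) ε)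
  γ_zero : γ 0 = μ₀
  γ_mem : ∀ t ∈ Set.Ioo (-ε) ε, γ t ∈ O ∩ regularSet U D
  deriv_γ : ∀ t ∈ Set.Ioo (-ε) ε, deriv γ t ∈ charKer U D (γ t) ∧ deriv γ t ≠ 0
  form : EuclideanSpace ℝ (Fin m) →ₗ[ℝ] EuclideanSpace ℝ (Fin m) →ₗ[ℝ] ℝ
  form_eq : ∀ u ∈ liouvilleKer U D μ₀, ∀ u' ∈ liouvilleKer U D μ₀,
    form (fderiv ℝ Ψ μ₀ u) (fderiv ℝ Ψ μ₀ u') = sympl n u u'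

/-- Smooth sections over the interval `I` of the tautological bundle over a curve `Λ` of subspaces
of `V`. -/
def IsCurveSection {V : Type*} [NormedAddCommGroup V] [NormedSpace ℝ V]
    (I : Set ℝ) (Λ : ℝ → Submodule ℝ V) (v : ℝ → V) : Prop :=
  ContDiffOn ℝ ∞ v I ∧ ∀ t ∈ I, v t ∈ Λ t

/-- The `j`-th osculating subspace `Λ^{(j)}(t)` of a curve `Λ` of subspaces: `Λ^{(0)}(t) = Λ(t)`, and
`Λ^{(j)}(t)` is spanned by the derivatives of order at most `j` at `t` of smooth sections. -/
def osculating {V : Type*} [NormedAddCommGroup V] [NormedSpace ℝ V]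
    (I : Set ℝ) (Λ : ℝ → Submodule ℝ V) (j : ℕ) (t : ℝ) : Submodule ℝ V :=
  Λ t ⊔ Submodule.span ℝ {w | ∃ v, IsCurveSection I Λ v ∧ ∃ i ≤ j, w = iteratedDeriv i v t}

namespace ExtremalChart

variable {U D} {μ₀ : Cot n} (C : ExtremalChart U D μ₀)

/-- The contact hyperplane `Δ(γ)`. -/
noncomputable def contact : Submodule ℝ (EuclideanSpace ℝ (Fin C.m)) :=
  (liouvilleKer U D μ₀).map (fderiv ℝ C.Ψ μ₀ : Cot n →ₗ[ℝ] EuclideanSpace ℝ (Fin C.m))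

/-- The skew-orthogonal complement in `Δ(γ)`. -/
noncomputable def skewCompl (A : Submodule ℝ (EuclideanSpace ℝ (Fin C.m))) :
    Submodule ℝ (EuclideanSpace ℝ (Fin C.m)) where
  carrier := {a | a ∈ C.contact ∧ ∀ b ∈ A, C.form a b = 0}
  zero_mem' := ⟨Submodule.zero_mem _, by simp⟩
  add_mem' := by
    rintro u v ⟨hu, hu'⟩ ⟨hv, hv'⟩
    refine ⟨Submodule.add_mem _ hu hv, fun w hw => ?_⟩
    rw [map_add, LinearMap.add_apply, hu' w hw, hv' w hw, add_zero]
  smul_mem' := by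
    rintro c u ⟨hu, hu'⟩
    refine ⟨Submodule.smul_mem _ c hu, fun w hw => ?_⟩
    rw [map_smul, LinearMap.smul_apply, hu' w hw, smul_zero]

/-- The Jacobi curve `t ↦ J(γ(t)) = dΨ(Ĵ(γ(t))) ⊆ Δ(γ)`. -/
noncomputable def jacobi (t : ℝ) : Submodule ℝ (EuclideanSpace ℝ (Fin C.m)) :=
  (lift U D (C.γ t)).map (fderiv ℝ C.Ψ (C.γ t) : Cot n →ₗ[ℝ] EuclideanSpace ℝ (Fin C.m))

/-- The extended Jacobi curve `t ↦ {J^i(γ(t))}` in the case of odd rank: `J^{-i} = J^{(i)}` for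
`i ≥ 0` and `J^i = (J^{1-i})^∠` for `i > 0`. -/
noncomputable def flag (i : ℤ) (t : ℝ) : Submodule ℝ (EuclideanSpace ℝ (Fin C.m)) :=
  if i ≤ 0 then osculating (Set.Ioo (-C.ε) C.ε) C.jacobi (-i).toNat t
  else C.skewCompl (osculating (Set.Ioo (-C.ε) C.ε) C.jacobi (i - 1).toNat t)

/-- `μ₀` is a regular point of the extended Jacobi curve. -/
def IsRegularPoint : Prop :=
  ∀ i, ∀ᶠ t in nhds (0 : ℝ),
    Module.finrank ℝ (C.flag i t) = Module.finrank ℝ (C.flag i 0)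

/-- `μ₀` is a point of maximal class of the extended Jacobi curve. -/
def IsMaximalClassPoint : Prop := ∃ ν, C.flag ν 0 = C.contact

/-- The graded pieces `Gr^i(μ₀) = J^i(μ₀) / J^{i+1}(μ₀)`. -/
abbrev Gr (i : ℤ) : Type :=
  (C.flag i 0) ⧸ (C.flag (i + 1) 0).submoduleOf (C.flag i 0)

/-- The class in `Gr^i(μ₀)` of a vector of `J^i(μ₀)`. -/
noncomputable def toGr (i : ℤ) (v : EuclideanSpace ℝ (Fin C.m)) (hv : v ∈ C.flag i 0) : C.Gr i :=
  Submodule.Quotient.mk ⟨v, hv⟩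

/-- The symplectic flag symbol at `μ₀` of the extended Jacobi curve is isomorphic to `S`: there is a
graded isomorphism `φ : X → Gr(μ₀) = ⨁ Gr^i(μ₀)` which respects the conformal symplectic structures
(that of `Gr(μ₀)` is induced by the form on `Δ(γ)` via `Gr^i × Gr^{-i} → ℝ`), and which
conjugates the line `ℝ δ` to the tangent line of the extended Jacobi curve, namely the line of
the degree `-1` endomorphism of `Gr(μ₀)` that sends the class of `ℓ(0)` in `Gr^i(μ₀)` to the class
of `ℓ'(0)` in `Gr^{i-1}(μ₀)`, for every smooth section `ℓ` of `J^i`. -/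
def HasFlagSymbol (S : FlagSymbol) : Prop :=
  ∃ φ : ∀ i, S.gr i ≃ₗ[ℝ] C.Gr i,
    (∃ c : ℝ, c ≠ 0 ∧ ∀ (i : ℤ) (x : S.gr i) (y : S.gr (-i)) (u v)
      (hu : u ∈ C.flag i 0) (hv : v ∈ C.flag (-i) 0),
      C.toGr i u hu = φ i x → C.toGr (-i) v hv = φ (-i) y →
        C.form u v = c * S.σ x y) ∧
    ∃ c : ℝ, c ≠ 0 ∧ ∀ (i : ℤ) (x : S.gr i) (v : ℝ → EuclideanSpace ℝ (Fin C.m)),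
      IsCurveSection (Set.Ioo (-C.ε) C.ε) (C.flag i) v →
      ∀ h0 : v 0 ∈ C.flag i 0, C.toGr i (v 0) h0 = φ i x →
        ∃ h1 : deriv v 0 ∈ C.flag (i - 1) 0,
          C.toGr (i - 1) (deriv v 0) h1 = c • φ (i - 1) ⟨S.δ x, S.δ_gr i x x.2⟩

end ExtremalChart

/-- A property `Q` holds at all points of a nonempty Zariski open subset of the fibre of `ℙW_D`
over `q`, which is given by the non-vanishing of a homogeneous polynomial in the coordinates of
the covectors (every nonempty Zariski open subset contains one of this form). -/
def Generically (q : EuclideanSpace ℝ (Fin n)) (Q : Cot n → Prop) : Prop :=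
  ∃ (d : ℕ) (F : MvPolynomial (Fin n) ℝ), F.IsHomogeneous d ∧
    (∃ p, (q, p) ∈ regularSet U D ∧
      MvPolynomial.eval (fun a => p (EuclideanSpace.single a 1)) F ≠ 0) ∧
    ∀ p, (q, p) ∈ regularSet U D →
      MvPolynomial.eval (fun a => p (EuclideanSpace.single a 1)) F ≠ 0 → Q (q, p)

/-- `D` (of odd rank) is of maximal class at `q`: the generic points of `W_D` over `q` are points of
maximal class (in terms of any local description of the space of abnormal extremals). -/
def IsOfMaximalClassAt (q : EuclideanSpace ℝ (Fin n)) : Prop :=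
  Generically U D q fun μ => ∀ C : ExtremalChart U D μ, C.IsMaximalClassPoint

/-- `S` is the Jacobi symbol of `D` (of odd rank) at `q`: the symplectic flag symbols of the extended
Jacobi curves at the generic points of `W_D` over `q`, which are regular points of these curves, are
isomorphic to `S`. -/
def HasJacobiSymbolAt (q : EuclideanSpace ℝ (Fin n)) (S : FlagSymbol) : Prop :=
  Generically U D q fun μ => ∃ C : ExtremalChart U D μ, C.IsRegularPoint ∧ C.HasFlagSymbol S

end LocalDist

/-! ## Distributions on manifolds -/

section Manifold

variable {n : ℕ} {M : Type*} [TopologicalSpace M] [ChartedSpace (EuclideanSpace ℝ (Fin n)) M]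
  (D : ∀ x : M, Submodule ℝ (TangentSpace (𝓡 n) x))

/-- The domain in `ℝⁿ` of the preferred chart at `q`. -/
def chartDomain (q : M) : Set (EuclideanSpace ℝ (Fin n)) := (extChartAt (𝓡 n) q).target

/-- The expression of a distribution `D ⊆ TM` in the preferred chart at `q`. -/
noncomputable def chartDist (q : M) (y : EuclideanSpace ℝ (Fin n)) :
    Submodule ℝ (EuclideanSpace ℝ (Fin n)) :=
  (D ((extChartAt (𝓡 n) q).symm y)).comap
    (mfderiv 𝓘(ℝ, EuclideanSpace ℝ (Fin n)) (𝓡 n)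
      (extChartAt (𝓡 n) q).symm y).toLinearMap

/-- `D` is a rank `r` distribution on the `n`-dimensional manifold `M`, i.e. an
`(r, n)`-distribution. -/
def IsDistributionOfRank (r : ℕ) : Prop :=
  ∀ q : M, LocalDist.IsDistribution (chartDomain q) (chartDist D q) r

/-- The square `D²` at `q` (in the preferred chart at `q`). -/
noncomputable def squareAt (q : M) : Submodule ℝ (EuclideanSpace ℝ (Fin n)) :=
  LocalDist.square (chartDomain q) (chartDist D q) (extChartAt (𝓡 n) q q)

/-- `D` (of odd rank) is of maximal class at `q`. -/
def IsOfMaximalClass (q : M) : Prop :=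
  LocalDist.IsOfMaximalClassAt (chartDomain q) (chartDist D q) (extChartAt (𝓡 n) q q)

/-- `S` is the Jacobi symbol of `D` (of odd rank) at `q`. -/
def HasJacobiSymbol (q : M) (S : FlagSymbol) : Prop :=
  LocalDist.HasJacobiSymbolAt (chartDomain q) (chartDist D q) (extChartAt (𝓡 n) q q) S

end Manifold

/-! The theorem splits into a pointwise dimension count on $D^\perp$ over $q$ and pure algebra of
the symbol $\delta_{s,2s}$.

Geometry. Over $q$ everything is read off from the first jet of a local frame of $D$ (`FrameJet`).
The skew $3\times 3$ matrix `curv p` of the brackets of the frame, evaluated on $p$, determines the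
characteristic kernel, which is a line exactly when this matrix is nonzero. The lift of $D$ then has
dimension $n$ and its skew complement in $TD^\perp$ has dimension $n-2$; dividing by the
characteristic line and the Euler field gives $\dim J^0=n-2$ and $\dim J^1=n-4$. A rectangular
diagram has all its rows in the columns $-s,\dots,s$, so the symbol is a sum of $k$ copies of
$\delta_{s,2s}$, and $2k=\dim J^0/J^1=2$ gives $k=1$. By maximal class the flag reaches $0$ in
positive degrees; summing the two-dimensional pieces of degrees $0,\dots,s$ gives $n-2=2(s+1)$
(`exists_iso_of_isRectangular`). Finally $\dim D^2=6$ forces $n\ge 6$, that is $s\ge 1$.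

The algebra $\mathfrak u^F(\delta)$. On $\mathbb R^{2s+1}\otimes\mathbb R^2$ the symbol is, up to
scale, the lowering operator of an irreducible $\mathfrak{sl}_2$-module. Commuting with it is a
difference operator along each diagonal of matrix entries. Hence an operator of nonnegative degree
commuting with $\delta$ is determined by the first entries of its diagonal (`eq_zero_of_lie_δ`), and
commutators with $\delta$ have vanishing diagonal sums (`sum_entry_lie_δ`). These two facts bound
$\mathfrak u_0$ and $\mathfrak u_1$, kill $\mathfrak u_k$ for $k\ge 2$, and leave
$\mathfrak{sl}_2\times\mathfrak{gl}_2$.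

Tanaka prolongation. A prolongation algebra is universal as soon as every derivation of positive
degree from $\eta$ into it is inner (`IsComplete`, `isUniversal_of_isComplete`): the graph of the
comparison map from any competitor is built degree by degree. For $s\ge 2$, restriction of a degree
one derivation to a Lagrangian $E_1\otimes\varepsilon_i$ reduces the problem to the classical first
prolongation of $\mathfrak{sl}_2\times\mathbb R$ on $\mathbb R^{2s+1}$, which vanishes; so the
semidirect sum with no positive part is complete. For $s=1$ one has
$\mathfrak{sl}_2\cong\mathfrak{so}(2,1)$ on $\mathbb R^3$, and the negative part together with
$\mathfrak{sl}_2\times\mathfrak{gl}_2$ is the nonpositive part of the contact grading of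
$\mathfrak{so}(4,3)$; completeness is checked in degrees $1$, $2$, $3$ and is trivial above. -/

namespace FlagSymbol

/-! ### Comparison of prolongation algebras and a criterion for universality -/

namespace ProlongationAlgebra

variable {S : FlagSymbol} {g0 : LieSubalgebra ℝ (Module.End ℝ S.X)}
  {L : Type} [LieRing L] [LieAlgebra ℝ L] (P : ProlongationAlgebra S g0 L)
  {L' : Type} [LieRing L'] [LieAlgebra ℝ L'] (Q : ProlongationAlgebra S g0 L')

/-- The inclusion of `X = η^{-1}`. -/
def inclX : S.X →ₗ[ℝ] L := (P.incl : Heis S →ₗ[ℝ] L) ∘ₗ Heis.ofX S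

/-- The inclusion of `ℝ = η^{-2}`. -/
def inclR : ℝ →ₗ[ℝ] L := (P.incl : Heis S →ₗ[ℝ] L) ∘ₗ Heis.ofR S

theorem lie_inclX (v w : S.X) : ⁅P.inclX v, P.inclX w⁆ = P.inclR (S.σ v w) := by
  change ⁅P.incl (Heis.ofX S v), P.incl (Heis.ofX S w)⁆ = P.incl (Heis.ofR S (S.σ v w))
  rw [← LieHom.map_lie]; rfl

theorem lie_inclX_inclR (v : S.X) (r : ℝ) : ⁅P.inclX v, P.inclR r⁆ = 0 := by
  change ⁅P.incl (Heis.ofX S v), P.incl (Heis.ofR S r)⁆ = 0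
  rw [← LieHom.map_lie, Heis.bracket_def, Heis.ofR_fst, map_zero, map_zero, map_zero]

theorem lie_incl0_inclX (A : g0) (v : S.X) :
    ⁅P.incl0 A, P.inclX v⁆ = P.inclX ((A : Module.End ℝ S.X) v) := P.lie_incl A v

theorem inclX_mem (v : S.X) : P.inclX v ∈ P.gr (-1) := by
  rw [P.gr_neg_one]; exact ⟨v, rfl⟩

theorem inclR_mem (r : ℝ) : P.inclR r ∈ P.gr (-2) := by
  rw [P.gr_neg_two]; exact ⟨r, rfl⟩

theorem incl0_mem (A : g0) : P.incl0 A ∈ P.gr 0 := by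
  rw [P.gr_zero]; exact ⟨A, rfl⟩

theorem incl_eq (y : Heis S) : P.incl y = P.inclX y.1 + P.inclR y.2 := by
  have : y = Heis.ofX S y.1 + Heis.ofR S y.2 := by
    apply Prod.ext
    · change y.1 = y.1 + 0; simp
    · change y.2 = 0 + y.2; simp
  conv_lhs => rw [this, map_add]
  rfl

/-- The centre is spanned by a bracket of two elements of $X$; by the Jacobi identity, brackets with
$\eta$ are thereby controlled by brackets with $X$ alone. -/
theorem inclR_eq {v w : S.X} (h : S.σ v w = 1) (r : ℝ) :
    P.inclR r = r • ⁅P.inclX v, P.inclX w⁆ := by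
  rw [lie_inclX, h, ← map_smul, smul_eq_mul, mul_one]

/-- Elements of nonnegative degree are determined by their brackets with `X = η^{-1}`. -/
theorem eq_zero_of_lie_inclX {v₀ w₀ : S.X} (h1 : S.σ v₀ w₀ = 1) {i : ℤ} (hi : 0 ≤ i) {x : L}
    (hx : x ∈ P.gr i) (h : ∀ v, ⁅x, P.inclX v⁆ = 0) : x = 0 := by
  refine P.nondegenerate i hi x hx fun y => ?_
  rw [P.incl_eq, lie_add, h, P.inclR_eq h1, lie_smul, leibniz_lie, h, h]
  simp

/-- Every homogeneous derivation of positive degree from the negative part is inner. -/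
def IsComplete : Prop :=
  ∀ (k : ℕ) (d : S.X →ₗ[ℝ] L) (u : L), (∀ v, d v ∈ P.gr k) → u ∈ P.gr ((k : ℤ) - 1) →
    (∀ v w, ⁅d v, P.inclX w⁆ - ⁅d w, P.inclX v⁆ = S.σ v w • u) →
    (∀ v, ⁅d v, P.inclR 1⁆ + ⁅P.inclX v, u⁆ = 0) →
    ∃ z ∈ P.gr ((k : ℤ) + 1), ∀ v, d v = ⁅z, P.inclX v⁆

/-- The homogeneous components of the graph of the comparison homomorphism between two
prolongation algebras, the degree being shifted by two. -/
def comparison : ℕ → Submodule ℝ (L' × L)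
  | 0 => LinearMap.range (Q.inclR.prod P.inclR)
  | 1 => LinearMap.range (Q.inclX.prod P.inclX)
  | 2 => LinearMap.range ((Q.incl0 : g0 →ₗ[ℝ] L').prod (P.incl0 : g0 →ₗ[ℝ] L))
  | k + 3 =>
    { carrier := {p | p.1 ∈ Q.gr (k + 1) ∧ p.2 ∈ P.gr (k + 1) ∧
        ∀ v, ⁅p, (Q.inclX v, P.inclX v)⁆ ∈ comparison (k + 2)}
      zero_mem' := ⟨Submodule.zero_mem _, Submodule.zero_mem _, fun v => by
        rw [zero_lie]; exact Submodule.zero_mem _⟩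
      add_mem' := fun ha hb => ⟨Submodule.add_mem _ ha.1 hb.1, Submodule.add_mem _ ha.2.1 hb.2.1,
        fun v => by rw [add_lie]; exact Submodule.add_mem _ (ha.2.2 v) (hb.2.2 v)⟩
      smul_mem' := fun c _ ha => ⟨Submodule.smul_mem _ c ha.1, Submodule.smul_mem _ c ha.2.1,
        fun v => by rw [smul_lie]; exact Submodule.smul_mem _ c (ha.2.2 v)⟩ }

theorem comparison_gr (k : ℕ) (p : L' × L) (hp : p ∈ comparison P Q k) :
    p.1 ∈ Q.gr ((k : ℤ) - 2) ∧ p.2 ∈ P.gr ((k : ℤ) - 2) := by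
  match k, hp with
  | 0, hp => obtain ⟨r, rfl⟩ := hp; exact ⟨Q.inclR_mem r, P.inclR_mem r⟩
  | 1, hp => obtain ⟨r, rfl⟩ := hp; exact ⟨Q.inclX_mem r, P.inclX_mem r⟩
  | 2, hp => obtain ⟨r, rfl⟩ := hp; exact ⟨Q.incl0_mem r, P.incl0_mem r⟩
  | k + 3, hp =>
    have e : ((k + 3 : ℕ) : ℤ) - 2 = k + 1 := by push_cast; ring
    rw [e]; exact ⟨hp.1, hp.2.1⟩

theorem comparison_lie_inclX (k : ℕ) (p : L' × L) (hp : p ∈ comparison P Q (k + 1)) (v : S.X) :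
    ⁅p, (Q.inclX v, P.inclX v)⁆ ∈ comparison P Q k := by
  match k, hp with
  | 0, hp =>
    obtain ⟨w, rfl⟩ := hp
    exact ⟨S.σ w v, Prod.ext (Q.lie_inclX w v).symm (P.lie_inclX w v).symm⟩
  | 1, hp =>
    obtain ⟨A, rfl⟩ := hp
    exact ⟨(A : Module.End ℝ S.X) v,
      Prod.ext (Q.lie_incl0_inclX A v).symm (P.lie_incl0_inclX A v).symm⟩
  | k + 2, hp => exact hp.2.2 v

theorem comparison_zero_lie_inclX (p : L' × L) (hp : p ∈ comparison P Q 0) (v : S.X) :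
    ⁅p, (Q.inclX v, P.inclX v)⁆ = 0 := by
  obtain ⟨w, rfl⟩ := hp
  rw [← lie_skew]
  have : ⁅(Q.inclX v, P.inclX v), (Q.inclR.prod P.inclR) w⁆ = 0 :=
    Prod.ext (Q.lie_inclX_inclR v w) (P.lie_inclX_inclR v w)
  rw [this, neg_zero]

theorem inclR_pair_eq {v₀ w₀ : S.X} (h1 : S.σ v₀ w₀ = 1) (r : ℝ) :
    ((Q.inclR.prod P.inclR) r : L' × L) =
      r • ⁅(Q.inclX v₀, P.inclX v₀), (Q.inclX w₀, P.inclX w₀)⁆ :=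
  Prod.ext (Q.inclR_eq h1 r) (P.inclR_eq h1 r)

/-- By Jacobi, a bracket with the centre is a combination of two double brackets with $X$. For `k`
at most `1` these vanish, so the truncation in `k - 2` is harmless. -/
theorem comparison_lie_inclR {v₀ w₀ : S.X} (h1 : S.σ v₀ w₀ = 1) (k : ℕ) (p : L' × L)
    (hp : p ∈ comparison P Q k) (r : ℝ) :
    ⁅p, (Q.inclR.prod P.inclR) r⁆ ∈ comparison P Q (k - 2) := by
  rw [inclR_pair_eq P Q h1, lie_smul, leibniz_lie, ← lie_skew (Q.inclX v₀, P.inclX v₀)]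
  refine Submodule.smul_mem _ _ (Submodule.add_mem _ ?_ (Submodule.neg_mem _ ?_))
  all_goals
    match k, hp with
    | 0, hp => rw [comparison_zero_lie_inclX P Q p hp, zero_lie]; exact Submodule.zero_mem _
    | 1, hp =>
      rw [comparison_zero_lie_inclX P Q _ (comparison_lie_inclX P Q 0 p hp _)]
      exact Submodule.zero_mem _
    | k + 2, hp =>
      exact comparison_lie_inclX P Q k _ (comparison_lie_inclX P Q (k + 1) p hp _) _

/-- In positive degree, membership in the graph is tested by bracketing with $X$, and Jacobi turns
$[[p,q],v]$ into brackets with smaller `a + b`. The shift of degrees by two makes the index of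
$[p,q]$ equal to `a + b - 2`. -/
theorem comparison_lie {v₀ w₀ : S.X} (h1 : S.σ v₀ w₀ = 1) (N : ℕ) :
    ∀ (a b : ℕ) (p q : L' × L), a + b ≤ N → p ∈ comparison P Q a → q ∈ comparison P Q b →
      ⁅p, q⁆ ∈ comparison P Q (a + b - 2) := by
  induction N with
  | zero =>
    intro a b p q hab hp hq
    obtain ⟨rfl, rfl⟩ : a = 0 ∧ b = 0 := by omega
    obtain ⟨r, rfl⟩ := hq
    exact comparison_lie_inclR P Q h1 0 p hp r
  | succ N ih =>
    intro a b p q hab hp hq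
    match a, b, hp, hq with
    | a, 0, hp, hq => obtain ⟨r, rfl⟩ := hq; exact comparison_lie_inclR P Q h1 a p hp r
    | 0, b, hp, hq =>
      obtain ⟨r, rfl⟩ := hp
      rw [← lie_skew, zero_add]
      exact Submodule.neg_mem _ (comparison_lie_inclR P Q h1 b q hq r)
    | 1, 1, hp, hq => obtain ⟨v, rfl⟩ := hq; exact comparison_lie_inclX P Q 0 p hp v
    | a + 2, 1, hp, hq => obtain ⟨v, rfl⟩ := hq; exact comparison_lie_inclX P Q _ p hp v
    | 1, b + 2, hp, hq =>
      obtain ⟨v, rfl⟩ := hp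
      rw [← lie_skew, show 1 + (b + 2) - 2 = b + 1 by omega]
      exact Submodule.neg_mem _ (comparison_lie_inclX P Q _ q hq v)
    | 2, 2, hp, hq =>
      obtain ⟨A, rfl⟩ := hp
      obtain ⟨B, rfl⟩ := hq
      exact ⟨⁅A, B⁆, Prod.ext (Q.incl0.map_lie A B) (P.incl0.map_lie A B)⟩
    | a + 2, b + 2, hp, hq =>
      -- This pattern still admits `a + b = 0`. Once that is set aside, the target index is `m + 3`,
      -- where membership is defined by brackets with $X$.
      rcases Nat.eq_zero_or_pos (a + b) with h0 | h0
      · obtain ⟨rfl, rfl⟩ : a = 0 ∧ b = 0 := by omega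
        obtain ⟨A, rfl⟩ := hp
        obtain ⟨B, rfl⟩ := hq
        exact ⟨⁅A, B⁆, Prod.ext (Q.incl0.map_lie A B) (P.incl0.map_lie A B)⟩
      obtain ⟨m, hm⟩ : ∃ m, a + b = m + 1 := ⟨a + b - 1, by omega⟩
      have e : a + 2 + (b + 2) - 2 = m + 3 := by omega
      rw [e]
      have hp' := comparison_gr P Q _ p hp
      have hq' := comparison_gr P Q _ q hq
      have e2 : ((a + 2 : ℕ) : ℤ) - 2 + (((b + 2 : ℕ) : ℤ) - 2) = m + 1 := by
        push_cast; have : (a : ℤ) + b = m + 1 := by exact_mod_cast hm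
        linarith
      refine ⟨e2 ▸ Q.lie_mem _ _ _ _ hp'.1 hq'.1, e2 ▸ P.lie_mem _ _ _ _ hp'.2 hq'.2, fun v => ?_⟩
      have h2 := ih (a + 2) (b + 1) p _ (by omega) hp (comparison_lie_inclX P Q _ q hq v)
      have h3 := ih (a + 1) (b + 2) _ q (by omega) (comparison_lie_inclX P Q _ p hp v) hq
      rw [show a + 2 + (b + 1) - 2 = m + 2 by omega] at h2
      rw [show a + 1 + (b + 2) - 2 = m + 2 by omega] at h3
      have e3 : ⁅⁅p, q⁆, (Q.inclX v, P.inclX v)⁆ = ⁅p, ⁅q, (Q.inclX v, P.inclX v)⁆⁆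
          + ⁅⁅p, (Q.inclX v, P.inclX v)⁆, q⁆ := by
        rw [lie_lie, ← lie_skew _ q, sub_eq_add_neg]
      rw [e3]
      exact Submodule.add_mem _ h2 h3

/-- The graph of the comparison homomorphism. -/
def comparisonGraph {v₀ w₀ : S.X} (h1 : S.σ v₀ w₀ = 1) : LieSubalgebra ℝ (L' × L) where
  toSubmodule := ⨆ k, comparison P Q k
  lie_mem' := by
    intro v w hv hw
    change v ∈ ⨆ k, comparison P Q k at hv
    change w ∈ ⨆ k, comparison P Q k at hw
    change ⁅v, w⁆ ∈ ⨆ k, comparison P Q k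
    induction hv using Submodule.iSup_induction' with
    | mem a v hv =>
      induction hw using Submodule.iSup_induction' with
      | mem b w hw =>
        exact Submodule.mem_iSup_of_mem _ (comparison_lie P Q h1 _ a b v w le_rfl hv hw)
      | zero => simp
      | add w w' _ _ h h' => rw [lie_add]; exact Submodule.add_mem _ h h'
    | zero => simp
    | add v v' _ _ h h' => rw [add_lie]; exact Submodule.add_mem _ h h'

/-- Nondegeneracy of `P` propagates upwards: a zero first component makes all brackets with $X$ have
zero first component, so their second components vanish by induction, and then so does the second
component itself. The graph is thus single-valued. -/
theorem comparison_eq_zero_of_fst {v₀ w₀ : S.X} (h1 : S.σ v₀ w₀ = 1) (k : ℕ) :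
    ∀ p ∈ comparison P Q k, p.1 = 0 → p.2 = 0 := by
  induction k using Nat.strong_induction_on with
  | _ k ih =>
  intro p hp h
  match k, hp, ih with
  | 0, hp, _ =>
    obtain ⟨r, rfl⟩ := hp
    have h' : Heis.ofR S r = 0 := Q.incl_injective (h.trans (map_zero _).symm)
    change P.incl (Heis.ofR S r) = 0
    rw [h', map_zero]
  | 1, hp, _ =>
    obtain ⟨r, rfl⟩ := hp
    have h' : Heis.ofX S r = 0 := Q.incl_injective (h.trans (map_zero _).symm)
    change P.incl (Heis.ofX S r) = 0
    rw [h', map_zero]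
  | 2, hp, _ =>
    obtain ⟨r, rfl⟩ := hp
    have h' : r = 0 := Q.incl0_injective (h.trans (map_zero _).symm)
    rw [h', map_zero]; rfl
  | k + 3, hp, ih =>
    refine P.eq_zero_of_lie_inclX h1 (by positivity) hp.2.1 fun v => ?_
    refine ih (k + 2) (by omega) _ (hp.2.2 v) ?_
    change ⁅p.1, Q.inclX v⁆ = 0
    rw [h, zero_lie]

theorem comparison_swap (k : ℕ) : ∀ p ∈ comparison P Q k, p.swap ∈ comparison Q P k := by
  induction k using Nat.strong_induction_on with
  | _ k ih =>
  intro p hp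
  match k, hp, ih with
  | 0, hp, _ => obtain ⟨r, rfl⟩ := hp; exact ⟨r, rfl⟩
  | 1, hp, _ => obtain ⟨r, rfl⟩ := hp; exact ⟨r, rfl⟩
  | 2, hp, _ => obtain ⟨r, rfl⟩ := hp; exact ⟨r, rfl⟩
  | k + 3, hp, ih => exact ⟨hp.2.1, hp.1, fun v => ih (k + 2) (by omega) _ (hp.2.2 v)⟩

/-- The graded pieces of `Q` are independent, so the vanishing of the first component can be read
off degree by degree. -/
theorem comparison_sum_eq_zero {v₀ w₀ : S.X} (h1 : S.σ v₀ w₀ = 1) (p : L' × L)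
    (hp : p ∈ ⨆ k, comparison P Q k) (h : p.1 = 0) : p.2 = 0 := by
  classical
  obtain ⟨f, hf, rfl⟩ := (Submodule.mem_iSup_iff_exists_finsupp _ _).1 hp
  have hind := Q.isInternal.submodule_iSupIndep
  have hinj : Function.Injective (fun k : ℕ => (k : ℤ) - 2) := fun a b h => by
    simp only at h; omega
  have hind' := hind.comp hinj
  have h0 : ∀ k, (f k).1 = 0 := by
    intro k
    by_cases hk : k ∈ f.support
    · refine (iSupIndep_iff_finsetSum_eq_zero_imp_eq_zero _).1 hind' f.support (fun i => (f i).1)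
        (fun i _ => (comparison_gr P Q i _ (hf i)).1) ?_ k hk
      rw [← Prod.fst_sum]; exact h
    · rw [Finsupp.notMem_support_iff.1 hk]; rfl
  rw [Finsupp.sum, Prod.snd_sum]
  exact Finset.sum_eq_zero fun i _ => comparison_eq_zero_of_fst P Q h1 i _ (hf i) (h0 i)

/-- Completeness enters here. An element of positive degree of `Q` acts on $\eta$ as a derivation;
by induction its values have unique partners in `P`, which form a derivation of $\eta$ into `P`.
That derivation is inner, and the element inducing it is the required partner. -/
theorem comparison_surjective (hP : P.IsComplete) {v₀ w₀ : S.X} (h1 : S.σ v₀ w₀ = 1) (k : ℕ) :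
    ∀ x ∈ Q.gr ((k : ℤ) - 2), ∃ z, (x, z) ∈ comparison P Q k := by
  induction k using Nat.strong_induction_on with
  | _ k ih =>
  intro x hx
  match k, hx, ih with
  | 0, hx, _ =>
    have hx' : x ∈ Q.gr (-2) := hx
    rw [Q.gr_neg_two] at hx'
    obtain ⟨r, rfl⟩ := hx'
    exact ⟨P.inclR r, r, rfl⟩
  | 1, hx, _ =>
    have hx' : x ∈ Q.gr (-1) := hx
    rw [Q.gr_neg_one] at hx'
    obtain ⟨r, rfl⟩ := hx'
    exact ⟨P.inclX r, r, rfl⟩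
  | 2, hx, _ =>
    have hx' : x ∈ Q.gr 0 := hx
    rw [Q.gr_zero] at hx'
    obtain ⟨r, rfl⟩ := hx'
    exact ⟨P.incl0 r, r, rfl⟩
  | k + 3, hx, ih =>
    have hx1 : x ∈ Q.gr ((k : ℤ) + 1) := by
      have e : ((k + 3 : ℕ) : ℤ) - 2 = k + 1 := by push_cast; ring
      rwa [e] at hx
    have huniq : ∀ m, ∀ y z z', (y, z) ∈ comparison P Q m → (y, z') ∈ comparison P Q m →
        z = z' := fun m y z z' h h' => sub_eq_zero.1
      (comparison_eq_zero_of_fst P Q h1 m _ (Submodule.sub_mem _ h h') (sub_self y))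
    have hex : ∀ v, ∃ z, (⁅x, Q.inclX v⁆, z) ∈ comparison P Q (k + 2) := fun v =>
      ih (k + 2) (by omega) _ (by
        have := Q.lie_mem _ _ _ _ hx1 (Q.inclX_mem v)
        convert this using 2; push_cast; ring)
    choose d hd using hex
    let d' : S.X →ₗ[ℝ] L :=
      { toFun := d
        map_add' := fun v w => huniq (k + 2) _ _ _ (hd _) (by
          rw [map_add, lie_add]; exact Submodule.add_mem _ (hd v) (hd w))
        map_smul' := fun c v => huniq (k + 2) _ _ _ (hd _) (by
          rw [map_smul, lie_smul]; exact Submodule.smul_mem _ c (hd v)) }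
    obtain ⟨u, hu⟩ : ∃ u, (⁅x, Q.inclR 1⁆, u) ∈ comparison P Q (k + 1) :=
      ih (k + 1) (by omega) _ (by
        have := Q.lie_mem _ _ _ _ hx1 (Q.inclR_mem 1)
        convert this using 2; push_cast; ring)
    -- The derivation identities hold in `Q` by Jacobi; uniqueness of partners transfers them to
    -- `P`.
    obtain ⟨z, hz, hdz⟩ := hP k d' u (fun v => by
        have := (comparison_gr P Q _ _ (hd v)).2
        rwa [show ((k + 2 : ℕ) : ℤ) - 2 = k by push_cast; ring] at this) (by
        have := (comparison_gr P Q _ _ hu).2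
        convert this using 2; push_cast; ring) (fun v w => by
        have hv := comparison_lie_inclX P Q (k + 1) _ (hd v) w
        have hw := comparison_lie_inclX P Q (k + 1) _ (hd w) v
        refine huniq (k + 1) _ _ _ (Submodule.sub_mem _ hv hw) ?_
        have e : ⁅⁅x, Q.inclX v⁆, Q.inclX w⁆ - ⁅⁅x, Q.inclX w⁆, Q.inclX v⁆ =
            S.σ v w • ⁅x, Q.inclR 1⁆ := by
          rw [← lie_smul, ← map_smul, smul_eq_mul, mul_one, ← Q.lie_inclX, leibniz_lie x,
            ← lie_skew (Q.inclX v), sub_eq_add_neg]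
        have := Submodule.smul_mem _ (S.σ v w) hu
        rw [Prod.smul_mk, ← e] at this
        exact this) (fun v => by
        have hv := comparison_lie_inclR P Q h1 (k + 2) _ (hd v) 1
        have hw := comparison_lie_inclX P Q k _ hu v
        refine comparison_eq_zero_of_fst P Q h1 k _ (Submodule.sub_mem _ hv hw) ?_ |>.symm.trans ?_
          |>.symm
        · change ⁅⁅x, Q.inclX v⁆, Q.inclR 1⁆ - ⁅⁅x, Q.inclR 1⁆, Q.inclX v⁆ = 0
          rw [lie_lie, Q.lie_inclX_inclR, lie_zero, ← lie_skew _ (Q.inclX v)]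
          simp
        · change ⁅d v, P.inclR 1⁆ - ⁅u, P.inclX v⁆ = ⁅d v, P.inclR 1⁆ + ⁅P.inclX v, u⁆
          rw [← lie_skew u, sub_neg_eq_add])
    exact ⟨z, hx1, hz, fun v => by
      have := hd v
      change (_, d' v) ∈ _ at this
      rw [hdz] at this
      exact this⟩

/-- A prolongation algebra without outer derivations of positive degree is universal. -/
theorem isUniversal_of_isComplete (hP : P.IsComplete) {v₀ w₀ : S.X} (h1 : S.σ v₀ w₀ = 1) :
    S.IsUniversalProlongation g0 L := by
  refine ⟨P, fun L' _ _ Q => ?_⟩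
  -- The homomorphism is read off from its graph `G`. The projection to `L'` is injective by
  -- nondegeneracy of `P` and surjective by completeness. The projection to `L` is injective by
  -- nondegeneracy of `Q`, through the symmetry of the construction.
  let G := comparisonGraph P Q h1
  let π : G →ₗ⁅ℝ⁆ L' := (LieHom.fst ℝ L' L).comp G.incl
  let τ : G →ₗ⁅ℝ⁆ L := (LieHom.snd ℝ L' L).comp G.incl
  have hswap : ∀ p ∈ ⨆ k, comparison P Q k, p.swap ∈ ⨆ k, comparison Q P k := by
    intro p hp
    induction hp using Submodule.iSup_induction' with
    | mem a v hv => exact Submodule.mem_iSup_of_mem a (comparison_swap P Q a v hv)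
    | zero => exact Submodule.zero_mem _
    | add v w _ _ h h' => exact Submodule.add_mem _ h h'
  have hinj : Function.Injective π := by
    refine (injective_iff_map_eq_zero _).2 fun p hp => ?_
    exact Subtype.ext (Prod.ext hp (comparison_sum_eq_zero P Q h1 _ p.2 hp))
  have hinj' : Function.Injective τ := by
    refine (injective_iff_map_eq_zero _).2 fun p hp => ?_
    exact Subtype.ext (Prod.ext (comparison_sum_eq_zero Q P h1 _ (hswap _ p.2) hp) hp)
  have hex : ∀ x k, x ∈ Q.gr ((k : ℕ) - 2) → ∃ p : G, (p : L' × L) ∈ comparison P Q k ∧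
      π p = x := fun x k hx => by
    obtain ⟨z, hz⟩ := comparison_surjective P Q hP h1 k x hx
    exact ⟨⟨(x, z), Submodule.mem_iSup_of_mem k hz⟩, hz, rfl⟩
  have hrange : ∀ x, x ∈ LinearMap.range (π : G →ₗ[ℝ] L') := by
    intro x
    have hx : x ∈ ⨆ i, Q.gr i := by rw [Q.isInternal.submodule_iSup_eq_top]; trivial
    refine (iSup_le fun i => ?_ : ⨆ i, Q.gr i ≤ LinearMap.range (π : G →ₗ[ℝ] L')) hx
    intro y hy
    rcases lt_or_ge i (-2) with hi | hi
    · rw [Q.gr_lt i hi] at hy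
      rw [(Submodule.mem_bot ℝ).1 hy]; exact Submodule.zero_mem _
    · obtain ⟨k, hk⟩ := Int.eq_ofNat_of_zero_le (show 0 ≤ i + 2 by omega)
      obtain ⟨p, -, hp⟩ := hex y k (by rwa [← show i = (k : ℤ) - 2 by omega])
      exact ⟨p, hp⟩
  let e : G ≃ₗ⁅ℝ⁆ L' := LieEquiv.ofBijective π ⟨hinj, fun x => hrange x⟩
  have key : ∀ p : G, τ (e.symm (π p)) = τ p := fun p =>
    congrArg τ (e.symm_apply_apply p)
  refine ⟨τ.comp (e.symm : L' →ₗ⁅ℝ⁆ G), hinj'.comp e.symm.injective, ?_, ?_, ?_⟩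
  · intro i x hx
    rcases lt_or_ge i (-2) with hi | hi
    · rw [Q.gr_lt i hi] at hx
      rw [(Submodule.mem_bot ℝ).1 hx, map_zero]; exact Submodule.zero_mem _
    · obtain ⟨k, hk⟩ := Int.eq_ofNat_of_zero_le (show 0 ≤ i + 2 by omega)
      obtain rfl : i = (k : ℤ) - 2 := by omega
      obtain ⟨p, hp, rfl⟩ := hex x k hx
      change τ (e.symm (π p)) ∈ _
      rw [key]
      exact (comparison_gr P Q k _ hp).2
  · intro y
    have h0 : (Q.inclX y.1, P.inclX y.1) ∈ ⨆ k, comparison P Q k :=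
      Submodule.mem_iSup_of_mem 1 ⟨y.1, rfl⟩
    have h2 : (Q.inclR y.2, P.inclR y.2) ∈ ⨆ k, comparison P Q k :=
      Submodule.mem_iSup_of_mem 0 ⟨y.2, rfl⟩
    rw [Q.incl_eq, P.incl_eq]
    exact key ⟨_, Submodule.add_mem _ h0 h2⟩
  · intro A
    exact key ⟨(Q.incl0 A, P.incl0 A), Submodule.mem_iSup_of_mem 2 ⟨A, rfl⟩⟩

end ProlongationAlgebra
end FlagSymbol

/-! ## The irreducible representation of `sl₂` of dimension `2s + 1` -/

namespace SlIrrep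

open Matrix

variable (s : ℕ)

/-- The lowering operator `e_a ↦ e_{a+1}`. -/
def lower : Matrix (Fin (2 * s + 1)) (Fin (2 * s + 1)) ℝ :=
  Matrix.of fun b a => if (b : ℕ) = a + 1 then 1 else 0

/-- The raising operator `e_a ↦ a (2s + 1 - a) e_{a-1}`. -/
def raise : Matrix (Fin (2 * s + 1)) (Fin (2 * s + 1)) ℝ :=
  Matrix.of fun b a => if (b : ℕ) + 1 = a then ((b : ℕ) + 1 : ℝ) * (2 * s - (b : ℕ)) else 0

/-- The semisimple element `e_a ↦ (2s - 2a) e_a`. -/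
def height : Matrix (Fin (2 * s + 1)) (Fin (2 * s + 1)) ℝ :=
  Matrix.diagonal fun a => 2 * s - 2 * (a : ℕ)

variable {s}
variable {m : Type*}

theorem lower_mul_apply (x : Matrix (Fin (2 * s + 1)) m ℝ) (b : Fin (2 * s + 1)) (j : m) :
    (lower s * x) b j = if h : 0 < (b : ℕ) then x ⟨b - 1, by omega⟩ j else 0 := by
  rw [Matrix.mul_apply]
  split_ifs with h
  · rw [Finset.sum_eq_single ⟨b - 1, by omega⟩]
    · simp [lower, Nat.sub_add_cancel h]
    · intro a _ ha
      have : (b : ℕ) ≠ a + 1 := fun h' => ha (Fin.ext (by simp; omega))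
      simp [lower, this]
    · simp
  · refine Finset.sum_eq_zero fun a _ => ?_
    have : (b : ℕ) ≠ a + 1 := by omega
    simp [lower, this]

theorem raise_mul_apply (x : Matrix (Fin (2 * s + 1)) m ℝ) (b : Fin (2 * s + 1)) (j : m) :
    (raise s * x) b j = if h : (b : ℕ) < 2 * s then
      ((b : ℕ) + 1 : ℝ) * (2 * s - (b : ℕ)) * x ⟨b + 1, by omega⟩ j else 0 := by
  rw [Matrix.mul_apply]
  split_ifs with h
  · rw [Finset.sum_eq_single ⟨b + 1, by omega⟩]
    · simp [raise]
    · intro a _ ha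
      have : (b : ℕ) + 1 ≠ a := fun h' => ha (Fin.ext (by simp; omega))
      simp [raise, this]
    · simp
  · refine Finset.sum_eq_zero fun a _ => ?_
    have : (b : ℕ) + 1 ≠ a := by omega
    simp [raise, this]

theorem height_mul_apply (x : Matrix (Fin (2 * s + 1)) m ℝ) (b : Fin (2 * s + 1)) (j : m) :
    (height s * x) b j = (2 * s - 2 * (b : ℕ)) * x b j := by
  rw [height, Matrix.diagonal_mul]

theorem raise_mul_lower_sub : raise s * lower s - lower s * raise s = height s := by
  ext b a
  rw [Matrix.sub_apply, raise_mul_apply, lower_mul_apply]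
  by_cases hab : b = a
  · subst hab
    simp only [lower, raise, height, Matrix.of_apply, Matrix.diagonal_apply_eq]
    have hb := b.2
    split_ifs with h1 h2 h3 h4 h5
    all_goals first
      | omega
      | skip
    · rw [Nat.cast_sub (by omega)]; push_cast; ring
    · have : (b : ℕ) = 0 := by omega
      simp [this]
    · have : (b : ℕ) = 2 * s := by omega
      rw [Nat.cast_sub (by omega), this]; push_cast; ring
    · have : (b : ℕ) = 2 * s := by omega
      have : (b : ℕ) = 0 := by omega
      have : s = 0 := by omega
      simp_all
  · have hab' : (b : ℕ) ≠ a := fun h => hab (Fin.ext h)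
    simp only [lower, raise, height, Matrix.of_apply, Matrix.diagonal_apply_ne _ hab]
    split_ifs with h1 h2 h3 h4 h5 h6
    all_goals first
      | omega
      | simp

theorem height_mul_lower_sub : height s * lower s - lower s * height s = (-2 : ℝ) • lower s := by
  ext b a
  rw [Matrix.sub_apply, height_mul_apply, height, Matrix.mul_diagonal]
  simp only [lower, Matrix.of_apply, Matrix.smul_apply, smul_eq_mul]
  split_ifs with h
  · rw [h]; push_cast; ring
  · simp

theorem height_mul_raise_sub : height s * raise s - raise s * height s = (2 : ℝ) • raise s := by
  ext b a
  rw [Matrix.sub_apply, height_mul_apply, height, Matrix.mul_diagonal]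
  simp only [raise, Matrix.of_apply, Matrix.smul_apply, smul_eq_mul]
  split_ifs with h
  · rw [← h]; push_cast; ring
  · simp

/-- The representation of `sl₂` by matrices of size `2s + 1`. -/
def irrep (s : ℕ) : LieAlgebra.SpecialLinear.sl (Fin 2) ℝ →ₗ⁅ℝ⁆
    Matrix (Fin (2 * s + 1)) (Fin (2 * s + 1)) ℝ where
  toFun A := A.1 0 0 • height s + A.1 0 1 • raise s + A.1 1 0 • lower s
  map_add' A B := by
    change (A.1 0 0 + B.1 0 0) • height s + (A.1 0 1 + B.1 0 1) • raise s +
      (A.1 1 0 + B.1 1 0) • lower s = _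
    module
  map_smul' c A := by
    change (c * A.1 0 0) • height s + (c * A.1 0 1) • raise s + (c * A.1 1 0) • lower s =
      c • (A.1 0 0 • height s + A.1 0 1 • raise s + A.1 1 0 • lower s)
    module
  map_lie' := by
    rintro ⟨A, hA⟩ ⟨B, hB⟩
    have hA' : A 1 1 = -A 0 0 := by
      have : A.trace = 0 := hA
      rw [Matrix.trace_fin_two] at this; linarith
    have hB' : B 1 1 = -B 0 0 := by
      have : B.trace = 0 := hB
      rw [Matrix.trace_fin_two] at this; linarith
    have e1 := raise_mul_lower_sub (s := s)
    have e2 := height_mul_lower_sub (s := s)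
    have e3 := height_mul_raise_sub (s := s)
    have f1 : raise s * lower s = lower s * raise s + height s := by rw [← e1]; abel
    have f2 : height s * lower s = lower s * height s + (-2 : ℝ) • lower s := by rw [← e2]; abel
    have f3 : height s * raise s = raise s * height s + (2 : ℝ) • raise s := by rw [← e3]; abel
    change (A * B - B * A) 0 0 • height s + (A * B - B * A) 0 1 • raise s +
      (A * B - B * A) 1 0 • lower s = ⁅A 0 0 • height s + A 0 1 • raise s + A 1 0 • lower s,
        B 0 0 • height s + B 0 1 • raise s + B 1 0 • lower s⁆
    simp only [LieRing.of_associative_ring_bracket, Matrix.sub_apply,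
      Matrix.mul_apply, Fin.sum_univ_two, hA', hB', add_mul, mul_add, smul_mul_assoc,
      mul_smul_comm, f1, f2, f3]
    module

theorem irrep_apply (A : LieAlgebra.SpecialLinear.sl (Fin 2) ℝ) :
    irrep s A = A.1 0 0 • height s + A.1 0 1 • raise s + A.1 1 0 • lower s := rfl

/-- The element of `sl₂` with given entries. -/
def slMk (a b c : ℝ) : LieAlgebra.SpecialLinear.sl (Fin 2) ℝ :=
  ⟨!![a, b; c, -a], by
    change Matrix.trace (!![a, b; c, -a] : Matrix (Fin 2) (Fin 2) ℝ) = 0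
    simp [Matrix.trace_fin_two]⟩

theorem irrep_slMk (a b c : ℝ) : irrep s (slMk a b c) = a • height s + b • raise s + c • lower s := by
  simp [irrep_apply, slMk]

theorem slMk_eq (A : LieAlgebra.SpecialLinear.sl (Fin 2) ℝ) :
    A = slMk (A.1 0 0) (A.1 0 1) (A.1 1 0) := by
  have hA' : A.1 1 1 = -A.1 0 0 := by
    have : A.1.trace = 0 := A.2
    rw [Matrix.trace_fin_two] at this; linarith
  apply Subtype.ext
  ext i j
  fin_cases i <;> fin_cases j <;> simp [slMk, hA']

/-- The action of `sl₂` on column vectors. -/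
noncomputable def irrepEnd (s : ℕ) : LieAlgebra.SpecialLinear.sl (Fin 2) ℝ →ₗ⁅ℝ⁆
    Module.End ℝ (Fin (2 * s + 1) → ℝ) :=
  ((lieEquivMatrix' (R := ℝ) (n := Fin (2 * s + 1))).symm :
    Matrix (Fin (2 * s + 1)) (Fin (2 * s + 1)) ℝ →ₗ⁅ℝ⁆ _).comp (irrep s)

theorem irrepEnd_apply (A : LieAlgebra.SpecialLinear.sl (Fin 2) ℝ) (x : Fin (2 * s + 1) → ℝ) :
    irrepEnd s A x = irrep s A *ᵥ x := by
  change (lieEquivMatrix'.symm (irrep s A)) x = _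
  rw [lieEquivMatrix'_symm_apply, Matrix.toLin'_apply]

theorem lower_mulVec_apply (x : Fin (2 * s + 1) → ℝ) (b : Fin (2 * s + 1)) :
    (lower s *ᵥ x) b = if h : 0 < (b : ℕ) then x ⟨b - 1, by omega⟩ else 0 := by
  have := lower_mul_apply (Matrix.replicateCol Unit x) b ()
  rwa [← Matrix.replicateCol_mulVec] at this

theorem raise_mulVec_apply (x : Fin (2 * s + 1) → ℝ) (b : Fin (2 * s + 1)) :
    (raise s *ᵥ x) b = if h : (b : ℕ) < 2 * s then
      ((b : ℕ) + 1 : ℝ) * (2 * s - (b : ℕ)) * x ⟨b + 1, by omega⟩ else 0 := by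
  have := raise_mul_apply (Matrix.replicateCol Unit x) b ()
  rwa [← Matrix.replicateCol_mulVec] at this

/-- Vectors whose first nonzero entry has index at least `k`. -/
theorem single_last_mem (W : Submodule ℝ (Fin (2 * s + 1) → ℝ))
    (hW : ∀ w ∈ W, lower s *ᵥ w ∈ W) (k : ℕ) : ∀ w ∈ W, w ≠ 0 →
      (∀ b : Fin (2 * s + 1), (b : ℕ) + k < 2 * s → w b = 0) →
      Pi.single (Fin.last (2 * s)) 1 ∈ W := by
  induction k with
  | zero =>
    intro w hw hw0 hb
    have e : w = w (Fin.last _) • Pi.single (Fin.last (2 * s)) 1 := by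
      funext b
      by_cases h : b = Fin.last _
      · subst h; simp
      · have hb' : (b : ℕ) < 2 * s := by
          have := Fin.val_lt_last h; simpa using this
        simp [h, hb b (by omega)]
    have h1 : w (Fin.last _) ≠ 0 := fun h => hw0 (by rw [e, h, zero_smul])
    have := W.smul_mem (w (Fin.last _))⁻¹ hw
    rw [e] at this
    simpa [smul_smul, h1] using this
  | succ k ih =>
    intro w hw hw0 hb
    -- Lowering pushes the support one step towards the last index. If it kills `w`, then `w` is
    -- already supported at the last index and the induction hypothesis applies to `w` itself.
    by_cases hz : lower s *ᵥ w = 0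
    · refine ih w hw hw0 fun b hbk => ?_
      have := congrFun hz ⟨b + 1, by omega⟩
      rw [lower_mulVec_apply] at this
      simpa using this
    · refine ih _ (hW w hw) hz fun b hbk => ?_
      rw [lower_mulVec_apply]
      split_ifs with h
      · exact hb _ (by simp; omega)
      · rfl

/-- Repeated lowering puts the last basis vector into every nonzero invariant subspace; raising then
recovers all the others, because the coefficients $(b+1)(2s-b)$ are nonzero for $b<2s$. -/
theorem irrepEnd_irreducible (W : Submodule ℝ (Fin (2 * s + 1) → ℝ))
    (hW : ∀ A, ∀ w ∈ W, irrepEnd s A w ∈ W) : W = ⊥ ∨ W = ⊤ := by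
  by_cases h0 : W = ⊥
  · exact Or.inl h0
  right
  obtain ⟨w, hw, hw0⟩ := W.exists_mem_ne_zero_of_ne_bot h0
  have hlow : ∀ w ∈ W, lower s *ᵥ w ∈ W := fun w hw => by
    have := hW (slMk 0 0 1) w hw
    rw [irrepEnd_apply, irrep_slMk] at this; simpa using this
  have hraise : ∀ w ∈ W, raise s *ᵥ w ∈ W := fun w hw => by
    have := hW (slMk 0 1 0) w hw
    rw [irrepEnd_apply, irrep_slMk] at this; simpa using this
  have hlast := single_last_mem W hlow (2 * s) w hw hw0 (fun b hb => by omega)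
  have hall : ∀ k : ℕ, ∀ b : Fin (2 * s + 1), (b : ℕ) + k = 2 * s →
      (Pi.single b 1 : Fin (2 * s + 1) → ℝ) ∈ W := by
    intro k
    induction k with
    | zero =>
      intro b hb
      rwa [show b = Fin.last (2 * s) from Fin.ext (by simpa using hb)]
    | succ k ih =>
      intro b hb
      have h1 := hraise _ (ih ⟨b + 1, by omega⟩ (by simp; omega))
      have hc : ((b : ℕ) + 1 : ℝ) * (2 * s - (b : ℕ)) ≠ 0 := by
        have : ((b : ℕ) : ℝ) + (k + 1) = 2 * s := by exact_mod_cast hb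
        have : (2 * s - (b : ℕ) : ℝ) = k + 1 := by linarith
        rw [this]; positivity
      have e : raise s *ᵥ (Pi.single ⟨b + 1, by omega⟩ 1 : Fin (2 * s + 1) → ℝ) =
          (((b : ℕ) + 1 : ℝ) * (2 * s - (b : ℕ))) • (Pi.single b 1 : Fin (2 * s + 1) → ℝ) := by
        funext b'
        rw [raise_mulVec_apply]
        by_cases hbb : b' = b
        · subst hbb
          rw [dif_pos (by omega)]; simp
        · have : (b' : ℕ) ≠ b := fun h => hbb (Fin.ext h)
          split_ifs
          · simp [Fin.ext_iff, this]
          · simp [hbb]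
      rw [e] at h1
      have h2 := W.smul_mem (((b : ℕ) + 1 : ℝ) * (2 * s - (b : ℕ)))⁻¹ h1
      rwa [smul_smul, inv_mul_cancel₀ hc, one_smul] at h2
  rw [eq_top_iff]
  intro x _
  rw [← Finset.univ_sum_single x]
  refine Submodule.sum_mem _ fun b _ => ?_
  have := W.smul_mem (x b) (hall (2 * s - b) b (by omega))
  rwa [← Pi.single_smul, smul_eq_mul, mul_one] at this

end SlIrrep

/-! ### The invariant form and the action of $\mathfrak{sl}_2\times\mathfrak{gl}_2$ on $\mathbb
R^{2s+1}\otimes\mathbb R^2$ -/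

namespace SlIrrep

open Matrix

variable {s : ℕ}

theorem slMk_lie (a b c a' b' c' : ℝ) :
    ⁅slMk a b c, slMk a' b' c'⁆ =
      slMk (b * c' - b' * c) (2 * (a * b' - a' * b)) (2 * (c * a' - c' * a)) := by
  apply Subtype.ext
  change (!![a, b; c, -a] * !![a', b'; c', -a'] - !![a', b'; c', -a'] * !![a, b; c, -a] :
    Matrix (Fin 2) (Fin 2) ℝ) = !![_, _; _, _]
  ext i j
  fin_cases i <;> fin_cases j <;> simp <;> ring

/-- The Gram matrix of the invariant form `B(e_a, e_{2s-a}) = (-1)^a`. -/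
def gram (s : ℕ) : Matrix (Fin (2 * s + 1)) (Fin (2 * s + 1)) ℝ :=
  Matrix.of fun b a => if a = b.rev then (-1) ^ (b : ℕ) else 0

theorem gram_mul_apply {m : Type*} (x : Matrix (Fin (2 * s + 1)) m ℝ) (b : Fin (2 * s + 1))
    (j : m) : (gram s * x) b j = (-1) ^ (b : ℕ) * x b.rev j := by
  rw [Matrix.mul_apply, Finset.sum_eq_single b.rev]
  · simp [gram]
  · intro a _ ha; simp [gram, ha]
  · simp

theorem neg_one_pow_rev (b : Fin (2 * s + 1)) : (-1 : ℝ) ^ (b.rev : ℕ) = (-1) ^ (b : ℕ) := by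
  have h : (b.rev : ℕ) + b = 2 * s := by rw [Fin.val_rev]; omega
  have h2 : (-1 : ℝ) ^ (b.rev : ℕ) * (-1) ^ (b : ℕ) = 1 := by
    rw [← pow_add, h, pow_mul]; simp
  rcases neg_one_pow_eq_or ℝ (b : ℕ) with h3 | h3 <;> rw [h3] at h2 ⊢ <;> linarith

/-- The indices of opposite basis vectors add up to the even number $2s$, so the signs agree.
Symmetry of this form is what makes its product with the area form of $\mathbb R^2$ symplectic. -/
theorem gram_transpose : (gram s)ᵀ = gram s := by
  ext b a
  simp only [gram, Matrix.transpose_apply, Matrix.of_apply]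
  by_cases h : b = a.rev
  · subst h; rw [if_pos rfl, if_pos (Fin.rev_rev a).symm, neg_one_pow_rev]
  · have : a ≠ b.rev := fun h' => h (by rw [h', Fin.rev_rev])
    simp [h, this]

theorem transpose_mul_gram (T : Matrix (Fin (2 * s + 1)) (Fin (2 * s + 1)) ℝ)
    (h : ∀ a b : Fin (2 * s + 1), (-1) ^ (a : ℕ) * T a.rev b + (-1) ^ (b : ℕ) * T b.rev a = 0) :
    Tᵀ * gram s + gram s * T = 0 := by
  ext a b
  have : Tᵀ * gram s = (gram s * T)ᵀ := by rw [Matrix.transpose_mul, gram_transpose]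
  rw [this, Matrix.add_apply, Matrix.transpose_apply, gram_mul_apply, gram_mul_apply, add_comm]
  exact h a b

theorem lower_gram : (lower s)ᵀ * gram s + gram s * lower s = 0 := by
  refine transpose_mul_gram _ fun a b => ?_
  simp only [lower, Matrix.of_apply, Fin.val_rev]
  by_cases h : (a : ℕ) + b + 1 = 2 * s
  · rw [if_pos (by omega), if_pos (by omega)]
    rcases Nat.even_or_odd (a : ℕ) with h1 | h1
    · have h2 : Odd (b : ℕ) := by
        obtain ⟨m, hm⟩ := h1; exact ⟨s - m - 1, by omega⟩
      simp [h1.neg_one_pow, h2.neg_one_pow]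
    · have h2 : Even (b : ℕ) := by
        obtain ⟨m, hm⟩ := h1; exact ⟨s - m - 1, by omega⟩
      simp [h1.neg_one_pow, h2.neg_one_pow]
  · rw [if_neg (by omega), if_neg (by omega)]; simp

theorem raise_gram : (raise s)ᵀ * gram s + gram s * raise s = 0 := by
  refine transpose_mul_gram _ fun a b => ?_
  simp only [raise, Matrix.of_apply]
  have ha : (a.rev : ℕ) + a = 2 * s := by rw [Fin.val_rev]; omega
  have hb : (b.rev : ℕ) + b = 2 * s := by rw [Fin.val_rev]; omega
  by_cases h : (a : ℕ) + b = 2 * s + 1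
  · rw [if_pos (by omega), if_pos (by omega)]
    have ha' : (a.rev : ℝ) = 2 * s - a := by
      have : ((a.rev : ℕ) : ℝ) + a = 2 * s := by exact_mod_cast ha
      linarith
    have hb' : (b.rev : ℝ) = 2 * s - b := by
      have : ((b.rev : ℕ) : ℝ) + b = 2 * s := by exact_mod_cast hb
      linarith
    have hab : (a : ℝ) + b = 2 * s + 1 := by exact_mod_cast h
    have e : (b : ℝ) = 2 * s + 1 - a := by linarith
    rcases Nat.even_or_odd (a : ℕ) with h1 | h1
    · have h2 : Odd (b : ℕ) := by
        obtain ⟨m, hm⟩ := h1; exact ⟨s - m, by omega⟩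
      rw [ha', hb', h1.neg_one_pow, h2.neg_one_pow, e]; ring
    · have h2 : Even (b : ℕ) := by
        obtain ⟨m, hm⟩ := h1; exact ⟨s - m, by omega⟩
      rw [ha', hb', h1.neg_one_pow, h2.neg_one_pow, e]; ring
  · rw [if_neg (by omega), if_neg (by omega)]; simp

theorem height_gram : (height s)ᵀ * gram s + gram s * height s = 0 := by
  refine transpose_mul_gram _ fun a b => ?_
  have ha : (a.rev : ℕ) + a = 2 * s := by rw [Fin.val_rev]; omega
  have hb : (b.rev : ℕ) + b = 2 * s := by rw [Fin.val_rev]; omega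
  by_cases h : a.rev = b
  · have h' : b.rev = a := by rw [← h, Fin.rev_rev]
    rw [h, h']
    simp only [height, Matrix.diagonal_apply_eq]
    have e : (-1 : ℝ) ^ (a : ℕ) = (-1) ^ (b : ℕ) := by rw [← h, neg_one_pow_rev]
    have hab : (a : ℝ) + b = 2 * s := by
      rw [h] at ha; have : ((b : ℕ) : ℝ) + a = 2 * s := by exact_mod_cast ha
      linarith
    rw [e]; linear_combination (-2 * (-1) ^ (b : ℕ)) * hab
  · have h' : b.rev ≠ a := fun h' => h (by rw [← h', Fin.rev_rev])
    simp [height, h, h']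

theorem irrep_gram (A : LieAlgebra.SpecialLinear.sl (Fin 2) ℝ) :
    (irrep s A)ᵀ * gram s + gram s * irrep s A = 0 := by
  have h1 := lower_gram (s := s)
  have h2 := raise_gram (s := s)
  have h3 := height_gram (s := s)
  rw [← eq_neg_iff_add_eq_zero] at h1 h2 h3 ⊢
  rw [irrep_apply]
  simp only [Matrix.transpose_add, Matrix.transpose_smul, add_mul, mul_add, smul_mul_assoc,
    mul_smul_comm, h1, h2, h3]
  module

/-- The symplectic form `B ⊗ ω` on `ℝ^{2s+1} ⊗ ℝ²`. -/
def form (x y : Matrix (Fin (2 * s + 1)) (Fin 2) ℝ) : ℝ :=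
  (xᵀ * gram s * y) 0 1 - (xᵀ * gram s * y) 1 0

theorem form_apply (x y : Matrix (Fin (2 * s + 1)) (Fin 2) ℝ) :
    form x y = ∑ a : Fin (2 * s + 1), (-1) ^ (a : ℕ) * (x a 0 * y a.rev 1 - x a 1 * y a.rev 0) := by
  simp only [form, Matrix.mul_assoc]
  rw [Matrix.mul_apply, Matrix.mul_apply, ← Finset.sum_sub_distrib]
  refine Finset.sum_congr rfl fun a _ => ?_
  rw [gram_mul_apply, gram_mul_apply, Matrix.transpose_apply, Matrix.transpose_apply]
  ring

/-- The componentwise action of `sl₂ × gl₂` on `ℝ^{2s+1} ⊗ ℝ²`. -/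
def act (s : ℕ) : LieAlgebra.SpecialLinear.sl (Fin 2) ℝ × Matrix (Fin 2) (Fin 2) ℝ →ₗ⁅ℝ⁆
    Module.End ℝ (Matrix (Fin (2 * s + 1)) (Fin 2) ℝ) where
  toFun p := mulLeftLinearMap (Fin 2) ℝ (irrep s p.1) +
    mulRightLinearMap (Fin (2 * s + 1)) ℝ p.2ᵀ
  map_add' p q := by
    ext1 x
    simp [Matrix.add_mul, Matrix.mul_add]
    abel
  map_smul' c p := by
    ext1 x
    simp
  map_lie' := by
    rintro ⟨A, a⟩ ⟨B, b⟩
    ext1 x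
    simp only [LieAlgebra.Prod.bracket_apply, LieHom.map_lie]
    simp only [LieRing.of_associative_ring_bracket, LinearMap.add_apply, mulLeftLinearMap_apply,
      mulRightLinearMap_apply, LinearMap.sub_apply, Module.End.mul_apply, Matrix.transpose_sub,
      Matrix.transpose_mul, Matrix.sub_mul, Matrix.mul_sub, Matrix.mul_add, Matrix.add_mul,
      Matrix.mul_assoc]
    abel

theorem act_apply (p : LieAlgebra.SpecialLinear.sl (Fin 2) ℝ × Matrix (Fin 2) (Fin 2) ℝ)
    (x : Matrix (Fin (2 * s + 1)) (Fin 2) ℝ) : act s p x = irrep s p.1 * x + x * p.2ᵀ := rfl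

/-- $\mathfrak{sl}_2$ preserves the symmetric factor of the form, and an element of
$\mathfrak{gl}_2$ scales the area form by its trace. -/
theorem form_act (p : LieAlgebra.SpecialLinear.sl (Fin 2) ℝ × Matrix (Fin 2) (Fin 2) ℝ)
    (x y : Matrix (Fin (2 * s + 1)) (Fin 2) ℝ) :
    form (act s p x) y + form x (act s p y) = p.2.trace * form x y := by
  have h := irrep_gram (s := s) p.1
  have e1 : (act s p x)ᵀ * gram s * y = xᵀ * ((irrep s p.1)ᵀ * gram s) * y +
      p.2 * (xᵀ * gram s * y) := by
    simp only [act_apply, Matrix.transpose_add, Matrix.transpose_mul, Matrix.transpose_transpose,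
      Matrix.add_mul, Matrix.mul_assoc]
  have e2 : xᵀ * gram s * act s p y = xᵀ * (gram s * irrep s p.1) * y +
      (xᵀ * gram s * y) * p.2ᵀ := by
    simp only [act_apply, Matrix.mul_add, Matrix.mul_assoc]
  rw [form, form, e1, e2, eq_neg_of_add_eq_zero_left h, form]
  simp only [Matrix.mul_neg, Matrix.neg_mul, Matrix.add_apply, Matrix.neg_apply, Matrix.mul_apply (M := p.2),
    Matrix.mul_apply (N := p.2ᵀ), Fin.sum_univ_two, Matrix.transpose_apply, Matrix.trace_fin_two]
  ring

theorem act_single (p : LieAlgebra.SpecialLinear.sl (Fin 2) ℝ × Matrix (Fin 2) (Fin 2) ℝ)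
    (a b : Fin (2 * s + 1)) (i j : Fin 2) :
    act s p (Matrix.single a i 1) b j =
      (if j = i then irrep s p.1 b a else 0) + (if b = a then p.2 j i else 0) := by
  rw [act_apply, Matrix.add_apply]
  congr 1
  · split_ifs with h
    · subst h; simp
    · exact Matrix.mul_single_apply_of_ne _ _ _ _ _ h _ 
  · split_ifs with h
    · subst h; simp
    · simp [h]

theorem irrep_entry (p : LieAlgebra.SpecialLinear.sl (Fin 2) ℝ) (b a : Fin (2 * s + 1)) :
    irrep s p b a = (if b = a then p.1 0 0 * (2 * s - 2 * (a : ℕ)) else 0) +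
      (if (b : ℕ) + 1 = a then p.1 0 1 * (((b : ℕ) + 1) * (2 * s - (b : ℕ))) else 0) +
      (if (b : ℕ) = a + 1 then p.1 1 0 else 0) := by
  simp only [irrep_apply, Matrix.add_apply, Matrix.smul_apply, smul_eq_mul, height, raise, lower,
    Matrix.of_apply, Matrix.diagonal_apply, mul_ite, mul_zero, mul_one]
  congr 2
  split_ifs with h
  · rw [h]
  · rfl

/-- Off-diagonal parts are read off from single entries. The weight and the scalar part are
separated by comparing the weights $2s$ and $2s-2$, which needs $s>0$: for $s=0$ the factor
$\mathfrak{sl}_2$ acts by zero. -/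
theorem act_injective (hs : 0 < s) : Function.Injective (act s) := by
  refine (injective_iff_map_eq_zero _).2 fun p hp => ?_
  have h : ∀ (a b : Fin (2 * s + 1)) (i j : Fin 2),
      (if j = i then irrep s p.1 b a else 0) + (if b = a then p.2 j i else 0) = 0 := fun a b i j => by
    rw [← act_single, hp]; rfl
  have hs' : (s : ℝ) ≠ 0 := by exact_mod_cast hs.ne'
  have k01 := h ⟨1, by omega⟩ ⟨0, by omega⟩ 0 0
  have k10 := h ⟨0, by omega⟩ ⟨1, by omega⟩ 0 0
  have m01 := h ⟨0, by omega⟩ ⟨0, by omega⟩ 0 1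
  have m10 := h ⟨0, by omega⟩ ⟨0, by omega⟩ 1 0
  have m00 := h ⟨0, by omega⟩ ⟨0, by omega⟩ 0 0
  have m11 := h ⟨0, by omega⟩ ⟨0, by omega⟩ 1 1
  have k00 := h ⟨1, by omega⟩ ⟨1, by omega⟩ 0 0
  simp [irrep_entry, hs'] at k01 k10 m01 m10 m00 m11 k00
  have h00 : p.1.1 0 0 = 0 := by linarith
  rw [h00] at m00 m11
  apply Prod.ext
  · rw [slMk_eq p.1, h00, k01, k10, slMk]
    apply Subtype.ext
    ext i j; fin_cases i <;> fin_cases j <;> simp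
  · ext i j; fin_cases i <;> fin_cases j <;> simp [m01, m10] <;> linarith

end SlIrrep

/-! ### The prolongation $\mathfrak u^F(\delta)$ of $\delta_{s,2s}$ in coordinates -/

namespace FlagSymbol

open SlIrrep Matrix

/-- Coordinates in which a symbol is (up to scalars) the symbol `δ_{s,2s}` on `ℝ^{2s+1} ⊗ ℝ²`. -/
structure Coordinates (S : FlagSymbol) (s : ℕ) where
  κ : Matrix (Fin (2 * s + 1)) (Fin 2) ℝ ≃ₗ[ℝ] S.X
  c : ℝ
  c_ne : c ≠ 0
  σ_eq : ∀ x y, S.σ (κ x) (κ y) = c * form x y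
  c' : ℝ
  c'_ne : c' ≠ 0
  δ_eq : ∀ x, S.δ (κ x) = c' • κ (lower s * x)
  gr_iff : ∀ i x, κ x ∈ S.gr i ↔ ∀ (a : Fin (2 * s + 1)) (j : Fin 2), (s : ℤ) - (a : ℕ) ≠ i → x a j = 0

namespace Coordinates

variable {S : FlagSymbol} {s : ℕ} (K : Coordinates S s)

/-- The action of `sl₂ × gl₂` in coordinates. -/
noncomputable def act : LieAlgebra.SpecialLinear.sl (Fin 2) ℝ × Matrix (Fin 2) (Fin 2) ℝ →ₗ⁅ℝ⁆
    Module.End ℝ S.X :=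
  (K.κ.lieConj : _ →ₗ⁅ℝ⁆ _).comp (SlIrrep.act s)

theorem act_κ (p : LieAlgebra.SpecialLinear.sl (Fin 2) ℝ × Matrix (Fin 2) (Fin 2) ℝ)
    (x : Matrix (Fin (2 * s + 1)) (Fin 2) ℝ) : K.act p (K.κ x) = K.κ (SlIrrep.act s p x) := by
  change K.κ.conj (SlIrrep.act s p) (K.κ x) = _
  rw [LinearEquiv.conj_apply_apply, LinearEquiv.symm_apply_apply]

theorem act_injective (hs : 0 < s) : Function.Injective K.act :=
  K.κ.lieConj.injective.comp (SlIrrep.act_injective hs)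

theorem ext_κ {A B : Module.End ℝ S.X} (h : ∀ x, A (K.κ x) = B (K.κ x)) : A = B := by
  ext1 y
  obtain ⟨x, rfl⟩ := K.κ.surjective y
  exact h x

theorem σ_act (p : LieAlgebra.SpecialLinear.sl (Fin 2) ℝ × Matrix (Fin 2) (Fin 2) ℝ) (x y : S.X) :
    S.σ (K.act p x) y + S.σ x (K.act p y) = p.2.trace * S.σ x y := by
  obtain ⟨x, rfl⟩ := K.κ.surjective x
  obtain ⟨y, rfl⟩ := K.κ.surjective y
  rw [act_κ, act_κ, σ_eq, σ_eq, σ_eq]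
  linear_combination K.c * form_act p x y

theorem act_mem_csp (p : LieAlgebra.SpecialLinear.sl (Fin 2) ℝ × Matrix (Fin 2) (Fin 2) ℝ) :
    K.act p ∈ S.csp := ⟨_, K.σ_act p⟩

/-- This places $\delta$ inside the image of $\mathfrak{sl}_2$, so that brackets with it become
computations in $\mathfrak{sl}_2$. -/
theorem δ_eq_act : S.δ = K.act (slMk 0 0 K.c', 0) := by
  refine K.ext_κ fun x => ?_
  rw [δ_eq, act_κ, SlIrrep.act_apply, irrep_slMk]
  simp

/-- The matrix entries of an endomorphism. -/
noncomputable def entry : Module.End ℝ S.X →ₗ[ℝ]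
    (Fin (2 * s + 1) → Fin 2 → Fin (2 * s + 1) → Fin 2 → ℝ) where
  toFun V b j a i := K.κ.symm (V (K.κ (Matrix.single a i 1))) b j
  map_add' V W := by funext b j a i; simp
  map_smul' c V := by funext b j a i; simp

theorem entry_apply (V : Module.End ℝ S.X) (b j a i) :
    K.entry V b j a i = K.κ.symm (V (K.κ (Matrix.single a i 1))) b j := rfl

theorem entry_act (p : LieAlgebra.SpecialLinear.sl (Fin 2) ℝ × Matrix (Fin 2) (Fin 2) ℝ) (b j a i) :
    K.entry (K.act p) b j a i =
      (if j = i then irrep s p.1 b a else 0) + (if b = a then p.2 j i else 0) := by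
  rw [entry_apply, act_κ, LinearEquiv.symm_apply_apply, act_single]

theorem eq_zero_of_entry {V : Module.End ℝ S.X} (h : ∀ b j a i, K.entry V b j a i = 0) : V = 0 := by
  refine K.ext_κ fun x => ?_
  rw [LinearMap.zero_apply, Matrix.matrix_eq_sum_single x]
  simp only [map_sum]
  refine Finset.sum_eq_zero fun a _ => Finset.sum_eq_zero fun i _ => ?_
  have e : Matrix.single a i (x a i) = x a i • Matrix.single a i (1 : ℝ) := by
    rw [Matrix.smul_single, smul_eq_mul, mul_one]
  rw [e, map_smul, map_smul]
  have : V (K.κ (Matrix.single a i 1)) = 0 := by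
    apply K.κ.symm.injective
    ext b j
    rw [map_zero]
    exact h b j a i
  rw [this, smul_zero]

theorem κ_single_mem (a : Fin (2 * s + 1)) (i : Fin 2) :
    K.κ (Matrix.single a i 1) ∈ S.gr ((s : ℤ) - (a : ℕ)) := by
  rw [K.gr_iff]
  intro b j hb
  refine Matrix.single_apply_of_row_ne ?_ _ _ _
  rintro rfl
  exact hb rfl

/-- Row `a` has degree $s-a$, so an operator of degree `k` lives on the diagonal `b + k = a`. -/
theorem entry_eq_zero {V : Module.End ℝ S.X} {k : ℤ} (hV : V ∈ S.cspDeg k) {b a : Fin (2 * s + 1)}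
    {j i : Fin 2} (h : ((b : ℕ) : ℤ) + k ≠ (a : ℕ)) : K.entry V b j a i = 0 := by
  have := hV.2 _ _ (K.κ_single_mem a i)
  rw [← K.κ.apply_symm_apply (V _), K.gr_iff] at this
  exact this b j fun h' => h (by linarith)

theorem mem_cspDeg {V : Module.End ℝ S.X} {k : ℤ} (hV : V ∈ S.csp)
    (h : ∀ (b : Fin (2 * s + 1)) (j : Fin 2) (a : Fin (2 * s + 1)) (i : Fin 2), ((b : ℕ) : ℤ) + k ≠ (a : ℕ) → K.entry V b j a i = 0) : V ∈ S.cspDeg k := by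
  refine ⟨hV, fun i x hx => ?_⟩
  obtain ⟨x, rfl⟩ := K.κ.surjective x
  rw [K.gr_iff] at hx
  rw [Matrix.matrix_eq_sum_single x]
  simp only [map_sum]
  refine Submodule.sum_mem _ fun a _ => Submodule.sum_mem _ fun i' _ => ?_
  have e : Matrix.single a i' (x a i') = x a i' • Matrix.single a i' (1 : ℝ) := by
    rw [Matrix.smul_single, smul_eq_mul, mul_one]
  rw [e, map_smul, map_smul]
  by_cases ha : (s : ℤ) - (a : ℕ) = i
  · refine Submodule.smul_mem _ _ ?_
    rw [← K.κ.apply_symm_apply (V _), K.gr_iff]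
    intro b j hb
    exact h b j a i' fun h' => hb (by linarith)
  · rw [hx a i' ha, zero_smul]; exact Submodule.zero_mem _

/-- The commutator with $\delta$ is a difference operator along diagonals: entry $(b,a)$ is $c'$
times the difference of the entries $(b,a+1)$ and $(b-1,a)$ of `V`, terms outside the matrix being
zero. -/
theorem entry_lie_δ (V : Module.End ℝ S.X) (b : Fin (2 * s + 1)) (j : Fin 2) (a : Fin (2 * s + 1))
    (i : Fin 2) :
    K.entry ⁅V, S.δ⁆ b j a i = K.c' *
      ((if h : (a : ℕ) < 2 * s then K.entry V b j ⟨a + 1, by omega⟩ i else 0) -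
        (if h : 0 < (b : ℕ) then K.entry V ⟨b - 1, by omega⟩ j a i else 0)) := by
  have h1 : lower s * Matrix.single a i (1 : ℝ) =
      if h : (a : ℕ) < 2 * s then Matrix.single ⟨a + 1, by omega⟩ i 1 else 0 := by
    ext b' j'
    rw [lower_mul_apply]
    split_ifs with h2 h3 h3
    · simp only [Matrix.single_apply, Fin.ext_iff]
      congr 1
      simp only [eq_iff_iff, and_congr_left_iff]
      intro _
      omega
    · refine Matrix.single_apply_of_row_ne ?_ _ _ _
      intro h'; have := congrArg Fin.val h'; simp at this; omega
    · refine (Matrix.single_apply_of_row_ne ?_ _ _ _).symm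
      intro h'; have := congrArg Fin.val h'; simp at this; omega
    · rfl
  have h2 : K.κ.symm (S.δ (V (K.κ (Matrix.single a i 1)))) =
      K.c' • (lower s * K.κ.symm (V (K.κ (Matrix.single a i 1)))) := by
    conv_lhs => rw [← K.κ.apply_symm_apply (V (K.κ (Matrix.single a i 1))), K.δ_eq]
    rw [map_smul, LinearEquiv.symm_apply_apply]
  rw [LieRing.of_associative_ring_bracket, entry_apply, LinearMap.sub_apply, Module.End.mul_apply,
    Module.End.mul_apply, K.δ_eq, h1, map_sub, h2, map_smul, map_smul, ← smul_sub,
    Matrix.smul_apply, Matrix.sub_apply, lower_mul_apply, smul_eq_mul]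
  congr 2
  split_ifs
  · rfl
  · simp

/-- An endomorphism of nonnegative degree which commutes with `δ` is determined by its component
in `gl₂`. -/
theorem eq_zero_of_lie_δ {V : Module.End ℝ S.X} {k : ℕ} (hV : V ∈ S.cspDeg k) (h : ⁅V, S.δ⁆ = 0)
    (h0 : k = 0 → ∀ j i, K.entry V 0 j 0 i = 0) : V = 0 := by
  have key : ∀ (m : ℕ) (b a : Fin (2 * s + 1)) (j i : Fin 2), (b : ℕ) = m → (a : ℕ) = b + k →
      K.entry V b j a i = 0 := by
    intro m
    induction m with
    | zero =>
      intro b a j i hb ha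
      -- In positive degree the first entry of the diagonal is itself a boundary difference and so
      -- vanishes; in degree zero it is the $\mathfrak{gl}_2$ component controlled by `h0`.
      rcases Nat.eq_zero_or_pos k with hk | hk
      · obtain rfl : b = 0 := Fin.ext (by simpa using hb)
        obtain rfl : a = 0 := Fin.ext (by simp; simp at ha; omega)
        exact h0 hk j i
      · have := K.entry_lie_δ V b j ⟨a - 1, by omega⟩ i
        rw [h, map_zero, dif_pos (by simp; omega), dif_neg (by omega), sub_zero] at this
        have e : (⟨((⟨a - 1, by omega⟩ : Fin (2 * s + 1)) : ℕ) + 1, by simp; omega⟩ :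
          Fin (2 * s + 1)) = a := Fin.ext (by simp; omega)
        rw [e] at this
        exact (mul_eq_zero.1 this.symm).resolve_left K.c'_ne
    | succ m ih =>
      intro b a j i hb ha
      have := K.entry_lie_δ V b j ⟨a - 1, by omega⟩ i
      rw [h, map_zero, dif_pos (by simp; omega), dif_pos (by omega),
        ih ⟨b - 1, by omega⟩ ⟨a - 1, by omega⟩ j i (by simp; omega) (by simp; omega), sub_zero]
        at this
      have e : (⟨((⟨a - 1, by omega⟩ : Fin (2 * s + 1)) : ℕ) + 1, by simp; omega⟩ :
        Fin (2 * s + 1)) = a := Fin.ext (by simp; omega)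
      rw [e] at this
      exact (mul_eq_zero.1 this.symm).resolve_left K.c'_ne
  refine K.eq_zero_of_entry fun b j a i => ?_
  by_cases hab : (a : ℕ) = b + k
  · exact key b b a j i rfl hab
  · exact K.entry_eq_zero hV fun h' => hab (by exact_mod_cast h'.symm)

/-- The diagonals of a commutator with `δ` have vanishing sum. -/
theorem sum_entry_lie_δ (V : Module.End ℝ S.X) (k : ℕ) (j i : Fin 2) :
    ∑ t ∈ Finset.range (2 * s + 1), (if h : t + k ≤ 2 * s then
      K.entry ⁅V, S.δ⁆ ⟨t, by omega⟩ j ⟨t + k, by omega⟩ i else 0) = 0 := by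
  -- The partial sums of the differences telescope to the entry following the last one, which falls
  -- off the matrix at `n = 2 * s`.
  have key : ∀ n, n ≤ 2 * s → ∑ t ∈ Finset.range (n + 1), (if h : t + k ≤ 2 * s then
      K.entry ⁅V, S.δ⁆ ⟨t, by omega⟩ j ⟨t + k, by omega⟩ i else 0) = K.c' *
        (if h : n + k + 1 ≤ 2 * s then K.entry V ⟨n, by omega⟩ j ⟨n + k + 1, by omega⟩ i else 0) := by
    intro n
    induction n with
    | zero =>
      intro _
      rw [zero_add, Finset.sum_range_one]
      split_ifs with h1 h2 h2
      · rw [entry_lie_δ, dif_pos (by simp; omega), dif_neg (by simp), sub_zero]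
      · rw [entry_lie_δ, dif_neg (by simp; omega), dif_neg (by simp), sub_zero]
      · omega
      · simp
    | succ n ih =>
      intro hn
      rw [Finset.sum_range_succ, ih (by omega)]
      split_ifs with h1 h2 h3 h4 h5
      all_goals first
        | omega
        | skip
      · rw [entry_lie_δ, dif_pos (by simp; omega), dif_pos (by simp)]
        have e : (⟨n + 1 + k, by omega⟩ : Fin (2 * s + 1)) = ⟨n + k + 1, by omega⟩ :=
          Fin.ext (by simp; omega)
        simp only [Nat.add_sub_cancel, e]
        have e' : (⟨n + 1 + k + 1, by omega⟩ : Fin (2 * s + 1)) = ⟨n + k + 1 + 1, by omega⟩ :=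
          Fin.ext (by simp; omega)
        rw [e']; ring
      · rw [entry_lie_δ, dif_neg (by simp; omega), dif_pos (by simp)]
        have e : (⟨n + 1 + k, by omega⟩ : Fin (2 * s + 1)) = ⟨n + k + 1, by omega⟩ :=
          Fin.ext (by simp; omega)
        simp only [Nat.add_sub_cancel, e]
        ring
      · simp
  have := key (2 * s) le_rfl
  rw [dif_neg (by omega), mul_zero] at this
  exact this

theorem act_zero_mem (a : ℝ) (B : Matrix (Fin 2) (Fin 2) ℝ) :
    K.act (slMk a 0 0, B) ∈ S.cspDeg (0 : ℕ) := by
  refine K.mem_cspDeg (K.act_mem_csp _) fun b j a' i h => ?_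
  have h' : b ≠ a' := by rintro rfl; simp at h
  rw [entry_act, irrep_entry, if_neg h', if_neg h']
  simp [slMk]

theorem act_one_mem (r : ℝ) : K.act (slMk 0 r 0, 0) ∈ S.cspDeg (1 : ℕ) := by
  refine K.mem_cspDeg (K.act_mem_csp _) fun b j a i h => ?_
  have h' : ¬ (b : ℕ) + 1 = a := fun h' => h (by exact_mod_cast h')
  rw [entry_act, irrep_entry, if_neg h']
  simp [slMk]

theorem lie_act_δ (a b : ℝ) (B : Matrix (Fin 2) (Fin 2) ℝ) :
    ⁅K.act (slMk a b 0, B), S.δ⁆ = K.act (slMk (b * K.c') 0 (-2 * a * K.c'), 0) := by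
  rw [K.δ_eq_act, ← LieHom.map_lie, LieAlgebra.Prod.bracket_apply, slMk_lie, lie_zero]
  congr 3 <;> ring

theorem prolong_zero {v : Module.End ℝ S.X} (hv : v ∈ S.prolong 0) :
    ∃ r, v = K.act (slMk 0 0 r, 0) := by
  obtain ⟨r, rfl⟩ := Submodule.mem_span_singleton.1 hv
  refine ⟨r * K.c', ?_⟩
  rw [K.δ_eq_act, ← map_smul]
  congr 1
  refine Prod.ext (Subtype.ext ?_) (smul_zero _)
  change r • !![0, 0; K.c', -0] = !![0, 0; r * K.c', -0]
  simp

theorem act_mem_prolong_zero (r : ℝ) : K.act (slMk 0 0 r, 0) ∈ S.prolong 0 := by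
  refine Submodule.mem_span_singleton.2 ⟨r / K.c', ?_⟩
  rw [K.δ_eq_act, ← map_smul]
  congr 1
  refine Prod.ext (Subtype.ext ?_) (smul_zero _)
  change (r / K.c') • !![0, 0; K.c', -0] = !![0, 0; r, -0]
  have := K.c'_ne
  simp [div_mul_cancel₀ _ this]

theorem act_mem_prolong_one (a : ℝ) (B : Matrix (Fin 2) (Fin 2) ℝ) :
    K.act (slMk a 0 0, B) ∈ S.prolong 1 := by
  refine ⟨K.act_zero_mem a B, ?_⟩
  rw [lie_act_δ, zero_mul]
  exact K.act_mem_prolong_zero _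

theorem act_mem_prolong_two (b : ℝ) : K.act (slMk 0 b 0, 0) ∈ S.prolong 2 := by
  refine ⟨K.act_one_mem b, ?_⟩
  rw [lie_act_δ, mul_zero, zero_mul]
  exact K.act_mem_prolong_one _ _

/-- A suitable multiple of the semisimple element has the same bracket with $\delta$. The difference
commutes with $\delta$ and is determined by its $2\times 2$ block at the highest weight. -/
theorem prolong_one {v : Module.End ℝ S.X} (hv : v ∈ S.prolong 1) :
    ∃ a B, v = K.act (slMk a 0 0, B) := by
  obtain ⟨r, hr⟩ := K.prolong_zero hv.2
  -- Solution of $-2ac'=r$. In `B` below, the contribution $2sa$ of the semisimple element at the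
  -- highest weight is subtracted.
  let a : ℝ := -(r / K.c') / 2
  let B : Matrix (Fin 2) (Fin 2) ℝ := Matrix.of fun j i =>
    K.entry v 0 j 0 i - (if j = i then a * (2 * s) else 0)
  refine ⟨a, B, sub_eq_zero.1 (K.eq_zero_of_lie_δ (k := 0)
    (Submodule.sub_mem _ hv.1 (K.act_zero_mem a B)) ?_ fun _ j i => ?_)⟩
  · rw [sub_lie, hr, lie_act_δ, sub_eq_zero, zero_mul]
    congr 3
    have := K.c'_ne
    simp only [a]; field_simp
  · rw [map_sub]
    change K.entry v 0 j 0 i - K.entry (K.act (slMk a 0 0, B)) 0 j 0 i = 0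
    rw [entry_act, irrep_entry]
    simp [B, slMk]

/-- $[v,\delta]$ is a multiple of the semisimple element plus some `B` in $\mathfrak{gl}_2$. The
diagonal sums of a commutator vanish and the weights add up to zero, so $(2s+1)B=0$; the rest is
matched by a multiple of the raising operator. -/
theorem prolong_two {v : Module.End ℝ S.X} (hv : v ∈ S.prolong 2) :
    ∃ b, v = K.act (slMk 0 b 0, 0) := by
  obtain ⟨a, B, hr⟩ := K.prolong_one hv.2
  have hB : B = 0 := by
    ext j i
    have h := K.sum_entry_lie_δ v 0 j i
    rw [hr] at h
    have h1 : ∑ t ∈ Finset.range (2 * s + 1), (if h : t + 0 ≤ 2 * s then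
        K.entry (K.act (slMk a 0 0, B)) ⟨t, by omega⟩ j ⟨t + 0, by omega⟩ i else 0) =
        ∑ t ∈ Finset.range (2 * s + 1), ((if j = i then a * (2 * s - 2 * (t : ℝ)) else 0) + B j i) := by
      refine Finset.sum_congr rfl fun t ht => ?_
      rw [Finset.mem_range] at ht
      rw [dif_pos (by omega), entry_act, irrep_entry]
      simp [slMk]
    have h2 : ∑ t ∈ Finset.range (2 * s + 1), a * (2 * s - 2 * (t : ℝ)) = 0 := by
      have h3 : ∀ n : ℕ, ∑ t ∈ Finset.range (n + 1), (t : ℝ) = n * (n + 1) / 2 := by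
        intro n
        induction n with
        | zero => simp
        | succ n ih => rw [Finset.sum_range_succ, ih]; push_cast; ring
      rw [← Finset.mul_sum, Finset.sum_sub_distrib, ← Finset.mul_sum (f := fun t : ℕ => (t : ℝ)), h3]
      simp; right; ring
    rw [h1, Finset.sum_add_distrib] at h
    have h4 : ∑ t ∈ Finset.range (2 * s + 1), (if j = i then a * (2 * s - 2 * (t : ℝ)) else 0) = 0 := by
      split_ifs
      · exact h2
      · simp
    rw [h4, zero_add, Finset.sum_const, Finset.card_range, nsmul_eq_mul] at h
    have h5 : ((2 * s + 1 : ℕ) : ℝ) ≠ 0 := by positivity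
    exact (mul_eq_zero.1 h).resolve_left h5
  refine ⟨a / K.c', sub_eq_zero.1 (K.eq_zero_of_lie_δ (k := 1)
    (Submodule.sub_mem _ hv.1 (K.act_one_mem _)) ?_ fun h => absurd h one_ne_zero)⟩
  rw [sub_lie, hr, lie_act_δ, sub_eq_zero, hB, div_mul_cancel₀ _ K.c'_ne, mul_zero, zero_mul]

/-- In degree two, $[v,\delta]$ is a multiple of the raising operator. Its first superdiagonal sum
must vanish, whereas that of the raising operator is positive for $s>0$. So `v` commutes with
$\delta$ and is zero; higher degrees follow by induction. -/
theorem prolong_add_three (K : Coordinates S s) (hs : 0 < s) (k : ℕ) : S.prolong (k + 3) = ⊥ := by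
  rw [eq_bot_iff]
  induction k with
  | zero =>
    intro v hv
    obtain ⟨b, hr⟩ := K.prolong_two hv.2
    have h := K.sum_entry_lie_δ v 1 0 0
    rw [hr] at h
    have h1 : ∑ t ∈ Finset.range (2 * s + 1), (if h : t + 1 ≤ 2 * s then
        K.entry (K.act (slMk 0 b 0, 0)) ⟨t, by omega⟩ 0 ⟨t + 1, by omega⟩ 0 else 0) =
        b * ∑ t ∈ Finset.range (2 * s + 1), (((t : ℝ) + 1) * (2 * s - (t : ℝ))) := by
      rw [Finset.mul_sum]
      refine Finset.sum_congr rfl fun t ht => ?_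
      rw [Finset.mem_range] at ht
      split_ifs with h
      · rw [entry_act, irrep_entry]
        simp [slMk]
      · have : t = 2 * s := by omega
        rw [this]; simp
    have h2 : 0 < ∑ t ∈ Finset.range (2 * s + 1), (((t : ℝ) + 1) * (2 * s - (t : ℝ))) := by
      refine Finset.sum_pos' (fun t ht => ?_) ⟨0, by simp, by simp; exact hs⟩
      have : (t : ℝ) ≤ 2 * s := by
        have := Finset.mem_range.1 ht
        exact_mod_cast (by omega : t ≤ 2 * s)
      exact mul_nonneg (by positivity) (by linarith)
    rw [h1] at h
    have hb := (mul_eq_zero.1 h).resolve_right h2.ne'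
    refine K.eq_zero_of_lie_δ (k := 2) hv.1 ?_ fun h => absurd h two_ne_zero
    rw [hr, hb, show (slMk 0 0 0 : LieAlgebra.SpecialLinear.sl (Fin 2) ℝ) = 0 from ?_]
    · exact map_zero _
    · apply Subtype.ext
      change !![0, 0; 0, -0] = (0 : Matrix (Fin 2) (Fin 2) ℝ)
      ext i j; fin_cases i <;> fin_cases j <;> simp
  | succ k ih =>
    intro v hv
    exact K.eq_zero_of_lie_δ (k := k + 3) hv.1 (ih hv.2) fun h => absurd h (by omega)

theorem uF_eq_range (hs : 0 < s) : S.uF = K.act.range := by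
  apply le_antisymm
  · intro v hv
    refine (iSup_le fun k => ?_ : ⨆ k, S.prolong k ≤ K.act.range.toSubmodule) hv
    match k with
    | 0 => intro v hv; obtain ⟨r, rfl⟩ := K.prolong_zero hv; exact ⟨_, rfl⟩
    | 1 => intro v hv; obtain ⟨r, B, rfl⟩ := K.prolong_one hv; exact ⟨_, rfl⟩
    | 2 => intro v hv; obtain ⟨r, rfl⟩ := K.prolong_two hv; exact ⟨_, rfl⟩
    | k + 3 => rw [K.prolong_add_three hs]; exact bot_le
  · rintro _ ⟨⟨A, B⟩, rfl⟩
    have e : ((A, B) : LieAlgebra.SpecialLinear.sl (Fin 2) ℝ × Matrix (Fin 2) (Fin 2) ℝ) =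
        (slMk (A.1 0 0) 0 0, B) + ((slMk 0 (A.1 0 1) 0, 0) + (slMk 0 0 (A.1 1 0), 0)) := by
      refine Prod.ext ?_ (by simp)
      conv_lhs => rw [slMk_eq A]
      apply Subtype.ext
      change !![A.1 0 0, A.1 0 1; A.1 1 0, -A.1 0 0] = !![A.1 0 0, 0; 0, -A.1 0 0] +
        (!![0, A.1 0 1; 0, -0] + !![0, 0; A.1 1 0, -0])
      ext i j; fin_cases i <;> fin_cases j <;> simp
    change K.act (A, B) ∈ ⨆ k, S.prolong k
    rw [e, map_add, map_add]
    exact Submodule.add_mem _ (Submodule.mem_iSup_of_mem 1 (K.act_mem_prolong_one _ _))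
      (Submodule.add_mem _ (Submodule.mem_iSup_of_mem 2 (K.act_mem_prolong_two _))
        (Submodule.mem_iSup_of_mem 0 (K.act_mem_prolong_zero _)))

/-- The isomorphism of `sl₂ × gl₂` with the prolongation of the symbol. -/
noncomputable def equivUF (hs : 0 < s) :
    (LieAlgebra.SpecialLinear.sl (Fin 2) ℝ × Matrix (Fin 2) (Fin 2) ℝ) ≃ₗ⁅ℝ⁆ S.uF :=
  (LieEquiv.ofInjective K.act (K.act_injective hs)).trans
    (LieEquiv.ofEq _ _ (by rw [K.uF_eq_range hs]))

theorem equivUF_coe (hs : 0 < s) (p) : (K.equivUF hs p : Module.End ℝ S.X) = K.act p := rfl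

end Coordinates

end FlagSymbol

/-! ### First prolongations in coordinates -/

namespace SlIrrep

open Matrix

variable {s : ℕ}

theorem slMk_zero : (slMk 0 0 0 : LieAlgebra.SpecialLinear.sl (Fin 2) ℝ) = 0 := by
  apply Subtype.ext
  change !![0, 0; 0, -0] = (0 : Matrix (Fin 2) (Fin 2) ℝ)
  ext i j; fin_cases i <;> fin_cases j <;> simp

/-- The first prolongation of the representation of `sl₂ × ℝ` on `ℝ^{2s+1}` vanishes for `s ≥ 2`,
and for `s = 1` it has no elements without component along the scalars. -/
theorem classical_prolongation (A : Fin (2 * s + 1) → LieAlgebra.SpecialLinear.sl (Fin 2) ℝ)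
    (μ : Fin (2 * s + 1) → ℝ)
    (h : ∀ a b d, irrep s (A a) d b + (if d = b then μ a else 0) =
      irrep s (A b) d a + (if d = a then μ b else 0)) (hs : 2 ≤ s ∨ s = 1 ∧ μ = 0) :
    A = 0 ∧ μ = 0 := by
  rcases hs with hs | ⟨rfl, rfl⟩
  · have hfar : ∀ a b : Fin (2 * s + 1), (a : ℕ) + 2 ≤ b ∨ (b : ℕ) + 2 ≤ a →
        (A a).1 0 0 * (2 * s - 2 * (b : ℕ)) + μ a = 0 := by
      intro a b hab
      have := h a b b
      rw [irrep_entry, irrep_entry, if_pos rfl, if_pos rfl, if_neg (by omega), if_neg (by omega),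
        if_neg (by rintro rfl; omega), if_neg (by omega), if_neg (by omega),
        if_neg (by rintro rfl; omega)] at this
      linarith
    -- With at least five indices, every `a` has two different indices at distance at least two from
    -- it, and an affine function with two zeros is zero.
    have hαμ : ∀ a, (A a).1 0 0 = 0 ∧ μ a = 0 := by
      intro a
      have hs' : (2 : ℝ) ≤ s := by exact_mod_cast hs
      have solve : ∀ b b' : Fin (2 * s + 1), (b : ℕ) < b' → (a : ℕ) + 2 ≤ b ∨ (b : ℕ) + 2 ≤ a →
          (a : ℕ) + 2 ≤ b' ∨ (b' : ℕ) + 2 ≤ a → (A a).1 0 0 = 0 ∧ μ a = 0 := by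
        intro b b' hbb h1 h2
        have e1 := hfar a b h1
        have e2 := hfar a b' h2
        have h3 : ((b : ℕ) : ℝ) < (b' : ℕ) := by exact_mod_cast hbb
        have h4 : (A a).1 0 0 * (2 * ((b' : ℕ) - (b : ℕ))) = 0 := by linear_combination e1 - e2
        have h5 := (mul_eq_zero.1 h4).resolve_right (by linarith)
        rw [h5] at e1
        exact ⟨h5, by linarith⟩
      have ha := a.2
      by_cases h1 : (a : ℕ) ≤ 1
      · exact solve ⟨2 * s - 1, by omega⟩ ⟨2 * s, by omega⟩ (by simp; omega) (by simp; omega)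
          (by simp; omega)
      by_cases h2 : (a : ℕ) = 2
      · exact solve ⟨0, by omega⟩ ⟨2 * s, by omega⟩ (by simp; omega) (by simp; omega)
          (by simp; omega)
      · exact solve ⟨0, by omega⟩ ⟨1, by omega⟩ (by simp) (by simp; omega)
          (by simp; omega)
    have hγ : ∀ a, (A a).1 1 0 = 0 := by
      intro a
      -- The first index has no predecessor to compare with; there the lowering coefficient is seen
      -- on the pair of indices $2$, $3$, which exists because $s\ge 2$.
      by_cases ha : (a : ℕ) = 0
      · have := h a ⟨2, by omega⟩ ⟨3, by omega⟩
        simpa [irrep_entry, hαμ, Fin.ext_iff, ha] using this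
      · have := h ⟨a - 1, by omega⟩ a a
        rw [irrep_entry, irrep_entry, if_pos rfl, if_pos rfl, if_neg (by simp), if_neg (by simp),
          if_neg (by simp [Fin.ext_iff]; omega), if_neg (by simp; omega), if_pos (by simp; omega),
          if_neg (by simp [Fin.ext_iff]; omega), (hαμ _).1, (hαμ _).2] at this
        linarith
    have hβ : ∀ a, (A a).1 0 1 = 0 := by
      intro a
      -- Mirror image of the previous exception: the last index is tested on the indices $2s-2$,
      -- $2s-3$.
      by_cases ha : (a : ℕ) = 2 * s
      · have := h a ⟨2 * s - 2, by omega⟩ ⟨2 * s - 3, by omega⟩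
        rw [irrep_entry, irrep_entry, if_neg (by simp; omega), if_pos (by simp; omega),
          if_neg (by simp; omega), if_neg (by simp; omega), if_neg (by simp [Fin.ext_iff]; omega),
          if_neg (by simp; omega), if_neg (by simp; omega),
          if_neg (by simp [Fin.ext_iff]; omega)] at this
        have h2 : (((2 * s - 3 : ℕ) : ℝ) + 1) * (2 * s - (2 * s - 3 : ℕ)) ≠ 0 := by
          rw [Nat.cast_sub (by omega)]
          push_cast
          have hs' : (2 : ℝ) ≤ s := by exact_mod_cast hs
          exact mul_ne_zero (by linarith) (by linarith)
        simp only [add_zero, zero_add] at this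
        exact (mul_eq_zero.1 this).resolve_right h2
      · have hlt : (a : ℕ) + 1 < 2 * s + 1 := by omega
        have := h a ⟨a + 1, hlt⟩ a
        rw [irrep_entry, irrep_entry, if_neg (by simp [Fin.ext_iff]), if_pos (by simp),
          if_neg (by simp; omega), if_neg (by simp [Fin.ext_iff]), if_pos rfl, if_neg (by simp),
          if_neg (by simp), if_pos rfl, (hαμ _).1, (hαμ _).2] at this
        have h2 : (((a : ℕ) : ℝ) + 1) * (2 * s - (a : ℕ)) ≠ 0 := by
          have : ((a : ℕ) : ℝ) < 2 * s := by exact_mod_cast (by omega : (a : ℕ) < 2 * s)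
          exact mul_ne_zero (by positivity) (by linarith)
        simp only [add_zero, zero_add, zero_mul] at this
        exact (mul_eq_zero.1 this).resolve_right h2
    refine ⟨funext fun a => ?_, funext fun a => (hαμ a).2⟩
    rw [slMk_eq (A a), (hαμ a).1, hγ, hβ, slMk_zero]; rfl
  · refine ⟨?_, rfl⟩
    -- For $s=1$ and `μ = 0` the nine coefficients of the three elements of $\mathfrak{sl}_2$ are
    -- killed by the nine scalar components of the identity over the three pairs of indices.
    have h010 := h 0 1 0
    have h011 := h 0 1 1
    have h012 := h 0 1 2
    have h021 := h 0 2 1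
    have h022 := h 0 2 2
    have h020 := h 0 2 0
    have h122 := h 1 2 2
    have h121 := h 1 2 1
    have h120 := h 1 2 0
    simp [irrep_entry] at h010 h011 h012 h021 h022 h020 h122 h121 h120
    have h022' := h022.resolve_right (by norm_num)
    have h121' := h121.resolve_right (by norm_num)
    have key : ∀ a, A a = 0 := by
      intro a
      have h3 : (A a).1 0 0 = 0 ∧ (A a).1 0 1 = 0 ∧ (A a).1 1 0 = 0 := by
        fin_cases a <;> simp <;> refine ⟨?_, ?_, ?_⟩ <;> linarith
      rw [slMk_eq (A a), h3.1, h3.2.1, h3.2.2, slMk_zero]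
    exact funext key

theorem form_single (a b : Fin (2 * s + 1)) (i j : Fin 2) :
    form (Matrix.single a i 1) (Matrix.single b j 1) =
      if b = a.rev then (-1) ^ (a : ℕ) * (if i = 0 ∧ j = 1 then 1 else if i = 1 ∧ j = 0 then -1 else 0)
      else 0 := by
  rw [form_apply, Finset.sum_eq_single a]
  · split_ifs with h h1 h2
    · obtain ⟨rfl, rfl⟩ := h1; subst h; simp
    · obtain ⟨rfl, rfl⟩ := h2; subst h; simp
    · subst h; fin_cases i <;> fin_cases j <;> simp_all
    · simp [Matrix.single_apply_of_row_ne h]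
  · intro d _ hd
    simp [Matrix.single_apply_of_row_ne (Ne.symm hd)]
  · simp

theorem eq_zero_of_single {W : Type*} [AddCommGroup W] [Module ℝ W]
    (F : Matrix (Fin (2 * s + 1)) (Fin 2) ℝ →ₗ[ℝ] W) (h : ∀ a i, F (Matrix.single a i 1) = 0) :
    F = 0 := by
  ext1 x
  rw [Matrix.matrix_eq_sum_single x, map_sum]
  refine Finset.sum_eq_zero fun a _ => ?_
  rw [map_sum]
  refine Finset.sum_eq_zero fun i _ => ?_
  rw [show Matrix.single a i (x a i) = x a i • Matrix.single a i (1 : ℝ) by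
    rw [Matrix.smul_single, smul_eq_mul, mul_one], map_smul, h, smul_zero]

/-- Vanishing of the first prolongation of `(η, sl₂ × gl₂)`: for `s ≥ 2`, and, for `s = 1`, after
normalization of the diagonal components. -/
theorem first_prolongation
    (F : Matrix (Fin (2 * s + 1)) (Fin 2) ℝ →ₗ[ℝ]
      LieAlgebra.SpecialLinear.sl (Fin 2) ℝ × Matrix (Fin 2) (Fin 2) ℝ)
    (u : Matrix (Fin (2 * s + 1)) (Fin 2) ℝ)
    (h : ∀ x y, form x y • u = act s (F x) y - act s (F y) x)
    (hs : 2 ≤ s ∨ s = 1 ∧ ∀ a i, (F (Matrix.single a i 1)).2 i i = 0) : F = 0 ∧ u = 0 := by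
  have hs0 : 0 < s := by rcases hs with h | h <;> omega
  have he : ∀ a i b j d l, form (Matrix.single a i 1) (Matrix.single b j 1) * u d l =
      ((if l = j then irrep s (F (Matrix.single a i 1)).1 d b else 0) +
        (if d = b then (F (Matrix.single a i 1)).2 l j else 0)) -
      ((if l = i then irrep s (F (Matrix.single b j 1)).1 d a else 0) +
        (if d = a then (F (Matrix.single b j 1)).2 l i else 0)) := by
    intro a i b j d l
    have := congrFun (congrFun (h (Matrix.single a i 1) (Matrix.single b j 1)) d) l
    rwa [Matrix.sub_apply, act_single, act_single] at this
  -- Each column of the matrix space is isotropic, so the left side drops out and the restriction of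
  -- `F` to it satisfies the classical identity for $\mathfrak{sl}_2\times\mathbb R$.
  have hclass : ∀ i, (fun a => (F (Matrix.single a i 1)).1) = 0 ∧
      (fun a => (F (Matrix.single a i 1)).2 i i) = 0 := by
    intro i
    refine classical_prolongation _ _ (fun a b d => ?_) (hs.imp_right fun h => ⟨h.1, funext fun a =>
      h.2 a i⟩)
    have := he a i b i d i
    rw [form_single, if_pos rfl, if_pos rfl, if_neg (c := i = 0 ∧ i = 1) (by omega),
      if_neg (c := i = 1 ∧ i = 0) (by omega), mul_zero, ite_self, zero_mul] at this
    exact (sub_eq_zero.1 this.symm)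
  have hR : ∀ a i, (F (Matrix.single a i 1)).1 = 0 := fun a i => congrFun (hclass i).1 a
  have hD : ∀ a i, (F (Matrix.single a i 1)).2 i i = 0 := fun a i => congrFun (hclass i).2 a
  simp only [hR, map_zero, Matrix.zero_apply, ite_self, zero_add] at he
  -- With `b` different from `a` and from its opposite, the form term vanishes and the `b`-row of
  -- the identity contains only the $\mathfrak{gl}_2$ component at `a`.
  have hthird : ∀ a : Fin (2 * s + 1), ∃ b, b ≠ a ∧ b ≠ a.rev := by
    intro a
    by_cases h0 : (a : ℕ) = s
    · exact ⟨⟨0, by omega⟩, by simp [Fin.ext_iff]; omega, by simp [Fin.ext_iff, Fin.val_rev]; omega⟩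
    · exact ⟨⟨s, by omega⟩, by simp [Fin.ext_iff]; omega, by simp [Fin.ext_iff, Fin.val_rev]; omega⟩
  have hM : ∀ a i l j, (F (Matrix.single a i 1)).2 l j = 0 := by
    intro a i l j
    obtain ⟨b, hb, hb'⟩ := hthird a
    have := he a i b j b l
    rw [form_single, if_neg hb', if_pos rfl, if_neg hb, zero_mul, sub_zero] at this
    exact this.symm
  have hF : F = 0 := eq_zero_of_single F fun a i => Prod.ext (hR a i) (by ext l j; exact hM a i l j)
  refine ⟨hF, ?_⟩
  ext d l
  -- Once `F = 0`, evaluation at a pair on which the form is nonzero gives `u = 0`.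
  have := he 0 0 (Fin.rev 0) 1 d l
  rw [form_single] at this
  simpa [hM] using this

end SlIrrep

/-! ### Degree one derivations and completeness for $s\ge 2$ -/

namespace FlagSymbol

open SlIrrep Matrix

namespace Coordinates

variable {S : FlagSymbol} {s : ℕ} (K : Coordinates S s)

/-- The first prolongation condition, in coordinates. -/
theorem first_prolongation (hs0 : 0 < s) (f : S.X →ₗ[ℝ] S.uF) (u : S.X)
    (h : ∀ x y, S.σ x y • u = (f x : Module.End ℝ S.X) y - (f y : Module.End ℝ S.X) x)
    (hs : 2 ≤ s ∨ s = 1 ∧ ∀ a i, ((K.equivUF hs0).symm (f (K.κ (Matrix.single a i 1)))).2 i i = 0) :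
    f = 0 ∧ u = 0 := by
  let F : Matrix (Fin (2 * s + 1)) (Fin 2) ℝ →ₗ[ℝ]
      LieAlgebra.SpecialLinear.sl (Fin 2) ℝ × Matrix (Fin 2) (Fin 2) ℝ :=
    ((K.equivUF hs0).symm.toLinearEquiv : S.uF →ₗ[ℝ] _) ∘ₗ f ∘ₗ (K.κ : _ →ₗ[ℝ] S.X)
  have hF : ∀ x, f (K.κ x) = K.equivUF hs0 (F x) := fun x =>
    ((K.equivUF hs0).apply_symm_apply (f (K.κ x))).symm
  have h' := SlIrrep.first_prolongation F (K.c • K.κ.symm u) (fun x y => K.κ.injective (by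
    have := h (K.κ x) (K.κ y)
    rw [hF, hF, equivUF_coe, equivUF_coe, act_κ, act_κ, K.σ_eq] at this
    rw [map_sub, ← this, map_smul, map_smul, LinearEquiv.apply_symm_apply, smul_smul, mul_comm]))
    hs
  constructor
  · ext1 x
    obtain ⟨x, rfl⟩ := K.κ.surjective x
    rw [hF, h'.1]
    simp
  · have := (smul_eq_zero.1 h'.2).resolve_left K.c_ne
    simpa using this

theorem exists_σ_eq_one (K : Coordinates S s) : ∃ v w, S.σ v w = 1 := by
  refine ⟨K.κ (Matrix.single 0 0 1), K.c⁻¹ • K.κ (Matrix.single (Fin.rev 0) 1 1), ?_⟩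
  rw [map_smul, K.σ_eq, form_single]
  simp [K.c_ne]

/-- The identity on pairs of elements of $X$ already forces vanishing; the condition involving the
centre is not needed. -/
theorem firstProlongation_eq_bot (hs : 2 ≤ s) (K : Coordinates S s) :
    S.firstProlongation S.uF = ⊥ := by
  rw [eq_bot_iff]
  rintro ⟨f, g⟩ ⟨h, -⟩
  have := K.first_prolongation (by omega) f (g 1) (fun x y => by
    rw [← map_smul, smul_eq_mul, mul_one]; exact h x y) (Or.inl hs)
  refine Prod.ext this.1 ?_
  ext
  exact this.2

/-- For `s ≥ 2`, a prolongation algebra without positive part is complete. -/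
theorem eq_zero_of_mem_gr_zero (K : Coordinates S s) (hs0 : 0 < s) {L : Type} [LieRing L]
    [LieAlgebra ℝ L] (P : ProlongationAlgebra S S.uF L) (d : S.X →ₗ[ℝ] L) (u : L)
    (hd : ∀ v, d v ∈ P.gr 0) (hu : u ∈ P.gr (-1))
    (h : ∀ v w, ⁅d v, P.inclX w⁆ - ⁅d w, P.inclX v⁆ = S.σ v w • u)
    (hs : 2 ≤ s ∨ s = 1 ∧ ∀ a i A, P.incl0 A = d (K.κ (Matrix.single a i 1)) →
      ((K.equivUF hs0).symm A).2 i i = 0) : ∀ v, d v = 0 := by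
  have hd' : ∀ v, ∃ A, P.incl0 A = d v := fun v => by
    have := hd v
    rw [P.gr_zero] at this
    exact this
  choose f hf using hd'
  -- Injectivity of the inclusion of the degree zero part makes the chosen preimages linear, which
  -- yields an element to which the coordinate computation applies.
  let f' : S.X →ₗ[ℝ] S.uF :=
    { toFun := f
      map_add' := fun v w => P.incl0_injective (by rw [map_add, hf, hf, hf, map_add])
      map_smul' := fun c v => P.incl0_injective (by
        rw [RingHom.id_apply, map_smul, hf, hf, map_smul]) }
  rw [P.gr_neg_one] at hu
  obtain ⟨u, rfl⟩ := hu
  have h1 := K.first_prolongation hs0 f' u (fun x y => by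
    have h2 := h x y
    rw [← hf, ← hf, P.lie_incl0_inclX, P.lie_incl0_inclX, ← map_sub] at h2
    have h3 : Function.Injective P.inclX := fun a b hab => by
      have := P.incl_injective hab
      exact congrArg Prod.fst this
    refine h3 ?_
    rw [map_smul]
    exact h2.symm) (hs.imp_right fun h4 => ⟨h4.1, fun a i => h4.2 a i _ (hf _)⟩)
  intro v
  rw [← hf v]
  have : f v = 0 := LinearMap.congr_fun h1.1 v
  rw [this, map_zero]

/-- Derivations of degree at least two take $X$ into positive degrees, which are zero; those of
degree one vanish by the first prolongation. So all of them are brackets with `0`. -/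
theorem isComplete_of_two_le (K : Coordinates S s) (hs : 2 ≤ s) {L : Type} [LieRing L] [LieAlgebra ℝ L]
    (P : ProlongationAlgebra S S.uF L) (h0 : ∀ i, 0 < i → P.gr i = ⊥) : P.IsComplete := by
  intro k d u hd hu h _
  suffices hd0 : ∀ v, d v = 0 from ⟨0, Submodule.zero_mem _, fun v => by rw [hd0, zero_lie]⟩
  rcases Nat.eq_zero_or_pos k with rfl | hk
  · exact K.eq_zero_of_mem_gr_zero (by omega) P d u (fun v => by simpa using hd v)
      (by simpa using hu) h (Or.inl hs)
  · intro v
    have := hd v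
    rw [h0 k (by exact_mod_cast hk)] at this
    exact this

end Coordinates

end FlagSymbol

/-! ### Eigenspace gradings and the semidirect sum with the Heisenberg algebra -/

namespace FlagSymbol

/-- The grading by the integral eigenspaces of an endomorphism. -/
def eigenGrading {L : Type} [AddCommGroup L] [Module ℝ L] (G : Module.End ℝ L) (i : ℤ) :
    Submodule ℝ L := Module.End.eigenspace G (i : ℝ)

theorem mem_eigenGrading {L : Type} [AddCommGroup L] [Module ℝ L] {G : Module.End ℝ L} {i : ℤ}
    {x : L} : x ∈ eigenGrading G i ↔ G x = (i : ℝ) • x := Module.End.mem_eigenspace_iff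

theorem eigenGrading_isInternal {L : Type} [AddCommGroup L] [Module ℝ L] {G : Module.End ℝ L}
    (h : ∀ x, x ∈ ⨆ i, eigenGrading G i) : DirectSum.IsInternal (eigenGrading G) := by
  refine DirectSum.isInternal_submodule_of_iSupIndep_of_iSup_eq_top ?_ (eq_top_iff.2 fun x _ => h x)
  exact (Module.End.eigenspaces_iSupIndep G).comp Int.cast_injective

theorem lie_mem_eigenGrading {L : Type} [LieRing L] [LieAlgebra ℝ L] {G : Module.End ℝ L}
    (hG : ∀ x y, G ⁅x, y⁆ = ⁅G x, y⁆ + ⁅x, G y⁆) {i j : ℤ} {x y : L} (hx : x ∈ eigenGrading G i)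
    (hy : y ∈ eigenGrading G j) : ⁅x, y⁆ ∈ eigenGrading G (i + j) := by
  rw [mem_eigenGrading] at *
  rw [hG, hx, hy, smul_lie, lie_smul, ← add_smul, Int.cast_add]

namespace Coordinates

open SlIrrep Matrix

variable {S : FlagSymbol} {s : ℕ} (K : Coordinates S s)

/-- The action of `sl₂ × gl₂` on the Heisenberg algebra by derivations. -/
noncomputable def derivationHom :
    LieAlgebra.SpecialLinear.sl (Fin 2) ℝ × Matrix (Fin 2) (Fin 2) ℝ →ₗ⁅ℝ⁆
      LieDerivation ℝ S.Heis S.Heis where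
  toFun p :=
    -- Being a derivation forces the action on the centre to be the conformal factor of the action
    -- on $X$, namely the trace.
    { toLinearMap := LinearMap.prodMap (K.act p) (p.2.trace • LinearMap.id)
      leibniz' := fun u v => Prod.ext
        (by
          change K.act p 0 = 0 - 0
          rw [map_zero, sub_zero])
        (by
          change p.2.trace * S.σ u.1 v.1 = S.σ u.1 (K.act p v.1) - S.σ v.1 (K.act p u.1)
          have h1 := K.σ_act p u.1 v.1
          have h2 : S.σ v.1 (K.act p u.1) = - S.σ (K.act p u.1) v.1 := by
            have := S.σ_self (v.1 + K.act p u.1)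
            simp only [map_add, LinearMap.add_apply, S.σ_self] at this
            linarith
          rw [h2]; linarith) }
  map_add' p q := by
    ext1 u
    refine Prod.ext ?_ ?_
    · change K.act (p + q) u.1 = K.act p u.1 + K.act q u.1
      rw [map_add]; rfl
    · change (p.2 + q.2).trace * u.2 = p.2.trace * u.2 + q.2.trace * u.2
      rw [Matrix.trace_add, add_mul]
  map_smul' c p := by
    ext1 u
    refine Prod.ext ?_ ?_
    · change K.act (c • p) u.1 = c • K.act p u.1
      rw [map_smul]; rfl
    · change (c • p.2).trace * u.2 = c * (p.2.trace * u.2)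
      rw [Matrix.trace_smul, smul_eq_mul, mul_assoc]
  map_lie' := by
    intro p q
    ext1 u
    rw [LieDerivation.lie_apply]
    refine Prod.ext ?_ ?_
    · change K.act ⁅p, q⁆ u.1 = K.act p (K.act q u.1) - K.act q (K.act p u.1)
      rw [LieHom.map_lie]; rfl
    · change (p.2 * q.2 - q.2 * p.2).trace * u.2 =
        p.2.trace * (q.2.trace * u.2) - q.2.trace * (p.2.trace * u.2)
      rw [Matrix.trace_sub, Matrix.trace_mul_comm]
      ring

theorem derivationHom_ofX (p) (x : S.X) :
    K.derivationHom p (Heis.ofX S x) = Heis.ofX S (K.act p x) :=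
  Prod.ext rfl (mul_zero _)

/-- The semidirect sum of `η` and `sl₂ × gl₂`. -/
abbrev Semi : Type :=
  LieAlgebra.SemiDirectSum S.Heis
    (LieAlgebra.SpecialLinear.sl (Fin 2) ℝ × Matrix (Fin 2) (Fin 2) ℝ) K.derivationHom

/-- The degree derivation of the semidirect sum. -/
noncomputable def semiDegree : Module.End ℝ K.Semi where
  toFun z := ⟨(-z.left.1, -2 * z.left.2), 0⟩
  map_add' y z := by
    refine LieAlgebra.SemiDirectSum.ext (Prod.ext ?_ ?_) ?_
    · change -(y.left.1 + z.left.1) = -y.left.1 + -z.left.1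
      abel
    · change -2 * (y.left.2 + z.left.2) = -2 * y.left.2 + -2 * z.left.2
      ring
    · exact (add_zero _).symm
  map_smul' c z := by
    refine LieAlgebra.SemiDirectSum.ext (Prod.ext ?_ ?_) ?_
    · change -(c • z.left.1) = c • -z.left.1
      simp
    · change -2 * (c * z.left.2) = c * (-2 * z.left.2)
      ring
    · exact (smul_zero _).symm

theorem semiDegree_lie (y z : K.Semi) :
    K.semiDegree ⁅y, z⁆ = ⁅K.semiDegree y, z⁆ + ⁅y, K.semiDegree z⁆ := by
  refine LieAlgebra.SemiDirectSum.ext (Prod.ext ?_ ?_) ?_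
  · change -(0 + K.act y.right z.left.1 - K.act z.right y.left.1) =
      (0 + K.act 0 z.left.1 - K.act z.right (-y.left.1)) +
        (0 + K.act y.right (-z.left.1) - K.act 0 y.left.1)
    rw [map_zero]
    simp
    abel
  · change -2 * (S.σ y.left.1 z.left.1 + y.right.2.trace * z.left.2 - z.right.2.trace * y.left.2) =
      (S.σ (-y.left.1) z.left.1 + (0 : Matrix (Fin 2) (Fin 2) ℝ).trace * z.left.2 -
          z.right.2.trace * (-2 * y.left.2)) +
        (S.σ y.left.1 (-z.left.1) + y.right.2.trace * (-2 * z.left.2) -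
          (0 : Matrix (Fin 2) (Fin 2) ℝ).trace * y.left.2)
    rw [Matrix.trace_zero, map_neg, map_neg, LinearMap.neg_apply]
    ring
  · change 0 = ⁅(0 : LieAlgebra.SpecialLinear.sl (Fin 2) ℝ × Matrix (Fin 2) (Fin 2) ℝ), z.right⁆ +
      ⁅y.right, (0 : LieAlgebra.SpecialLinear.sl (Fin 2) ℝ × Matrix (Fin 2) (Fin 2) ℝ)⁆
    rw [zero_lie, lie_zero, add_zero]

/-- The degree derivation is scalar on each of the three components, with the distinct values $-1$,
$-2$, $0$, so its eigenspaces are coordinate subspaces. -/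
theorem mem_semi_grading (i : ℤ) (z : K.Semi) : z ∈ eigenGrading K.semiDegree i ↔
    (i ≠ -1 → z.left.1 = 0) ∧ (i ≠ -2 → z.left.2 = 0) ∧ (i ≠ 0 → z.right = 0) := by
  rw [mem_eigenGrading]
  refine (LieAlgebra.SemiDirectSum.ext_iff.trans ((and_congr (Prod.ext_iff (α := S.X) (β := ℝ))
    Iff.rfl).trans and_assoc)).trans ?_
  have key : ∀ {W : Type} [AddCommGroup W] [Module ℝ W] (a : ℤ) (w : W),
      (a : ℝ) • w = (i : ℝ) • w ↔ (i ≠ a → w = 0) := by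
    intro W _ _ a w
    rw [← sub_eq_zero, ← sub_smul, smul_eq_zero, sub_eq_zero, Int.cast_inj, or_iff_not_imp_left,
      eq_comm]
  refine and_congr ?_ (and_congr ?_ ?_)
  · rw [← key]
    change -z.left.1 = (i : ℝ) • z.left.1 ↔ _
    simp
  · rw [← key]
    change -2 * z.left.2 = (i : ℝ) * z.left.2 ↔ _
    simp
  · rw [← key]
    change 0 = (i : ℝ) • z.right ↔ _
    simp

/-- The semidirect sum is a prolongation algebra. -/
noncomputable def semiProlongation (hs : 0 < s) : ProlongationAlgebra S S.uF K.Semi where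
  gr := eigenGrading K.semiDegree
  isInternal := by
    refine eigenGrading_isInternal fun z => ?_
    have e : z = ⟨(z.left.1, 0), 0⟩ + (⟨(0, z.left.2), 0⟩ + ⟨0, z.right⟩) := by
      refine LieAlgebra.SemiDirectSum.ext (Prod.ext ?_ ?_) ?_
      · change z.left.1 = z.left.1 + (0 + 0); simp
      · change z.left.2 = 0 + (z.left.2 + 0); simp
      · change z.right = 0 + (0 + z.right); simp
    rw [e]
    refine Submodule.add_mem _ (Submodule.mem_iSup_of_mem (-1) ?_)
      (Submodule.add_mem _ (Submodule.mem_iSup_of_mem (-2) ?_) (Submodule.mem_iSup_of_mem 0 ?_))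
    · rw [mem_semi_grading]; exact ⟨fun h => absurd rfl h, fun _ => rfl, fun _ => rfl⟩
    · rw [mem_semi_grading]; exact ⟨fun _ => rfl, fun h => absurd rfl h, fun _ => rfl⟩
    · rw [mem_semi_grading]; exact ⟨fun _ => rfl, fun _ => rfl, fun h => absurd rfl h⟩
  lie_mem i j x y hx hy := lie_mem_eigenGrading K.semiDegree_lie hx hy
  incl := LieAlgebra.SemiDirectSum.inl K.derivationHom
  incl_injective := LieAlgebra.SemiDirectSum.inl_injective _
  incl0 := (LieAlgebra.SemiDirectSum.inr K.derivationHom).comp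
    ((K.equivUF hs).symm : S.uF →ₗ⁅ℝ⁆ _)
  incl0_injective := by
    intro a b h
    have h' := congrArg LieAlgebra.SemiDirectSum.right h
    exact (K.equivUF hs).symm.injective h'
  gr_lt i hi := by
    rw [eq_bot_iff]
    intro z hz
    rw [mem_semi_grading] at hz
    exact LieAlgebra.SemiDirectSum.ext (Prod.ext (hz.1 (by omega)) (hz.2.1 (by omega)))
      (hz.2.2 (by omega))
  gr_neg_two := by
    ext z
    rw [mem_semi_grading]
    constructor
    · rintro ⟨h1, -, h3⟩
      exact ⟨z.left.2, LieAlgebra.SemiDirectSum.ext (Prod.ext (h1 (by norm_num)).symm rfl)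
        (h3 (by norm_num)).symm⟩
    · rintro ⟨r, rfl⟩
      exact ⟨fun _ => rfl, fun h => absurd rfl h, fun _ => rfl⟩
  gr_neg_one := by
    ext z
    rw [mem_semi_grading]
    constructor
    · rintro ⟨-, h2, h3⟩
      exact ⟨z.left.1, LieAlgebra.SemiDirectSum.ext (Prod.ext rfl (h2 (by norm_num)).symm)
        (h3 (by norm_num)).symm⟩
    · rintro ⟨r, rfl⟩
      exact ⟨fun h => absurd rfl h, fun _ => rfl, fun _ => rfl⟩
  gr_zero := by
    ext z
    rw [mem_semi_grading]
    constructor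
    · rintro ⟨h1, h2, -⟩
      refine ⟨K.equivUF hs z.right, LieAlgebra.SemiDirectSum.ext
        (Prod.ext (h1 (by norm_num)).symm (h2 (by norm_num)).symm) ?_⟩
      exact (K.equivUF hs).symm_apply_apply z.right
    · rintro ⟨r, rfl⟩
      exact ⟨fun _ => rfl, fun _ => rfl, fun h => absurd rfl h⟩
  lie_incl A x := by
    have h : K.act ((K.equivUF hs).symm A) = A := by
      rw [← K.equivUF_coe hs, LieEquiv.apply_symm_apply]
    refine LieAlgebra.SemiDirectSum.ext (Prod.ext ?_ ?_) ?_
    · change 0 + K.act ((K.equivUF hs).symm A) x - K.act 0 0 = (A : Module.End ℝ S.X) x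
      rw [h]; simp
    · change S.σ 0 x + ((K.equivUF hs).symm A).2.trace * 0 -
        (0 : Matrix (Fin 2) (Fin 2) ℝ).trace * 0 = 0
      simp
    · change ⁅((K.equivUF hs).symm A), (0 : LieAlgebra.SpecialLinear.sl (Fin 2) ℝ ×
        Matrix (Fin 2) (Fin 2) ℝ)⁆ = 0
      rw [lie_zero]
  nondegenerate i hi z hz h := by
    rw [mem_semi_grading] at hz
    refine LieAlgebra.SemiDirectSum.ext (Prod.ext (hz.1 (by omega)) (hz.2.1 (by omega))) ?_
    apply K.act_injective hs
    change K.act z.right = K.act 0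
    rw [map_zero]
    ext1 x
    have h1 := congrArg (fun w : K.Semi => w.left.1) (h (Heis.ofX S x))
    change 0 + K.act z.right x - K.act 0 z.left.1 = 0 at h1
    simpa using h1

theorem semi_isUniversal (hs : 2 ≤ s) : S.IsUniversalProlongation S.uF K.Semi := by
  obtain ⟨v, w, h⟩ := K.exists_σ_eq_one
  refine (K.semiProlongation (by omega)).isUniversal_of_isComplete
    (K.isComplete_of_two_le hs _ fun i hi => ?_) h
  rw [eq_bot_iff]
  intro z hz
  have hz' := (K.mem_semi_grading i z).1 hz
  exact LieAlgebra.SemiDirectSum.ext (Prod.ext (hz'.1 (by omega)) (hz'.2.1 (by omega)))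
    (hz'.2.2 (by omega))

end Coordinates

end FlagSymbol

/-! ## The contact grading of `so(4,3)` -/

namespace SplitSo

open SlIrrep
open scoped Matrix

/-- A matrix in `3 × 3` blocks. -/
def block {α β γ : Type*} (a : Matrix α α ℝ) (b : Matrix α β ℝ) (c : Matrix α γ ℝ)
    (d : Matrix β α ℝ) (e : Matrix β β ℝ) (f : Matrix β γ ℝ) (g : Matrix γ α ℝ) (h : Matrix γ β ℝ)
    (i : Matrix γ γ ℝ) : Matrix (α ⊕ β ⊕ γ) (α ⊕ β ⊕ γ) ℝ :=
  Matrix.fromBlocks a (Matrix.fromCols b c) (Matrix.fromRows d g) (Matrix.fromBlocks e f h i)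

section block

variable {α β γ : Type*}
  {a a' : Matrix α α ℝ} {b b' : Matrix α β ℝ} {c c' : Matrix α γ ℝ}
  {d d' : Matrix β α ℝ} {e e' : Matrix β β ℝ} {f f' : Matrix β γ ℝ} {g g' : Matrix γ α ℝ}
  {h h' : Matrix γ β ℝ} {i i' : Matrix γ γ ℝ}

theorem block_mul [Fintype α] [Fintype β] [Fintype γ] :
    block a b c d e f g h i * block a' b' c' d' e' f' g' h' i' =
      block (a * a' + b * d' + c * g') (a * b' + b * e' + c * h') (a * c' + b * f' + c * i')
        (d * a' + e * d' + f * g') (d * b' + e * e' + f * h') (d * c' + e * f' + f * i')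
        (g * a' + h * d' + i * g') (g * b' + h * e' + i * h') (g * c' + h * f' + i * i') := by
  ext (x | x | x) (y | y | y) <;>
    simp [block, Matrix.mul_apply, Fintype.sum_sum_type, add_assoc]

theorem block_add :
    block a b c d e f g h i + block a' b' c' d' e' f' g' h' i' =
      block (a + a') (b + b') (c + c') (d + d') (e + e') (f + f') (g + g') (h + h') (i + i') := by
  ext (x | x | x) (y | y | y) <;> simp [block]

theorem block_sub :
    block a b c d e f g h i - block a' b' c' d' e' f' g' h' i' =
      block (a - a') (b - b') (c - c') (d - d') (e - e') (f - f') (g - g') (h - h') (i - i') := by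
  ext (x | x | x) (y | y | y) <;> simp [block]

theorem block_smul (r : ℝ) :
    r • block a b c d e f g h i =
      block (r • a) (r • b) (r • c) (r • d) (r • e) (r • f) (r • g) (r • h) (r • i) := by
  ext (x | x | x) (y | y | y) <;> simp [block]

theorem block_transpose : (block a b c d e f g h i)ᵀ = block aᵀ dᵀ gᵀ bᵀ eᵀ hᵀ cᵀ fᵀ iᵀ := by
  ext (x | x | x) (y | y | y) <;> simp [block]

theorem block_inj : block a b c d e f g h i = block a' b' c' d' e' f' g' h' i' ↔
    a = a' ∧ b = b' ∧ c = c' ∧ d = d' ∧ e = e' ∧ f = f' ∧ g = g' ∧ h = h' ∧ i = i' := by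
  constructor
  · intro H
    rw [block, block, Matrix.fromBlocks_inj, Matrix.fromBlocks_inj] at H
    obtain ⟨h1, h2, h3, h4⟩ := H
    have h2' := Matrix.fromCols_inj h2
    have h3' := Matrix.fromRows_inj h3
    tauto
  · rintro ⟨rfl, rfl, rfl, rfl, rfl, rfl, rfl, rfl, rfl⟩; rfl

theorem exists_block (Z : Matrix (α ⊕ β ⊕ γ) (α ⊕ β ⊕ γ) ℝ) :
    ∃ a b c d e f g h i, Z = block a b c d e f g h i := by
  refine ⟨Matrix.of fun x y => Z (.inl x) (.inl y), Matrix.of fun x y => Z (.inl x) (.inr (.inl y)),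
    Matrix.of fun x y => Z (.inl x) (.inr (.inr y)), Matrix.of fun x y => Z (.inr (.inl x)) (.inl y),
    Matrix.of fun x y => Z (.inr (.inl x)) (.inr (.inl y)),
    Matrix.of fun x y => Z (.inr (.inl x)) (.inr (.inr y)),
    Matrix.of fun x y => Z (.inr (.inr x)) (.inl y),
    Matrix.of fun x y => Z (.inr (.inr x)) (.inr (.inl y)),
    Matrix.of fun x y => Z (.inr (.inr x)) (.inr (.inr y)), ?_⟩
  ext (x | x | x) (y | y | y) <;> simp [block]

end block

/-- The index set of a basis adapted to the contact grading. -/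
abbrev Ix : Type := Fin 2 ⊕ Fin (2 * 1 + 1) ⊕ Fin 2

/-- The standard area form. -/
def area : Matrix (Fin 2) (Fin 2) ℝ := !![0, 1; -1, 0]

/-- The Gram matrix of the symmetric form in the adapted basis. -/
def J : Matrix Ix Ix ℝ := block 0 0 1 0 (-gram 1) 0 1 0 0

/-- The graded parameters: components of degree `-2`, `-1`, `0`, `1`, `2`. -/
abbrev Par : Type :=
  ℝ × Matrix (Fin (2 * 1 + 1)) (Fin 2) ℝ ×
    (LieAlgebra.SpecialLinear.sl (Fin 2) ℝ × Matrix (Fin 2) (Fin 2) ℝ) ×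
    Matrix (Fin (2 * 1 + 1)) (Fin 2) ℝ × ℝ

/-- The skew-adjoint matrix with given parameters. -/
def blk : Par →ₗ[ℝ] Matrix Ix Ix ℝ where
  toFun z := block (-z.2.2.1.2ᵀ) (z.2.2.2.1ᵀ * gram 1) (z.2.2.2.2 • area) z.2.1 (irrep 1 z.2.2.1.1)
    z.2.2.2.1 (z.1 • area) (z.2.1ᵀ * gram 1) z.2.2.1.2
  map_add' z w := by
    simp only [block_add, Prod.fst_add, Prod.snd_add, Matrix.transpose_add, Matrix.add_mul, add_smul,
      neg_add, map_add]
  map_smul' r z := by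
    simp only [block_smul, Prod.smul_fst, Prod.smul_snd, Matrix.transpose_smul, Matrix.smul_mul,
      smul_assoc, smul_neg, map_smul, RingHom.id_apply]

theorem blk_apply (z : Par) : blk z = block (-z.2.2.1.2ᵀ) (z.2.2.2.1ᵀ * gram 1)
    (z.2.2.2.2 • area) z.2.1 (irrep 1 z.2.2.1.1) z.2.2.2.1 (z.1 • area) (z.2.1ᵀ * gram 1)
    z.2.2.1.2 := rfl

theorem area_transpose : areaᵀ = -area := by
  ext i j; fin_cases i <;> fin_cases j <;> simp [area]

theorem area_ne_zero : area ≠ 0 := by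
  intro h
  have := congrFun (congrFun h 0) 1
  simp [area] at this

theorem gram_mul_gram : gram 1 * gram 1 = 1 := by
  ext i j
  rw [gram_mul_apply]
  fin_cases i <;> fin_cases j <;> simp [gram, Fin.ext_iff]

theorem blk_injective : Function.Injective blk := by
  refine (injective_iff_map_eq_zero _).2 fun z hz => ?_
  have h0 : (0 : Matrix Ix Ix ℝ) = block 0 0 0 0 0 0 0 0 0 := by
    ext (x | x | x) (y | y | y) <;> simp [block]
  rw [h0, blk_apply, block_inj] at hz
  obtain ⟨-, -, h3, h4, h5, h6, h7, -, h9⟩ := hz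
  have hi : z.2.2.1 = 0 := by
    apply act_injective one_pos
    ext1 x
    rw [act_apply, h5, h9, map_zero]; simp
  exact Prod.ext ((smul_eq_zero.1 h7).resolve_right area_ne_zero) (Prod.ext h4 (Prod.ext hi
    (Prod.ext h6 ((smul_eq_zero.1 h3).resolve_right area_ne_zero))))

/-- The element of `sl₂` acting as a given skew-adjoint matrix on `ℝ³`. -/
noncomputable def slOf (A : Matrix (Fin (2 * 1 + 1)) (Fin (2 * 1 + 1)) ℝ) :
    LieAlgebra.SpecialLinear.sl (Fin 2) ℝ := slMk (A 0 0 / 2) (A 0 1 / 2) (A 1 0)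

/-- This is the isomorphism $\mathfrak{sl}_2\cong\mathfrak{so}(2,1)$ special to $s=1$: every
skew-adjoint operator on the three-dimensional module comes from $\mathfrak{sl}_2$. It explains why
an orthogonal algebra appears only for $n=6$. -/
theorem irrep_slOf (A : Matrix (Fin (2 * 1 + 1)) (Fin (2 * 1 + 1)) ℝ)
    (hA : Aᵀ * gram 1 + gram 1 * A = 0) : irrep 1 (slOf A) = A := by
  have e : Aᵀ * gram 1 = (gram 1 * A)ᵀ := by rw [Matrix.transpose_mul, gram_transpose]
  rw [e] at hA
  have h : ∀ a b : Fin (2 * 1 + 1), (-1) ^ (b : ℕ) * A b.rev a + (-1) ^ (a : ℕ) * A a.rev b = 0 := by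
    intro a b
    have := congrFun (congrFun hA a) b
    rwa [Matrix.add_apply, Matrix.transpose_apply, gram_mul_apply, gram_mul_apply] at this
  have h00 := h 0 0
  have h01 := h 0 1
  have h02 := h 0 2
  have h11 := h 1 1
  have h12 := h 1 2
  have h22 := h 2 2
  have r0 : (0 : Fin (2 * 1 + 1)).rev = 2 := rfl
  have r1 : (1 : Fin (2 * 1 + 1)).rev = 1 := rfl
  have r2 : (2 : Fin (2 * 1 + 1)).rev = 0 := rfl
  rw [r0] at h00 h01 h02
  rw [r1] at h01 h11 h12
  rw [r2] at h02 h12 h22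
  norm_num at h00 h01 h02 h11 h12 h22
  ext i j
  rw [irrep_entry]
  fin_cases i <;> fin_cases j <;> simp [slOf, slMk] <;> linarith

theorem skew_two (Y : Matrix (Fin 2) (Fin 2) ℝ) (hY : Yᵀ = -Y) : Y = Y 0 1 • area := by
  have h00 := congrFun (congrFun hY 0) 0
  have h01 := congrFun (congrFun hY 0) 1
  have h11 := congrFun (congrFun hY 1) 1
  simp at h00 h01 h11
  ext i j; fin_cases i <;> fin_cases j <;> simp [area] <;> linarith

theorem blk_skew (z : Par) : (blk z)ᵀ * J + J * blk z = 0 := by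
  have h0 : (0 : Matrix Ix Ix ℝ) = block 0 0 0 0 0 0 0 0 0 := by
    ext (x | x | x) (y | y | y) <;> simp [block]
  have hg := irrep_gram (s := 1) z.2.2.1.1
  rw [blk_apply, block_transpose, J, block_mul, block_mul, block_add, h0, block_inj]
  simp only [Matrix.mul_zero, Matrix.zero_mul, Matrix.mul_one, Matrix.one_mul, zero_add, add_zero,
    Matrix.transpose_smul, Matrix.transpose_mul, Matrix.transpose_transpose, gram_transpose,
    Matrix.transpose_neg, area_transpose, Matrix.mul_neg, Matrix.neg_mul]
  refine ⟨?_, ?_, ?_, ?_, ?_, ?_, ?_, ?_, ?_⟩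
  all_goals first
    | (rw [← neg_add, hg, neg_zero])
    | simp

/-- Skew-adjointness decouples blockwise: the corner blocks are skew $2\times2$ matrices, hence
multiples of the area form, the middle block comes from $\mathfrak{sl}_2$, and the remaining blocks
determine each other in pairs. -/
theorem exists_blk {Z : Matrix Ix Ix ℝ} (hZ : Zᵀ * J + J * Z = 0) : ∃ z, blk z = Z := by
  have h0 : (0 : Matrix Ix Ix ℝ) = block 0 0 0 0 0 0 0 0 0 := by
    ext (x | x | x) (y | y | y) <;> simp [block]
  obtain ⟨a, b, c, d, e, f, g, h, i, rfl⟩ := exists_block Z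
  rw [block_transpose, J, block_mul, block_mul, block_add, h0, block_inj] at hZ
  simp only [Matrix.mul_zero, Matrix.zero_mul, Matrix.mul_one, Matrix.one_mul, zero_add, add_zero,
    Matrix.mul_neg, Matrix.neg_mul] at hZ
  obtain ⟨h1, h2, h3, h4, h5, h6, h7, h8, h9⟩ := hZ
  have hf : fᵀ * gram 1 = b := by
    exact (eq_of_sub_eq_zero (by rw [← h8]; abel)).symm
  have hd : dᵀ * gram 1 = h := by
    exact (eq_of_sub_eq_zero (by rw [← h2]; abel)).symm
  refine ⟨(g 0 1, d, (slOf e, i), f, c 0 1), ?_⟩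
  rw [blk_apply, block_inj]
  refine ⟨?_, hf, ?_, rfl, ?_, rfl, ?_, hd, rfl⟩
  · rw [neg_eq_iff_add_eq_zero]; exact h7
  · exact (skew_two c (eq_neg_of_add_eq_zero_left h9)).symm
  · refine irrep_slOf e ?_
    rw [← neg_eq_zero, neg_add]; exact h5
  · exact (skew_two g (eq_neg_of_add_eq_zero_left h1)).symm

end SplitSo

/-! ### An orthonormal frame of signature $(4,3)$ and the bracket relations between graded
components -/

namespace SplitSo

open SlIrrep
open scoped Matrix

/-- An orthonormal frame for the form `J`. -/
noncomputable def frame : Matrix Ix (Fin 4 ⊕ Fin 3) ℝ :=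
  Matrix.of fun i j => Sum.elim
    ![Sum.elim ![1, 0] (Sum.elim ![0, 0, 0] ![1 / 2, 0]),
      Sum.elim ![0, 1] (Sum.elim ![0, 0, 0] ![0, 1 / 2]),
      Sum.elim ![0, 0] (Sum.elim ![1, 0, -1 / 2] ![0, 0]),
      Sum.elim ![0, 0] (Sum.elim ![0, 1, 0] ![0, 0])]
    ![Sum.elim ![1, 0] (Sum.elim ![0, 0, 0] ![-1 / 2, 0]),
      Sum.elim ![0, 1] (Sum.elim ![0, 0, 0] ![0, -1 / 2]),
      Sum.elim ![0, 0] (Sum.elim ![1, 0, 1 / 2] ![0, 0])] j i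

/-- The product of `J` with the frame. -/
noncomputable def coframe : Matrix Ix (Fin 4 ⊕ Fin 3) ℝ :=
  Matrix.of fun i j => Sum.elim
    ![Sum.elim ![1 / 2, 0] (Sum.elim ![0, 0, 0] ![1, 0]),
      Sum.elim ![0, 1 / 2] (Sum.elim ![0, 0, 0] ![0, 1]),
      Sum.elim ![0, 0] (Sum.elim ![1 / 2, 0, -1] ![0, 0]),
      Sum.elim ![0, 0] (Sum.elim ![0, 1, 0] ![0, 0])]
    ![Sum.elim ![-1 / 2, 0] (Sum.elim ![0, 0, 0] ![1, 0]),
      Sum.elim ![0, -1 / 2] (Sum.elim ![0, 0, 0] ![0, 1]),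
      Sum.elim ![0, 0] (Sum.elim ![-1 / 2, 0, -1] ![0, 0])] j i

theorem gram_one : gram 1 = !![0, 0, 1; 0, -1, 0; 1, 0, 0] := by
  ext i j
  simp only [gram, Matrix.of_apply]
  fin_cases i <;> fin_cases j
  all_goals first
    | (rw [if_neg (by decide)]; rfl)
    | (rw [if_pos (by decide)]; simp)

theorem J_mul_frame : J * frame = coframe := by
  have h3 : ∀ f : Fin (2 * 1 + 1) → ℝ, ∑ i, f i = f 0 + f 1 + f 2 := Fin.sum_univ_three
  ext (i | i | i) (j | j) <;> fin_cases i <;> fin_cases j <;>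
    simp [J, frame, coframe, block, Matrix.mul_apply, Fintype.sum_sum_type, h3, gram_one] <;>
    norm_num

theorem frame_transpose_mul : frameᵀ * coframe =
    LieAlgebra.Orthogonal.indefiniteDiagonal (Fin 4) (Fin 3) ℝ := by
  have h3 : ∀ f : Fin (2 * 1 + 1) → ℝ, ∑ i, f i = f 0 + f 1 + f 2 := Fin.sum_univ_three
  ext (i | i) (j | j) <;> fin_cases i <;> fin_cases j <;>
    simp [frame, coframe, Matrix.mul_apply, Fintype.sum_sum_type, h3,
      LieAlgebra.Orthogonal.indefiniteDiagonal] <;> norm_num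

theorem lie_neg_one (x y : Matrix (Fin (2 * 1 + 1)) (Fin 2) ℝ) :
    blk (0, x, 0, 0, 0) * blk (0, y, 0, 0, 0) - blk (0, y, 0, 0, 0) * blk (0, x, 0, 0, 0) =
      blk (form x y, 0, 0, 0, 0) := by
  -- The second product is the transpose of the first, so the difference is a skew $2\times2$
  -- matrix; its coefficient is the symplectic form, which recovers the Heisenberg bracket.
  have h : (xᵀ * gram 1 * y) - (yᵀ * gram 1 * x) = form x y • area := by
    have e : yᵀ * gram 1 * x = (xᵀ * gram 1 * y)ᵀ := by
      simp [Matrix.transpose_mul, gram_transpose, Matrix.mul_assoc]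
    rw [form, e]
    generalize xᵀ * gram 1 * y = Y
    ext i j; fin_cases i <;> fin_cases j <;> simp [area]
  simp only [blk_apply, block_mul, block_sub, block_inj]
  simp [h]

theorem lie_zero_neg_one (p) (x : Matrix (Fin (2 * 1 + 1)) (Fin 2) ℝ) :
    blk (0, 0, p, 0, 0) * blk (0, x, 0, 0, 0) - blk (0, x, 0, 0, 0) * blk (0, 0, p, 0, 0) =
      blk (0, act 1 p x, 0, 0, 0) := by
  have h := irrep_gram (s := 1) p.1
  simp only [blk_apply, block_mul, block_sub, block_inj]
  simp [act_apply, Matrix.add_mul, Matrix.mul_assoc]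
  rw [eq_neg_of_add_eq_zero_left h]
  simp [sub_eq_add_neg, add_comm]

theorem lie_zero_zero (p q) :
    blk (0, 0, p, 0, 0) * blk (0, 0, q, 0, 0) - blk (0, 0, q, 0, 0) * blk (0, 0, p, 0, 0) =
      blk (0, 0, ⁅p, q⁆, 0, 0) := by
  simp only [blk_apply, block_mul, block_sub, block_inj]
  simp [LieRing.of_associative_ring_bracket, Matrix.transpose_sub]

/-- The component in `sl₂ × gl₂` of the bracket of elements of degrees `1` and `-1`. -/
noncomputable def pairing (y x : Matrix (Fin (2 * 1 + 1)) (Fin 2) ℝ) :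
    LieAlgebra.SpecialLinear.sl (Fin 2) ℝ × Matrix (Fin 2) (Fin 2) ℝ :=
  (slOf (y * xᵀ * gram 1 - x * yᵀ * gram 1), -(xᵀ * gram 1 * y))

theorem irrep_pairing (y x : Matrix (Fin (2 * 1 + 1)) (Fin 2) ℝ) :
    irrep 1 (pairing y x).1 = y * xᵀ * gram 1 - x * yᵀ * gram 1 := by
  refine irrep_slOf _ ?_
  simp only [Matrix.transpose_sub, Matrix.transpose_mul, gram_transpose, Matrix.transpose_transpose,
    Matrix.mul_sub, Matrix.sub_mul, Matrix.mul_assoc]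
  abel

theorem lie_one_neg_one (y x : Matrix (Fin (2 * 1 + 1)) (Fin 2) ℝ) :
    blk (0, 0, 0, y, 0) * blk (0, x, 0, 0, 0) - blk (0, x, 0, 0, 0) * blk (0, 0, 0, y, 0) =
      blk (0, 0, pairing y x, 0, 0) := by
  have h := irrep_pairing y x
  simp only [blk_apply, block_mul, block_sub, block_inj, h]
  simp [pairing, Matrix.transpose_mul, gram_transpose, Matrix.mul_assoc]

theorem lie_two_neg_one (q : ℝ) (x : Matrix (Fin (2 * 1 + 1)) (Fin 2) ℝ) :
    blk (0, 0, 0, 0, q) * blk (0, x, 0, 0, 0) - blk (0, x, 0, 0, 0) * blk (0, 0, 0, 0, q) =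
      blk (0, 0, 0, -q • (x * area), 0) := by
  simp only [blk_apply, block_mul, block_sub, block_inj]
  simp [Matrix.transpose_mul, area_transpose, Matrix.mul_assoc]

/-- The degree element. -/
def degreeElt : Par := (0, 0, (0, -1), 0, 0)

/-- Minus the identity of $\mathfrak{gl}_2$ acts by $-1$ on $X$ and, through its trace, by $-2$ on
the centre, so its adjoint eigenvalues are the degrees of the contact grading. -/
theorem lie_degreeElt (z : Par) :
    blk degreeElt * blk z - blk z * blk degreeElt =
      blk (-2 * z.1, -z.2.1, 0, z.2.2.2.1, 2 * z.2.2.2.2) := by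
  simp only [degreeElt, blk_apply, block_mul, block_sub, block_inj]
  refine ⟨?_, ?_, ?_, ?_, ?_, ?_, ?_, ?_, ?_⟩ <;> simp
  · module
  · module

end SplitSo

/-! ### The parametrization and grading of $\mathfrak{so}(4,3)$ -/

namespace SplitSo

open SlIrrep
open scoped Matrix

/-- The Lie algebra `so(4,3)`. -/
abbrev So : Type := LieAlgebra.Orthogonal.so' (Fin 4) (Fin 3) ℝ

/-- The inverse of the frame. -/
noncomputable def unframe : Matrix (Fin 4 ⊕ Fin 3) Ix ℝ :=
  LieAlgebra.Orthogonal.indefiniteDiagonal (Fin 4) (Fin 3) ℝ * coframeᵀ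

theorem indefiniteDiagonal_sq : LieAlgebra.Orthogonal.indefiniteDiagonal (Fin 4) (Fin 3) ℝ *
    LieAlgebra.Orthogonal.indefiniteDiagonal (Fin 4) (Fin 3) ℝ = 1 := by
  rw [LieAlgebra.Orthogonal.indefiniteDiagonal, Matrix.diagonal_mul_diagonal, ← Matrix.diagonal_one]
  congr 1
  ext (i | i) <;> simp

theorem indefiniteDiagonal_transpose :
    (LieAlgebra.Orthogonal.indefiniteDiagonal (Fin 4) (Fin 3) ℝ)ᵀ =
    LieAlgebra.Orthogonal.indefiniteDiagonal (Fin 4) (Fin 3) ℝ :=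
  Matrix.diagonal_transpose _

theorem unframe_mul_frame : unframe * frame = 1 := by
  have h : coframeᵀ * frame = LieAlgebra.Orthogonal.indefiniteDiagonal (Fin 4) (Fin 3) ℝ := by
    rw [← indefiniteDiagonal_transpose, ← frame_transpose_mul, Matrix.transpose_mul,
      Matrix.transpose_transpose]
  rw [unframe, Matrix.mul_assoc, h, indefiniteDiagonal_sq]

theorem frame_mul_unframe : frame * unframe = 1 :=
  (Matrix.mul_eq_one_comm_of_card_eq (Fin 4 ⊕ Fin 3) Ix ℝ (by simp)).1 unframe_mul_frame

theorem J_transpose : Jᵀ = J := by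
  rw [J, block_transpose, Matrix.transpose_neg, gram_transpose]
  simp

theorem indefiniteDiagonal_mul_unframe :
    LieAlgebra.Orthogonal.indefiniteDiagonal (Fin 4) (Fin 3) ℝ * unframe = frameᵀ * J := by
  rw [unframe, ← Matrix.mul_assoc, indefiniteDiagonal_sq, Matrix.one_mul, ← J_mul_frame,
    Matrix.transpose_mul, J_transpose]

theorem unframe_transpose_mul :
    unframeᵀ * LieAlgebra.Orthogonal.indefiniteDiagonal (Fin 4) (Fin 3) ℝ = J * frame := by
  rw [← indefiniteDiagonal_transpose, ← Matrix.transpose_mul, indefiniteDiagonal_mul_unframe,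
    Matrix.transpose_mul, Matrix.transpose_transpose, J_transpose]

theorem mem_so_iff (Z : Matrix (Fin 4 ⊕ Fin 3) (Fin 4 ⊕ Fin 3) ℝ) :
    Z ∈ LieAlgebra.Orthogonal.so' (Fin 4) (Fin 3) ℝ ↔
      Zᵀ * LieAlgebra.Orthogonal.indefiniteDiagonal (Fin 4) (Fin 3) ℝ +
        LieAlgebra.Orthogonal.indefiniteDiagonal (Fin 4) (Fin 3) ℝ * Z = 0 := by
  rw [LieAlgebra.Orthogonal.so', mem_skewAdjointMatricesLieSubalgebra,
    mem_skewAdjointMatricesSubmodule, Matrix.IsSkewAdjoint, Matrix.IsAdjointPair, Matrix.mul_neg,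
    eq_neg_iff_add_eq_zero]

/-- The parametrization of `so(4,3)`. -/
noncomputable def toSo : Par →ₗ[ℝ] So where
  toFun z := ⟨unframe * blk z * frame, by
    have e1 : (unframe * blk z * frame)ᵀ * LieAlgebra.Orthogonal.indefiniteDiagonal (Fin 4) (Fin 3) ℝ =
        frameᵀ * (blk z)ᵀ * (unframeᵀ *
          LieAlgebra.Orthogonal.indefiniteDiagonal (Fin 4) (Fin 3) ℝ) := by
      simp only [Matrix.transpose_mul, Matrix.mul_assoc]
    have e2 : LieAlgebra.Orthogonal.indefiniteDiagonal (Fin 4) (Fin 3) ℝ *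
        (unframe * blk z * frame) = LieAlgebra.Orthogonal.indefiniteDiagonal (Fin 4) (Fin 3) ℝ *
          unframe * blk z * frame := by
      simp only [Matrix.mul_assoc]
    have e3 : frameᵀ * (blk z)ᵀ * (J * frame) + frameᵀ * J * blk z * frame =
        frameᵀ * ((blk z)ᵀ * J + J * blk z) * frame := by
      simp only [Matrix.mul_add, Matrix.add_mul, Matrix.mul_assoc]
    rw [mem_so_iff, e1, e2, unframe_transpose_mul, indefiniteDiagonal_mul_unframe, e3, blk_skew]
    simp⟩
  map_add' z w := Subtype.ext (by
    change unframe * blk (z + w) * frame = unframe * blk z * frame + unframe * blk w * frame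
    rw [map_add, Matrix.mul_add, Matrix.add_mul])
  map_smul' r z := Subtype.ext (by
    change unframe * blk (r • z) * frame = r • (unframe * blk z * frame)
    rw [map_smul, Matrix.mul_smul, Matrix.smul_mul])

theorem toSo_injective : Function.Injective toSo := by
  intro z w h
  have h1 : unframe * blk z * frame = unframe * blk w * frame := congrArg Subtype.val h
  apply blk_injective
  have h2 : ∀ z, frame * (unframe * blk z * frame) * unframe = blk z := fun z => by
    rw [← Matrix.mul_assoc, ← Matrix.mul_assoc, frame_mul_unframe, Matrix.one_mul, Matrix.mul_assoc,
      frame_mul_unframe, Matrix.mul_one]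
  rw [← h2 z, h1, h2]

theorem toSo_surjective : Function.Surjective toSo := by
  rintro ⟨Z, hZ⟩
  rw [mem_so_iff] at hZ
  have h1 : (frame * Z * unframe)ᵀ * J + J * (frame * Z * unframe) = 0 := by
    have h4 : frameᵀ * J = LieAlgebra.Orthogonal.indefiniteDiagonal (Fin 4) (Fin 3) ℝ * unframe :=
      indefiniteDiagonal_mul_unframe.symm
    have h5 : J * frame = unframeᵀ * LieAlgebra.Orthogonal.indefiniteDiagonal (Fin 4) (Fin 3) ℝ :=
      unframe_transpose_mul.symm
    have e : (frame * Z * unframe)ᵀ * J + J * (frame * Z * unframe) =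
        unframeᵀ * (Zᵀ * LieAlgebra.Orthogonal.indefiniteDiagonal (Fin 4) (Fin 3) ℝ +
          LieAlgebra.Orthogonal.indefiniteDiagonal (Fin 4) (Fin 3) ℝ * Z) * unframe := by
      have e1 : (frame * Z * unframe)ᵀ * J = unframeᵀ * Zᵀ * (frameᵀ * J) := by
        simp only [Matrix.transpose_mul, Matrix.mul_assoc]
      have e2 : J * (frame * Z * unframe) = J * frame * Z * unframe := by
        simp only [Matrix.mul_assoc]
      rw [e1, e2, h4, h5]
      simp only [Matrix.mul_add, Matrix.add_mul, Matrix.mul_assoc]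
    rw [e, hZ]; simp
  obtain ⟨z, hz⟩ := exists_blk h1
  refine ⟨z, Subtype.ext ?_⟩
  change unframe * blk z * frame = Z
  rw [hz, ← Matrix.mul_assoc, ← Matrix.mul_assoc, unframe_mul_frame, Matrix.one_mul, Matrix.mul_assoc,
    unframe_mul_frame, Matrix.mul_one]

/-- The parametrization is conjugation by an invertible frame, so the block matrix identities above
are also bracket relations in $\mathfrak{so}(4,3)$. -/
theorem toSo_lie {z w v : Par} (h : blk z * blk w - blk w * blk z = blk v) :
    ⁅toSo z, toSo w⁆ = toSo v := by
  apply Subtype.ext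
  change (unframe * blk z * frame) * (unframe * blk w * frame) -
    (unframe * blk w * frame) * (unframe * blk z * frame) = unframe * blk v * frame
  have h2 : ∀ z w, (unframe * blk z * frame) * (unframe * blk w * frame) =
      unframe * (blk z * blk w) * frame := fun z w => by
    rw [Matrix.mul_assoc, ← Matrix.mul_assoc frame, ← Matrix.mul_assoc frame, frame_mul_unframe,
      Matrix.one_mul]
    simp only [Matrix.mul_assoc]
  rw [h2, h2, ← Matrix.sub_mul, ← Matrix.mul_sub, h]

/-- The degree derivation of the contact grading. -/
noncomputable def degree : Module.End ℝ So := LieAlgebra.ad ℝ So (toSo degreeElt)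

theorem degree_lie (y z : So) : degree ⁅y, z⁆ = ⁅degree y, z⁆ + ⁅y, degree z⁆ := by
  simp only [degree, LieAlgebra.ad_apply]
  rw [leibniz_lie]

theorem mem_grading (i : ℤ) (z : Par) : toSo z ∈ FlagSymbol.eigenGrading degree i ↔
    (i ≠ -2 → z.1 = 0) ∧ (i ≠ -1 → z.2.1 = 0) ∧ (i ≠ 0 → z.2.2.1 = 0) ∧
      (i ≠ 1 → z.2.2.2.1 = 0) ∧ (i ≠ 2 → z.2.2.2.2 = 0) := by
  have key : ∀ {W : Type} [AddCommGroup W] [Module ℝ W] (a : ℤ) (w : W),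
      (a : ℝ) • w = (i : ℝ) • w ↔ (i ≠ a → w = 0) := by
    intro W _ _ a w
    rw [← sub_eq_zero, ← sub_smul, smul_eq_zero, sub_eq_zero, Int.cast_inj, or_iff_not_imp_left,
      eq_comm]
  rw [FlagSymbol.mem_eigenGrading, degree, LieAlgebra.ad_apply, toSo_lie (lie_degreeElt z), ← map_smul,
    toSo_injective.eq_iff, ← key, ← key, ← key, ← key, ← key]
  simp [Prod.ext_iff]

end SplitSo

/-! ### Constraints on derivations of degrees two and three -/

namespace SplitSo

open SlIrrep
open scoped Matrix

theorem lie_one_neg_two (y : Matrix (Fin (2 * 1 + 1)) (Fin 2) ℝ) (r : ℝ) :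
    blk (0, 0, 0, y, 0) * blk (r, 0, 0, 0, 0) - blk (r, 0, 0, 0, 0) * blk (0, 0, 0, y, 0) =
      blk (0, r • (y * area), 0, 0, 0) := by
  simp only [blk_apply, block_mul, block_sub, block_inj]
  simp [Matrix.transpose_mul, area_transpose, Matrix.mul_assoc]

theorem area_mul_area : area * area = -1 := by
  ext i j; fin_cases i <;> fin_cases j <;> simp [area]

theorem irrep_one_slMk (a b c : ℝ) :
    irrep 1 (slMk a b c) = !![2 * a, 2 * b, 0; c, 0, 2 * b; 0, c, -2 * a] := by
  ext i j
  rw [irrep_entry (s := 1) (slMk a b c) i j]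
  fin_cases i <;> fin_cases j <;> simp [slMk] <;> ring

theorem pairing_snd (y x : Matrix (Fin (2 * 1 + 1)) (Fin 2) ℝ) :
    (pairing y x).2 = -(xᵀ * gram 1 * y) := rfl

/-- A derivation of degree `2` from the negative part of `so(4,3)` is determined by its value `p` on
the center, and `p` is a scalar. -/
theorem scalar_of_pairing {p : LieAlgebra.SpecialLinear.sl (Fin 2) ℝ × Matrix (Fin 2) (Fin 2) ℝ}
    {r t : ℝ} (hr : r ≠ 0) (ht : t ≠ 0)
    (h : ∀ x y, irrep 1 (pairing (r • (act 1 p x * area)) y).1 -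
      irrep 1 (pairing (r • (act 1 p y * area)) x).1 = (t * form x y) • irrep 1 p.1) :
    p.1 = 0 ∧ p.2 = p.2 0 0 • 1 := by
  obtain ⟨A, B⟩ := p
  obtain ⟨a, b, c, rfl⟩ : ∃ a b c, A = slMk a b c := ⟨_, _, _, slMk_eq _⟩
  have h3 : ∀ f : Fin (2 * 1 + 1) → ℝ, ∑ i, f i = f 0 + f 1 + f 2 := Fin.sum_univ_three
  have key := fun x y i j => congrArg (fun Z => Z i j) (h x y)
  simp only [irrep_pairing, act_apply, irrep_one_slMk, form_apply, gram_one, Matrix.sub_apply,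
    Matrix.smul_apply, Matrix.mul_apply, Matrix.add_apply, Matrix.transpose_apply, h3,
    Fin.sum_univ_two, smul_eq_mul, area] at key
  -- Basis vectors chosen to isolate single unknowns: `e3`, `e4`, `e5` annihilate the
  -- $\mathfrak{sl}_2$ component, and the other three, together with `e5`, force `B` to be scalar.
  have e1 := key !![1, 0; 0, 0; 0, 0] !![0, 0; 1, 0; 0, 0] 0 1
  have e2 := key !![0, 1; 0, 0; 0, 0] !![0, 0; 0, 1; 0, 0] 0 1
  have e3 := key !![1, 0; 0, 0; 0, 0] !![0, 1; 0, 0; 0, 0] 0 1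
  have e4 := key !![0, 0; 0, 0; 1, 0] !![0, 0; 0, 0; 0, 1] 1 0
  have e5 := key !![0, 0; 1, 0; 0, 0] !![0, 0; 0, 1; 0, 0] 0 0
  have e6 := key !![1, 0; 0, 0; 0, 0] !![0, 0; 0, 1; 0, 0] 0 1
  clear key h
  simp [hr, ht] at e1 e2 e3 e4 e5 e6
  have hB : B 0 1 = 0 := mul_left_cancel₀ hr (by linarith)
  have hB' : B 1 1 = B 0 0 := mul_left_cancel₀ hr (by rw [e5] at e6; linarith)
  refine ⟨by rw [e3, e4, e5, slMk_zero], ?_⟩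
  ext i j
  fin_cases i <;> fin_cases j <;> simp [hB, hB', e1]

/-- There are no derivations of degree `3` from the negative part of `so(4,3)`. -/
theorem eq_zero_of_smul_area {l : Matrix (Fin (2 * 1 + 1)) (Fin 2) ℝ →ₗ[ℝ] ℝ} {t : ℝ}
    {u : Matrix (Fin (2 * 1 + 1)) (Fin 2) ℝ}
    (h : ∀ x y, -l x • (y * area) - -l y • (x * area) = (t * form x y) • u) : l = 0 := by
  refine eq_zero_of_single l fun a i => ?_
  obtain ⟨b, hb⟩ : ∃ b : Fin (2 * 1 + 1), b ≠ a := exists_ne a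
  -- Two vectors in the same column are skew-orthogonal. Multiplication by the area form moves them
  -- to the other column, and row `b` then sees only the term with `l x`.
  have h1 := congrFun (congrFun (h (Matrix.single a i 1) (Matrix.single b i 1)) b) (i + 1)
  rw [form_single] at h1
  fin_cases i <;> simpa [Matrix.mul_apply, Matrix.single_apply, hb.symm, area] using h1

end SplitSo

/-! ### $\mathfrak{so}(4,3)$ as the universal prolongation for $s=1$ -/

namespace FlagSymbol

namespace Coordinates

open SlIrrep SplitSo
open scoped Matrix

variable {S : FlagSymbol} (K : Coordinates S 1)

/-- The embedding of the Heisenberg algebra into `so(4,3)`. -/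
noncomputable def heisToSo : S.Heis →ₗ⁅ℝ⁆ So where
  -- Rescaling the centre compensates for the factor between $\sigma$ and the coordinate form.
  toFun z := toSo (K.c⁻¹ * z.2, K.κ.symm z.1, 0, 0, 0)
  map_add' y z := by
    rw [← map_add]
    congr 1
    refine Prod.ext ?_ (Prod.ext ?_ ?_)
    · change K.c⁻¹ * (y.2 + z.2) = K.c⁻¹ * y.2 + K.c⁻¹ * z.2
      ring
    · change K.κ.symm (y.1 + z.1) = K.κ.symm y.1 + K.κ.symm z.1
      rw [map_add]
    · simp
  map_smul' r z := by
    rw [RingHom.id_apply, ← map_smul]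
    congr 1
    refine Prod.ext ?_ (Prod.ext ?_ ?_)
    · change K.c⁻¹ * (r * z.2) = r * (K.c⁻¹ * z.2)
      ring
    · change K.κ.symm (r • z.1) = r • K.κ.symm z.1
      rw [map_smul]
    · simp
  map_lie' := by
    intro y z
    have h1 : ∀ (a b : ℝ) (x x'), blk (a, x, 0, 0, 0) * blk (b, x', 0, 0, 0) -
        blk (b, x', 0, 0, 0) * blk (a, x, 0, 0, 0) = blk (form x x', 0, 0, 0, 0) := by
      intro a b x x'
      rw [← lie_neg_one]
      simp only [blk_apply, block_mul, block_sub, block_inj]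
      simp
    change toSo (K.c⁻¹ * S.σ y.1 z.1, K.κ.symm 0, 0, 0, 0) = _
    rw [toSo_lie (h1 _ _ _ _), map_zero]
    congr 3
    have h2 := K.σ_eq (K.κ.symm y.1) (K.κ.symm z.1)
    rw [LinearEquiv.apply_symm_apply, LinearEquiv.apply_symm_apply] at h2
    rw [h2, inv_mul_cancel_left₀ K.c_ne]

/-- The embedding of `𝔲^F(δ)` into `so(4,3)`. -/
noncomputable def uFToSo : S.uF →ₗ⁅ℝ⁆ So where
  toFun A := toSo (0, 0, (K.equivUF one_pos).symm A, 0, 0)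
  map_add' A B := by
    rw [← map_add, map_add]
    simp
  map_smul' r A := by
    rw [RingHom.id_apply, ← map_smul, map_smul]
    simp
  map_lie' := by
    intro A B
    rw [toSo_lie (lie_zero_zero _ _), LieEquiv.map_lie]

theorem heisToSo_ofX (x : S.X) : K.heisToSo (Heis.ofX S x) = toSo (0, K.κ.symm x, 0, 0, 0) := by
  change toSo (K.c⁻¹ * 0, K.κ.symm x, 0, 0, 0) = _
  rw [mul_zero]

theorem heisToSo_ofR (r : ℝ) : K.heisToSo (Heis.ofR S r) = toSo (K.c⁻¹ * r, 0, 0, 0, 0) := by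
  change toSo (K.c⁻¹ * r, K.κ.symm 0, 0, 0, 0) = _
  rw [map_zero]

theorem uFToSo_equivUF (p) : K.uFToSo (K.equivUF one_pos p) = toSo (0, 0, p, 0, 0) := by
  change toSo (0, 0, (K.equivUF one_pos).symm (K.equivUF one_pos p), 0, 0) = _
  rw [LieEquiv.symm_apply_apply]

/-- The grading of `so(4,3)` makes it a prolongation algebra. -/
noncomputable def soProlongation : ProlongationAlgebra S S.uF So where
  gr := eigenGrading degree
  isInternal := by
    refine eigenGrading_isInternal fun z => ?_
    obtain ⟨⟨a, x, p, y, q⟩, rfl⟩ := toSo_surjective z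
    have e : ((a, x, p, y, q) : Par) = (a, 0, 0, 0, 0) + ((0, x, 0, 0, 0) + ((0, 0, p, 0, 0) +
        ((0, 0, 0, y, 0) + (0, 0, 0, 0, q)))) := by simp
    rw [e, map_add, map_add, map_add, map_add]
    refine Submodule.add_mem _ (Submodule.mem_iSup_of_mem (-2) ?_)
      (Submodule.add_mem _ (Submodule.mem_iSup_of_mem (-1) ?_)
      (Submodule.add_mem _ (Submodule.mem_iSup_of_mem 0 ?_)
      (Submodule.add_mem _ (Submodule.mem_iSup_of_mem 1 ?_)
      (Submodule.mem_iSup_of_mem 2 ?_)))) <;> simp [mem_grading]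
  lie_mem i j x y hx hy := lie_mem_eigenGrading degree_lie hx hy
  incl := K.heisToSo
  incl_injective := by
    intro y z h
    have h1 := toSo_injective h
    simp only [Prod.mk.injEq, EmbeddingLike.apply_eq_iff_eq, mul_eq_mul_left_iff, inv_eq_zero,
      K.c_ne, or_false] at h1
    exact Prod.ext h1.2.1 h1.1
  incl0 := K.uFToSo
  incl0_injective := by
    intro y z h
    have h1 := toSo_injective h
    simp only [Prod.mk.injEq, EmbeddingLike.apply_eq_iff_eq] at h1
    exact h1.2.2.1
  gr_lt i hi := by
    rw [eq_bot_iff]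
    intro z hz
    obtain ⟨z, rfl⟩ := toSo_surjective z
    rw [mem_grading] at hz
    rw [Submodule.mem_bot, ← map_zero toSo]
    congr 1
    exact Prod.ext (hz.1 (by omega)) (Prod.ext (hz.2.1 (by omega)) (Prod.ext (hz.2.2.1 (by omega))
      (Prod.ext (hz.2.2.2.1 (by omega)) (hz.2.2.2.2 (by omega)))))
  gr_neg_two := by
    ext z
    obtain ⟨⟨a, x, p, y, q⟩, rfl⟩ := toSo_surjective z
    rw [mem_grading]
    constructor
    · intro h
      norm_num at h
      refine ⟨K.c * a, (K.heisToSo_ofR _).trans ?_⟩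
      rw [inv_mul_cancel_left₀ K.c_ne, h.1, h.2.1, h.2.2.1, h.2.2.2]
    · rintro ⟨r, hr⟩
      have h1 := toSo_injective ((K.heisToSo_ofR r).symm.trans hr)
      simp only [Prod.mk.injEq] at h1
      simp [← h1.2.1, ← h1.2.2.1, ← h1.2.2.2.1, ← h1.2.2.2.2]
  gr_neg_one := by
    ext z
    obtain ⟨⟨a, x, p, y, q⟩, rfl⟩ := toSo_surjective z
    rw [mem_grading]
    constructor
    · intro h
      norm_num at h
      refine ⟨K.κ x, (K.heisToSo_ofX _).trans ?_⟩
      rw [LinearEquiv.symm_apply_apply, h.1, h.2.1, h.2.2.1, h.2.2.2]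
    · rintro ⟨r, hr⟩
      have h1 := toSo_injective ((K.heisToSo_ofX r).symm.trans hr)
      simp only [Prod.mk.injEq] at h1
      simp [← h1.1, ← h1.2.2.1, ← h1.2.2.2.1, ← h1.2.2.2.2]
  gr_zero := by
    ext z
    obtain ⟨⟨a, x, p, y, q⟩, rfl⟩ := toSo_surjective z
    rw [mem_grading]
    constructor
    · intro h
      norm_num at h
      refine ⟨K.equivUF one_pos p, (K.uFToSo_equivUF p).trans ?_⟩
      rw [h.1, h.2.1, h.2.2.1, h.2.2.2]
    · rintro ⟨A, hr⟩
      have h1 := toSo_injective hr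
      simp only [Prod.mk.injEq] at h1
      simp [← h1.1, ← h1.2.1, ← h1.2.2.2.1, ← h1.2.2.2.2]
  lie_incl A x := by
    obtain ⟨p, rfl⟩ := (K.equivUF one_pos).surjective A
    obtain ⟨x, rfl⟩ := K.κ.surjective x
    refine (congrArg₂ Bracket.bracket (K.uFToSo_equivUF p) (K.heisToSo_ofX _)).trans ?_
    refine Eq.trans ?_ (congrArg (fun v => K.heisToSo (Heis.ofX S v)) (K.act_κ p x).symm)
    rw [heisToSo_ofX, toSo_lie (lie_zero_neg_one _ _), LinearEquiv.symm_apply_apply,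
      LinearEquiv.symm_apply_apply]
  nondegenerate i hi z hz h := by
    obtain ⟨⟨a, x, p, y, q⟩, rfl⟩ := toSo_surjective z
    rw [mem_grading] at hz
    have hx : ∀ w, ⁅toSo (a, x, p, y, q), toSo (0, w, 0, 0, 0)⁆ = 0 := fun w => by
      have := h (Heis.ofX S (K.κ w))
      rwa [heisToSo_ofX, LinearEquiv.symm_apply_apply] at this
    obtain rfl : a = 0 := hz.1 (by omega)
    obtain rfl : x = 0 := hz.2.1 (by omega)
    -- The components are eliminated by degree: degree zero by faithfulness on $X$, degree one by
    -- the nondegenerate pairing with $X$, degree two by its bracket with one basis vector.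
    have hp : p = 0 := by
      by_cases hi0 : i = 0
      · obtain rfl : y = 0 := hz.2.2.2.1 (by omega)
        obtain rfl : q = 0 := hz.2.2.2.2 (by omega)
        apply SlIrrep.act_injective (s := 1) one_pos
        ext1 w
        have h1 := hx w
        rw [toSo_lie (lie_zero_neg_one _ _), ← map_zero toSo] at h1
        rw [map_zero]
        exact congrArg (fun v : Par => v.2.1) (toSo_injective h1)
      · exact hz.2.2.1 hi0
    subst hp
    have hy : y = 0 := by
      by_cases hi0 : i = 1
      · obtain rfl : q = 0 := hz.2.2.2.2 (by omega)
        ext b j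
        -- The Gram matrix squares to one, so this test vector makes the $\mathfrak{gl}_2$ component
        -- of the bracket display row `b` of `y`.
        have h1 := hx (gram 1 * Matrix.single b 0 (1 : ℝ))
        rw [toSo_lie (lie_one_neg_one _ _), ← map_zero toSo] at h1
        have h2 : (pairing y (gram 1 * Matrix.single b 0 (1 : ℝ))).2 = 0 :=
          congrArg (fun v : Par => v.2.2.1.2) (toSo_injective h1)
        rw [pairing_snd, Matrix.transpose_mul, gram_transpose, Matrix.mul_assoc (_ᵀ) (gram 1), gram_mul_gram,
          Matrix.mul_one] at h2
        have h3 := congrFun (congrFun h2 0) j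
        simpa [Matrix.mul_apply, Matrix.single_apply] using h3
      · exact hz.2.2.2.1 hi0
    subst hy
    have hq : q = 0 := by
      have h1 := hx (Matrix.single 0 0 1)
      rw [toSo_lie (lie_two_neg_one _ _), ← map_zero toSo] at h1
      have h2 := congrArg (fun v : Par => v.2.2.2.1 0 1) (toSo_injective h1)
      simpa [Matrix.mul_apply, Matrix.single_apply, area] using h2
    subst hq
    exact map_zero toSo

theorem soProlongation_inclX (x) : K.soProlongation.inclX (K.κ x) = toSo (0, x, 0, 0, 0) := by
  refine (K.heisToSo_ofX _).trans ?_
  rw [LinearEquiv.symm_apply_apply]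

theorem soProlongation_inclR (r : ℝ) :
    K.soProlongation.inclR r = toSo (K.c⁻¹ * r, 0, 0, 0, 0) := K.heisToSo_ofR r

theorem soProlongation_incl0 (A : S.uF) :
    K.soProlongation.incl0 A = toSo (0, 0, (K.equivUF one_pos).symm A, 0, 0) := rfl

theorem toSo_mem_soProlongation (i : ℤ) (z : Par) : toSo z ∈ K.soProlongation.gr i ↔
    (i ≠ -2 → z.1 = 0) ∧ (i ≠ -1 → z.2.1 = 0) ∧ (i ≠ 0 → z.2.2.1 = 0) ∧
      (i ≠ 1 → z.2.2.2.1 = 0) ∧ (i ≠ 2 → z.2.2.2.2 = 0) := mem_grading i z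

/-- The parameters of an element of `so(4,3)`. -/
noncomputable def param : So ≃ₗ[ℝ] Par :=
  (LinearEquiv.ofBijective toSo ⟨toSo_injective, toSo_surjective⟩).symm

theorem toSo_param (z : So) : toSo (param z) = z :=
  (LinearEquiv.ofBijective toSo ⟨toSo_injective, toSo_surjective⟩).apply_symm_apply z

theorem eq_toSo_of_mem {i : ℤ} {z : So} (hz : z ∈ K.soProlongation.gr i) :
    (0 ≤ i → (param z).1 = 0 ∧ (param z).2.1 = 0) ∧ (0 < i → (param z).2.2.1 = 0) ∧
      (i ≠ 1 → (param z).2.2.2.1 = 0) ∧ (i ≠ 2 → (param z).2.2.2.2 = 0) := by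
  rw [← toSo_param z, toSo_mem_soProlongation] at hz
  exact ⟨fun h => ⟨hz.1 (by omega), hz.2.1 (by omega)⟩, fun h => hz.2.2.1 (by omega), hz.2.2.2.1,
    hz.2.2.2.2⟩

theorem exists_of_mem_gr_zero {z : So} (hz : z ∈ K.soProlongation.gr 0) :
    z = toSo (0, 0, (param z).2.2.1, 0, 0) := by
  have h := K.eq_toSo_of_mem hz
  conv_lhs => rw [← toSo_param z]
  congr 1
  exact Prod.ext (h.1 le_rfl).1 (Prod.ext (h.1 le_rfl).2 (Prod.ext rfl
    (Prod.ext (h.2.2.1 (by omega)) (h.2.2.2 (by omega)))))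

theorem exists_of_mem_gr_one {z : So} (hz : z ∈ K.soProlongation.gr 1) :
    z = toSo (0, 0, 0, (param z).2.2.2.1, 0) := by
  have h := K.eq_toSo_of_mem hz
  conv_lhs => rw [← toSo_param z]
  congr 1
  exact Prod.ext (h.1 zero_le_one).1 (Prod.ext (h.1 zero_le_one).2 (Prod.ext (h.2.1 one_pos)
    (Prod.ext rfl (h.2.2.2 (by omega)))))

theorem exists_of_mem_gr_two {z : So} (hz : z ∈ K.soProlongation.gr 2) :
    z = toSo (0, 0, 0, 0, (param z).2.2.2.2) := by
  have h := K.eq_toSo_of_mem hz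
  conv_lhs => rw [← toSo_param z]
  congr 1
  exact Prod.ext (h.1 zero_le_two).1 (Prod.ext (h.1 zero_le_two).2 (Prod.ext (h.2.1 two_pos)
    (Prod.ext (h.2.2.1 (by omega)) rfl)))

theorem eq_zero_of_mem_gr {i : ℤ} (hi : 2 < i) {z : So} (hz : z ∈ K.soProlongation.gr i) :
    z = 0 := by
  have h := K.eq_toSo_of_mem hz
  rw [← toSo_param z, ← map_zero toSo]
  congr 1
  exact Prod.ext (h.1 (by omega)).1 (Prod.ext (h.1 (by omega)).2 (Prod.ext (h.2.1 (by omega))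
    (Prod.ext (h.2.2.1 (by omega)) (h.2.2.2 (by omega)))))

/-- Subtracting the inner derivation of `z` leaves a degree one derivation without diagonal
$\mathfrak{gl}_2$ components, and such derivations vanish for $s=1$. -/
theorem eq_lie_of_normalized (K : Coordinates S 1) {L : Type} [LieRing L] [LieAlgebra ℝ L]
    (P : ProlongationAlgebra S S.uF L) (d : S.X →ₗ[ℝ] L) (u z : L)
    (hd : ∀ v, d v ∈ P.gr 0) (hu : u ∈ P.gr (-1)) (hz : z ∈ P.gr 1)
    (h : ∀ v w, ⁅d v, P.inclX w⁆ - ⁅d w, P.inclX v⁆ = S.σ v w • u)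
    (hn : ∀ a i A, P.incl0 A = d (K.κ (Matrix.single a i 1)) - ⁅z, P.inclX (K.κ (Matrix.single a i 1))⁆ →
      ((K.equivUF one_pos).symm A).2 i i = 0) (v : S.X) : d v = ⁅z, P.inclX v⁆ := by
  let d' : S.X →ₗ[ℝ] L := d - (LieAlgebra.ad ℝ L z : L →ₗ[ℝ] L) ∘ₗ P.inclX
  have hd' : ∀ v, d' v = d v - ⁅z, P.inclX v⁆ := fun v => rfl
  suffices h0 : ∀ v, d' v = 0 from sub_eq_zero.1 (h0 v)
  refine K.eq_zero_of_mem_gr_zero one_pos P d' (u - ⁅z, P.inclR 1⁆) (fun v => ?_) ?_ (fun v w => ?_)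
    (Or.inr ⟨rfl, hn⟩)
  · refine Submodule.sub_mem _ (hd v) ?_
    exact P.lie_mem 1 (-1) _ _ hz (P.inclX_mem v)
  · refine Submodule.sub_mem _ hu ?_
    exact P.lie_mem 1 (-2) _ _ hz (P.inclR_mem 1)
  · have e : ⁅⁅z, P.inclX v⁆, P.inclX w⁆ - ⁅⁅z, P.inclX w⁆, P.inclX v⁆ =
        S.σ v w • ⁅z, P.inclR 1⁆ := by
      rw [← lie_smul, ← map_smul, smul_eq_mul, mul_one, ← P.lie_inclX, leibniz_lie z,
        ← lie_skew (P.inclX v)]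
      abel
    rw [smul_sub, ← e, hd', hd', sub_lie, sub_lie, ← h v w]
    abel

/-- For $s=1$ the first prolongation is not zero. The diagonal $\mathfrak{gl}_2$ components of a
degree one derivation are matched by a degree one element of $\mathfrak{so}(4,3)$, which reduces to
the normalized case. -/
theorem soProlongation_complete_zero (d : S.X →ₗ[ℝ] So) (u : So)
    (hd : ∀ v, d v ∈ K.soProlongation.gr 0) (hu : u ∈ K.soProlongation.gr (-1))
    (h : ∀ v w, ⁅d v, K.soProlongation.inclX w⁆ - ⁅d w, K.soProlongation.inclX v⁆ = S.σ v w • u) :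
    ∃ z ∈ K.soProlongation.gr 1, ∀ v, d v = ⁅z, K.soProlongation.inclX v⁆ := by
  -- On the basis vector of row `a` and column `i`, the diagonal component of the bracket with `y`
  -- is $-(-1)^a$ times the entry of `y` in the reversed row; this solves for the values prescribed
  -- by `d`.
  let y : Matrix (Fin (2 * 1 + 1)) (Fin 2) ℝ := Matrix.of fun b i =>
    -((-1) ^ (b : ℕ) * (param (d (K.κ (Matrix.single b.rev i 1)))).2.2.1.2 i i)
  have hz : toSo (0, 0, 0, y, 0) ∈ K.soProlongation.gr 1 := by simp [toSo_mem_soProlongation]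
  refine ⟨toSo (0, 0, 0, y, 0), hz, K.eq_lie_of_normalized K.soProlongation d u _ hd hu hz h
    fun a i A hA => ?_⟩
  rw [K.soProlongation_inclX, toSo_lie (lie_one_neg_one _ _),
    K.exists_of_mem_gr_zero (hd _), ← map_sub, K.soProlongation_incl0] at hA
  have h1 := congrArg (fun v : Par => v.2.2.1.2) (toSo_injective hA)
  change ((K.equivUF one_pos).symm A).2 = (param (d (K.κ (Matrix.single a i 1)))).2.2.1.2 -
    (pairing y (Matrix.single a i (1 : ℝ))).2 at h1
  rw [h1, pairing_snd, Matrix.mul_assoc]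
  have h2 : ((Matrix.single a i (1 : ℝ))ᵀ * (gram 1 * y)) i i = (gram 1 * y) a i := by
    rw [Matrix.transpose_single, Matrix.single_mul_apply_same, one_mul]
  rw [Matrix.sub_apply, Matrix.neg_apply, h2, gram_mul_apply]
  simp only [y, Matrix.of_apply, Fin.rev_rev]
  rw [neg_one_pow_rev]
  have h3 : (-1 : ℝ) ^ (a : ℕ) * (-1) ^ (a : ℕ) = 1 := by
    rw [← mul_pow]; simp
  linear_combination -(param (d (K.κ (Matrix.single a i 1)))).2.2.1.2 i i * h3

/-- The identity with the centre expresses `d` through its central value `p`, the area form being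
invertible. The identity on $X$ then forces `p` to be a scalar, and such derivations are brackets
with the top degree. -/
theorem soProlongation_complete_one (d : S.X →ₗ[ℝ] So) (u : So)
    (hd : ∀ v, d v ∈ K.soProlongation.gr 1) (hu : u ∈ K.soProlongation.gr 0)
    (h : ∀ v w, ⁅d v, K.soProlongation.inclX w⁆ - ⁅d w, K.soProlongation.inclX v⁆ = S.σ v w • u)
    (h' : ∀ v, ⁅d v, K.soProlongation.inclR 1⁆ + ⁅K.soProlongation.inclX v, u⁆ = 0) :
    ∃ z ∈ K.soProlongation.gr 2, ∀ v, d v = ⁅z, K.soProlongation.inclX v⁆ := by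
  let T : S.X → Matrix (Fin (2 * 1 + 1)) (Fin 2) ℝ := fun v => (param (d v)).2.2.2.1
  have hT : ∀ v, d v = toSo (0, 0, 0, T v, 0) := fun v => K.exists_of_mem_gr_one (hd v)
  rw [K.exists_of_mem_gr_zero hu] at h h'
  generalize (param u).2.2.1 = p at h h'
  have h1 : ∀ x, T (K.κ x) = -K.c • (SlIrrep.act 1 p x * area) := fun x => by
    have h2 := h' (K.κ x)
    rw [K.soProlongation_inclX, K.soProlongation_inclR, hT, toSo_lie (lie_one_neg_two _ _),
      ← lie_skew (toSo (0, x, 0, 0, 0)), toSo_lie (lie_zero_neg_one _ _), ← sub_eq_add_neg,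
      sub_eq_zero] at h2
    have h3 : (K.c⁻¹ * 1) • (T (K.κ x) * area) = SlIrrep.act 1 p x :=
      congrArg (fun v : Par => v.2.1) (toSo_injective h2)
    rw [← h3, Matrix.smul_mul, Matrix.mul_assoc, area_mul_area, smul_smul]
    simp [K.c_ne]
  have h2 := scalar_of_pairing (p := p) (neg_ne_zero.2 K.c_ne) K.c_ne fun x y => by
    have h3 := h (K.κ x) (K.κ y)
    rw [K.soProlongation_inclX, K.soProlongation_inclX, hT, hT, toSo_lie (lie_one_neg_one _ _),
      toSo_lie (lie_one_neg_one _ _), ← map_sub, ← map_smul, K.σ_eq] at h3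
    have h4 : (pairing (T (K.κ x)) y).1 - (pairing (T (K.κ y)) x).1 = (K.c * form x y) • p.1 :=
      congrArg (fun v : Par => v.2.2.1.1) (toSo_injective h3)
    rw [← h1, ← h1, ← map_sub, h4, map_smul]
  -- For scalar `p` the formula for `T` gives $-c\,p_{00}$ times `x * area`, while the element of
  -- degree two with parameter $q$ acts by $-q$ times `x * area`.
  refine ⟨toSo (0, 0, 0, 0, K.c * p.2 0 0), by simp [toSo_mem_soProlongation], fun v => ?_⟩
  obtain ⟨x, rfl⟩ := K.κ.surjective v
  rw [hT, h1, K.soProlongation_inclX, toSo_lie (lie_two_neg_one _ _)]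
  congr 5
  rw [SlIrrep.act_apply, h2.1, h2.2]
  simp [smul_smul]

/-- The top degree is one-dimensional, so `d` is a linear functional, and no nonzero functional
satisfies the derivation identity. -/
theorem soProlongation_complete_two (d : S.X →ₗ[ℝ] So) (u : So)
    (hd : ∀ v, d v ∈ K.soProlongation.gr 2) (hu : u ∈ K.soProlongation.gr 1)
    (h : ∀ v w, ⁅d v, K.soProlongation.inclX w⁆ - ⁅d w, K.soProlongation.inclX v⁆ = S.σ v w • u) :
    ∀ v, d v = 0 := by
  let l : Matrix (Fin (2 * 1 + 1)) (Fin 2) ℝ →ₗ[ℝ] ℝ :=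
    LinearMap.snd ℝ _ ℝ ∘ₗ LinearMap.snd ℝ _ _ ∘ₗ LinearMap.snd ℝ _ _ ∘ₗ LinearMap.snd ℝ _ _ ∘ₗ
      (param : So →ₗ[ℝ] Par) ∘ₗ d ∘ₗ (K.κ : _ →ₗ[ℝ] S.X)
  have hl : ∀ x, d (K.κ x) = toSo (0, 0, 0, 0, l x) := fun x => K.exists_of_mem_gr_two (hd _)
  rw [K.exists_of_mem_gr_one hu] at h
  have h1 := eq_zero_of_smul_area (l := l) (t := K.c) (u := (param u).2.2.2.1) fun x y => by
    have h3 := h (K.κ x) (K.κ y)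
    rw [K.soProlongation_inclX, K.soProlongation_inclX, hl, hl, toSo_lie (lie_two_neg_one _ _),
      toSo_lie (lie_two_neg_one _ _), ← map_sub, ← map_smul, K.σ_eq] at h3
    exact congrArg (fun v : Par => v.2.2.2.1) (toSo_injective h3)
  intro v
  obtain ⟨x, rfl⟩ := K.κ.surjective v
  rw [hl, h1]
  exact map_zero toSo

theorem soProlongation_isComplete : K.soProlongation.IsComplete := by
  intro k d u hd hu h h'
  match k with
  | 0 => exact K.soProlongation_complete_zero d u hd hu h
  | 1 => exact K.soProlongation_complete_one d u hd hu h h'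
  | 2 =>
    have := K.soProlongation_complete_two d u hd hu h
    exact ⟨0, Submodule.zero_mem _, fun v => by rw [this, zero_lie]⟩
  | k + 3 =>
    refine ⟨0, Submodule.zero_mem _, fun v => ?_⟩
    rw [zero_lie]
    exact K.eq_zero_of_mem_gr (by push_cast; omega) (hd v)

theorem so_isUniversal (K : Coordinates S 1) : S.IsUniversalProlongation S.uF So := by
  obtain ⟨v, w, h⟩ := K.exists_σ_eq_one
  exact K.soProlongation.isUniversal_of_isComplete K.soProlongation_isComplete h

end Coordinates

end FlagSymbol

/-! ### From the tableau of $\delta_{s,2s}$ to matrix coordinates -/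

namespace FlagSymbol

open SlIrrep

/-- The tableau of `δ_{s,2s}` with the columns of the matrix `x` as its rows. -/
def boxFun (s : ℕ) (x : Matrix (Fin (2 * s + 1)) (Fin 2) ℝ) :
    YoungBox (fun _ : Fin 1 => 2 * s) → ℝ := fun b => x b.2.2 (if b.2.1 then 0 else 1)

theorem boxFun_mk (s : ℕ) (x : Matrix (Fin (2 * s + 1)) (Fin 2) ℝ) (j : Fin 1) (e : Bool)
    (a : Fin (2 * s + 1)) : boxFun s x ⟨j, e, a⟩ = x a (if e then 0 else 1) := rfl

/-- The tableau of `δ_{s,2s}` as a matrix whose columns are its rows. -/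
def boxEquiv (s : ℕ) : Matrix (Fin (2 * s + 1)) (Fin 2) ℝ ≃ₗ[ℝ] (indecSymbol s (2 * s)).X where
  toFun := boxFun s
  map_add' x y := rfl
  map_smul' c x := rfl
  invFun f := Matrix.of fun a i =>
    (f : YoungBox (fun _ : Fin 1 => 2 * s) → ℝ) ⟨0, decide (i = 0), a⟩
  left_inv x := by
    ext a i
    fin_cases i <;> rfl
  right_inv f := by
    funext ⟨j, e, a⟩
    obtain rfl : j = 0 := Subsingleton.elim _ _
    cases e <;> rfl

theorem boxEquiv_apply (s : ℕ) (x : Matrix (Fin (2 * s + 1)) (Fin 2) ℝ) (j : Fin 1) (e : Bool)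
    (a : Fin (2 * s + 1)) :
    (boxEquiv s x : YoungBox (fun _ : Fin 1 => 2 * s) → ℝ) ⟨j, e, a⟩ = x a (if e then 0 else 1) := rfl

theorem boxEquiv_single_zero (s : ℕ) (a : Fin (2 * s + 1)) :
    boxEquiv s (Matrix.single a 0 1) = eBox a := by
  funext ⟨j, e, b⟩
  obtain rfl : j = 0 := Subsingleton.elim _ _
  rw [boxEquiv_apply]
  rw [eBox, Pi.single_apply]
  cases e <;> simp [Matrix.single_apply, eq_comm]

theorem boxEquiv_single_one (s : ℕ) (a : Fin (2 * s + 1)) :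
    boxEquiv s (Matrix.single a 1 1) = fBox a := by
  funext ⟨j, e, b⟩
  obtain rfl : j = 0 := Subsingleton.elim _ _
  rw [boxEquiv_apply]
  rw [fBox, Pi.single_apply]
  cases e <;> simp [Matrix.single_apply, eq_comm]

theorem σ_boxEquiv (s : ℕ) (x y : Matrix (Fin (2 * s + 1)) (Fin 2) ℝ) :
    (indecSymbol s (2 * s)).σ (boxEquiv s x) (boxEquiv s y) = form x y := by
  refine (YoungBox.form_apply (boxFun s x) (boxFun s y)).trans ?_
  rw [form_apply, Fintype.sum_sigma, Fin.sum_univ_one, Fintype.sum_prod_type,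
    Fintype.sum_bool, ← Finset.sum_add_distrib]
  refine Finset.sum_congr rfl fun a _ => ?_
  simp only [YoungBox.sgn, YoungBox.opp, boxFun_mk, neg_one_pow_rev]
  simp
  ring

theorem δ_boxEquiv (s : ℕ) (x : Matrix (Fin (2 * s + 1)) (Fin 2) ℝ) :
    (indecSymbol s (2 * s)).δ (boxEquiv s x) = boxEquiv s (lower s * x) := by
  funext ⟨j, e, b⟩
  rw [boxEquiv_apply, lower_mul_apply]
  refine Fin.cases ?_ (fun a => ?_) b
  · refine (YoungBox.shift_zero (boxFun s x) j e).trans ?_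
    simp
  · refine (YoungBox.shift_succ (boxFun s x) j e a).trans ?_
    simp
    rfl

/-- For `l = 2 * s` both rows of the diagram begin in column $s$, so the degree $s-a$ depends only
on the matrix row. -/
theorem boxEquiv_mem (s : ℕ) (i : ℤ) (x : Matrix (Fin (2 * s + 1)) (Fin 2) ℝ) :
    boxEquiv s x ∈ (indecSymbol s (2 * s)).gr i ↔
      ∀ (a : Fin (2 * s + 1)) (j : Fin 2), (s : ℤ) - (a : ℕ) ≠ i → x a j = 0 := by
  constructor
  · intro h a j ha
    have h1 := h ⟨0, decide (j = 0), a⟩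
    have h2 := h1 (by
      fin_cases j <;> simp [YoungBox.weight] <;> omega)
    rw [boxEquiv_apply] at h2
    rw [← h2]
    fin_cases j <;> rfl
  · rintro h ⟨j, e, a⟩ hb
    refine h a _ fun h' => hb ?_
    rw [← h']
    cases e <;> simp [YoungBox.weight]
    ring

/-- The coordinates defined by an isomorphism with `δ_{s,2s}`. -/
noncomputable def Iso.coordinates {S : FlagSymbol} {s : ℕ} (e : Iso (indecSymbol s (2 * s)) S) :
    Coordinates S s where
  κ := (boxEquiv s).trans e.toEquiv
  c := e.map_σ.choose
  c_ne := e.map_σ.choose_spec.1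
  σ_eq x y := by
    rw [← σ_boxEquiv]
    exact e.map_σ.choose_spec.2 _ _
  -- Inverse because an isomorphism of symbols carries its factor on the side of the target symbol.
  c' := e.map_δ.choose⁻¹
  c'_ne := inv_ne_zero e.map_δ.choose_spec.1
  δ_eq x := by
    have h := e.map_δ.choose_spec.2 (boxEquiv s x)
    rw [δ_boxEquiv] at h
    change _ = _ • e.toEquiv (boxEquiv s (lower s * x))
    rw [h, inv_smul_smul₀ e.map_δ.choose_spec.1]
    rfl
  gr_iff i x := by
    rw [← boxEquiv_mem, ← e.map_gr]
    exact e.toEquiv.injective.mem_set_image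

theorem Iso.coordinates_κ {S : FlagSymbol} {s : ℕ} (e : Iso (indecSymbol s (2 * s)) S) (x) :
    e.coordinates.κ x = e.toEquiv (boxEquiv s x) := rfl

end FlagSymbol

/-! ### The tensor product model and the algebraic assertions -/

namespace SlIrrep

/-- The identification of `ℝ^{2s+1} ⊗ ℝ²` with matrices. -/
noncomputable def tensorEquiv (s : ℕ) : (Fin (2 * s + 1) → ℝ) ⊗[ℝ] (Fin 2 → ℝ) ≃ₗ[ℝ]
    Matrix (Fin (2 * s + 1)) (Fin 2) ℝ :=
  (TensorProduct.piScalarRight ℝ ℝ (Fin (2 * s + 1) → ℝ) (Fin 2)).trans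
    (Matrix.transposeLinearEquiv (Fin 2) (Fin (2 * s + 1)) ℝ ℝ)

theorem tensorEquiv_tmul (s : ℕ) (x : Fin (2 * s + 1) → ℝ) (v : Fin 2 → ℝ) :
    tensorEquiv s (x ⊗ₜ v) = Matrix.vecMulVec x v := by
  ext a i
  change (TensorProduct.piScalarRight ℝ ℝ (Fin (2 * s + 1) → ℝ) (Fin 2)) (x ⊗ₜ v) i a = _
  rw [TensorProduct.piScalarRight_apply, TensorProduct.piScalarRightHom_tmul, Matrix.vecMulVec_apply]
  simp [mul_comm]

end SlIrrep

/-- Once the symbol is known to be $\delta_{s,2s}$, the remaining assertions are algebraic; `n` only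
separates $s=1$ from $s\ge2$. Positivity of `s` is needed for faithfulness of the action. -/
theorem conclusion_of_iso (S : FlagSymbol) {n s : ℕ} (hs : 0 < s) (hn : n = 2 * s + 4)
    (e : FlagSymbol.Iso (indecSymbol s (2 * s)) S) :
      ∃ (e : FlagSymbol.Iso (indecSymbol s (2 * s)) S)
        (ρ : LieAlgebra.SpecialLinear.sl (Fin 2) ℝ →ₗ⁅ℝ⁆ Module.End ℝ (Fin (2 * s + 1) → ℝ))
        (Ξ : (Fin (2 * s + 1) → ℝ) ⊗[ℝ] (Fin 2 → ℝ) ≃ₗ[ℝ] S.X)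
        (Θ : (LieAlgebra.SpecialLinear.sl (Fin 2) ℝ × Matrix (Fin 2) (Fin 2) ℝ) ≃ₗ⁅ℝ⁆ S.uF),
        (∀ a, Ξ (Pi.single a 1 ⊗ₜ[ℝ] Pi.single 0 1) = e.toEquiv (eBox a)) ∧
        (∀ a, Ξ (Pi.single a 1 ⊗ₜ[ℝ] Pi.single 1 1) = e.toEquiv (fBox a)) ∧
        (∀ W : Submodule ℝ (Fin (2 * s + 1) → ℝ), (∀ a, ∀ w ∈ W, ρ a w ∈ W) → W = ⊥ ∨ W = ⊤) ∧
        (∀ a b x v, (Θ (a, b) : Module.End ℝ S.X) (Ξ (x ⊗ₜ[ℝ] v)) =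
          Ξ (ρ a x ⊗ₜ[ℝ] v + x ⊗ₜ[ℝ] b.mulVec v)) ∧
        (n = 6 → S.IsUniversalProlongation S.uF (LieAlgebra.Orthogonal.so' (Fin 4) (Fin 3) ℝ)) ∧
        (6 < n → S.firstProlongation S.uF = ⊥ ∧
          ∃ ψ : (LieAlgebra.SpecialLinear.sl (Fin 2) ℝ × Matrix (Fin 2) (Fin 2) ℝ) →ₗ⁅ℝ⁆
              LieDerivation ℝ S.Heis S.Heis,
            (∀ a x, ψ a (FlagSymbol.Heis.ofX S x) =
              FlagSymbol.Heis.ofX S ((Θ a : Module.End ℝ S.X) x)) ∧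
            S.IsUniversalProlongation S.uF
              (LieAlgebra.SemiDirectSum S.Heis
                (LieAlgebra.SpecialLinear.sl (Fin 2) ℝ × Matrix (Fin 2) (Fin 2) ℝ) ψ)) := by
  let K := e.coordinates
  have hΞ : ∀ x v, ((SlIrrep.tensorEquiv s).trans K.κ) (x ⊗ₜ v) = K.κ (Matrix.vecMulVec x v) :=
    fun x v => by rw [LinearEquiv.trans_apply, SlIrrep.tensorEquiv_tmul]
  have hsingle : ∀ (a : Fin (2 * s + 1)) (i : Fin 2),
      Matrix.vecMulVec (Pi.single a 1) (Pi.single i 1) = Matrix.single a i (1 : ℝ) := fun a i => by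
    rw [Matrix.single_eq_single_vecMulVec_single]
  refine ⟨e, SlIrrep.irrepEnd s, (SlIrrep.tensorEquiv s).trans K.κ, K.equivUF hs, fun a => ?_,
    fun a => ?_, SlIrrep.irrepEnd_irreducible, fun a b x v => ?_, fun h6 => ?_, fun h6 => ?_⟩
  · rw [hΞ, hsingle, e.coordinates_κ, FlagSymbol.boxEquiv_single_zero]
  · rw [hΞ, hsingle, e.coordinates_κ, FlagSymbol.boxEquiv_single_one]
  · rw [map_add, hΞ, hΞ, hΞ, K.equivUF_coe, K.act_κ, SlIrrep.act_apply, ← map_add,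
      SlIrrep.irrepEnd_apply, Matrix.mul_vecMulVec, Matrix.vecMulVec_mul, Matrix.vecMul_transpose]
  · obtain rfl : s = 1 := by omega
    exact K.so_isUniversal
  · have hs2 : 2 ≤ s := by omega
    refine ⟨FlagSymbol.Coordinates.firstProlongation_eq_bot hs2 K, K.derivationHom, fun a x => ?_,
      K.semi_isUniversal hs2⟩
    rw [K.derivationHom_ofX, K.equivUF_coe]

/-! ### First jets of frames and the tangent spaces of $D^\perp$ -/

namespace LocalDist

variable {n : ℕ} {U : Set (EuclideanSpace ℝ (Fin n))}
  {D : EuclideanSpace ℝ (Fin n) → Submodule ℝ (EuclideanSpace ℝ (Fin n))}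

/-- The first jet at `q` of a local frame of the distribution `D`, with the equations of the
tangent spaces of `D^⊥` over `q`. -/
structure FrameJet (U : Set (EuclideanSpace ℝ (Fin n)))
    (D : EuclideanSpace ℝ (Fin n) → Submodule ℝ (EuclideanSpace ℝ (Fin n)))
    (q : EuclideanSpace ℝ (Fin n)) where
  x : Fin 3 → EuclideanSpace ℝ (Fin n)
  A : Fin 3 → EuclideanSpace ℝ (Fin n) →L[ℝ] EuclideanSpace ℝ (Fin n)
  linearIndependent : LinearIndependent ℝ x
  span_eq : Submodule.span ℝ (Set.range x) = D q
  mem_tangentAnn : ∀ p, (∀ v ∈ D q, p v = 0) → ∀ u, u ∈ tangentAnn U D (q, p) ↔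
    ∀ a, p (A a u.1) + u.2 (x a) = 0

theorem fderiv_impulse {X : EuclideanSpace ℝ (Fin n) → EuclideanSpace ℝ (Fin n)}
    {q : EuclideanSpace ℝ (Fin n)} {A : EuclideanSpace ℝ (Fin n) →L[ℝ] EuclideanSpace ℝ (Fin n)}
    (h : HasFDerivAt X A q) (p : EuclideanSpace ℝ (Fin n) →L[ℝ] ℝ) (u : Cot n) :
    fderiv ℝ (impulse X) (q, p) u = p (A u.1) + u.2 (X q) := by
  have h1 : HasFDerivAt (fun μ : Cot n => X μ.1)
      (A.comp (ContinuousLinearMap.fst ℝ _ (EuclideanSpace ℝ (Fin n) →L[ℝ] ℝ))) (q, p) :=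
    HasFDerivAt.comp (q, p) (f := Prod.fst) (g := X) h hasFDerivAt_fst
  have h2 := (hasFDerivAt_snd (𝕜 := ℝ) (E := EuclideanSpace ℝ (Fin n))
    (F := EuclideanSpace ℝ (Fin n) →L[ℝ] ℝ) (p := (q, p))).clm_apply h1
  have h3 : HasFDerivAt (impulse X) _ (q, p) := h2
  rw [h3.fderiv]
  simp

/-- At a zero of `g` the product rule needs only continuity of the other factor. This suffices
because coefficients of sections in a frame are multiplied by functions that vanish on $D^\perp$. -/
theorem hasFDerivAt_mul_of_eq_zero {f g : EuclideanSpace ℝ (Fin n) → ℝ}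
    {q : EuclideanSpace ℝ (Fin n)} {g' : EuclideanSpace ℝ (Fin n) →L[ℝ] ℝ}
    (hf : ContinuousAt f q) (hg : HasFDerivAt g g' q) (h0 : g q = 0) :
    HasFDerivAt (fun y => f y * g y) (f q • g') q := by
  rw [hasFDerivAt_iff_isLittleO] at *
  have h1 : (fun y => f y * (g y - g q - g' (y - q))) =o[nhds q] fun y => y - q := by
    have := (hf.isBigO_one ℝ).mul_isLittleO hg.norm_right
    simpa using this
  have h2 : (fun y => (f y - f q) * g' (y - q)) =o[nhds q] fun y => y - q := by
    have h3 : (fun y => f y - f q) =o[nhds q] fun _ => (1 : ℝ) := by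
      rw [Asymptotics.isLittleO_one_iff]
      simpa using hf.tendsto.sub_const (f q)
    have := h3.mul_isBigO (g'.isBigO_sub (nhds q) q).norm_right
    simpa using this
  refine (h1.add h2).congr_left fun y => ?_
  simp [h0]
  ring

/-- A vector field with values in `D` has continuous coefficients with respect to a frame. -/
theorem exists_continuousAt_coeff {ι : Type*} [Fintype ι]
    {X : ι → EuclideanSpace ℝ (Fin n) → EuclideanSpace ℝ (Fin n)}
    {Y : EuclideanSpace ℝ (Fin n) → EuclideanSpace ℝ (Fin n)} {q : EuclideanSpace ℝ (Fin n)}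
    (hX : ∀ a, ContinuousAt (X a) q) (hY : ContinuousAt Y q)
    (hli : LinearIndependent ℝ fun a => X a q)
    (h : ∀ᶠ y in nhds q, Y y ∈ Submodule.span ℝ (Set.range fun a => X a y)) :
    ∃ f : ι → EuclideanSpace ℝ (Fin n) → ℝ, (∀ a, ContinuousAt (f a) q) ∧
      ∀ᶠ y in nhds q, Y y = ∑ a, f a y • X a y := by
  classical
  obtain ⟨L, hL⟩ : ∃ L : EuclideanSpace ℝ (Fin n) →ₗ[ℝ] (ι → ℝ),
      ∀ a, L (X a q) = Pi.single a 1 := by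
    obtain ⟨L, hL⟩ := LinearMap.exists_leftInverse_of_injective
      (Fintype.linearCombination ℝ fun a => X a q)
      (LinearMap.ker_eq_bot.2 hli.fintypeLinearCombination_injective)
    refine ⟨L, fun a => ?_⟩
    have := LinearMap.congr_fun hL (Pi.single a 1)
    simpa using this
  let L' : EuclideanSpace ℝ (Fin n) →L[ℝ] (ι → ℝ) := LinearMap.toContinuousLinearMap L
  -- `N y` is the frame at `y` read through a left inverse of the frame at `q`. It is the identity
  -- at `q`, hence invertible nearby, and its inverse gives continuous coefficients.
  let N : EuclideanSpace ℝ (Fin n) → ((ι → ℝ) →L[ℝ] (ι → ℝ)) := fun y =>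
    ∑ a, (ContinuousLinearMap.proj a : (ι → ℝ) →L[ℝ] ℝ).smulRight (L' (X a y))
  have hN : ∀ y c, N y c = ∑ a, c a • L' (X a y) := fun y c => by
    simp [N]
  have hNq : N q = 1 := by
    ext c b
    rw [hN]
    simp [L', hL, Pi.single_apply]
  have hNc : ContinuousAt N q := by
    refine tendsto_finsetSum _ fun a _ => ?_
    have h1 : Continuous fun v : ι → ℝ =>
        (ContinuousLinearMap.proj a : (ι → ℝ) →L[ℝ] ℝ).smulRight v :=
      (ContinuousLinearMap.smulRightL ℝ (ι → ℝ) (ι → ℝ) (ContinuousLinearMap.proj a)).continuous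
    exact (h1.comp L'.continuous).continuousAt.comp (hX a)
  have hinv : ContinuousAt (fun y => Ring.inverse (N y)) q := by
    have : ContinuousAt Ring.inverse (N q) := by
      rw [hNq]; exact NormedRing.inverse_continuousAt (1 : ((ι → ℝ) →L[ℝ] (ι → ℝ))ˣ)
    exact this.comp hNc
  have hunit : ∀ᶠ y in nhds q, IsUnit (N y) := by
    refine hNc.eventually (Units.isOpen.mem_nhds ?_)
    change IsUnit (N q)
    rw [hNq]; exact isUnit_one
  refine ⟨fun a y => Ring.inverse (N y) (L' (Y y)) a, fun a => ?_, ?_⟩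
  · exact (continuous_apply a).continuousAt.comp
      (hinv.clm_apply (L'.continuous.continuousAt.comp hY))
  · filter_upwards [h, hunit] with y hy hu
    obtain ⟨c, hc⟩ := (Submodule.mem_span_range_iff_exists_fun ℝ).1 hy
    have h1 : L' (Y y) = N y c := by rw [← hc, hN, map_sum]; simp
    have h2 : Ring.inverse (N y) (N y c) = c := by
      have := Ring.inverse_mul_cancel _ hu
      exact congrArg (fun T => T c) this
    simp only [h1, h2, hc]

/-- The tangent space of $D^\perp$ is cut out by all sections over `U`. Cut-off frame fields show
that the three frame equations are necessary; expansion of an arbitrary section in the frame shows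
that they suffice. -/
theorem exists_frameJet (hD : IsDistribution U D 3) {q : EuclideanSpace ℝ (Fin n)} (hq : q ∈ U) :
    Nonempty (FrameJet U D q) := by
  obtain ⟨V, hV, hqV, hVU, X, hX, hX'⟩ := hD q hq
  have hXd : ∀ a, HasFDerivAt (X a) (fderiv ℝ (X a) q) q := fun a =>
    (((hX a).contDiffAt (hV.mem_nhds hqV)).differentiableAt (by simp)).hasFDerivAt
  obtain ⟨r, hr, hrV⟩ := Metric.nhds_basis_closedBall.mem_iff.1 (hV.mem_nhds hqV)
  -- The frame lives only on `V`, while sections must be defined on all of `U`; the bump is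
  -- supported in a closed ball inside `V` and equals one near `q`.
  let f : ContDiffBump q := ⟨r / 2, r, by positivity, by linarith⟩
  have hsec : ∀ a, IsSection U D fun y => f y • X a y := by
    refine fun a => ⟨fun y hy => ContDiffAt.contDiffWithinAt ?_, fun y hy => ?_⟩
    · by_cases hyV : y ∈ V
      · exact f.contDiff.contDiffAt.smul ((hX a).contDiffAt (hV.mem_nhds hyV))
      · have h1 : y ∉ tsupport f := by
          rw [f.tsupport_eq]
          exact fun h => hyV (hrV h)
        refine (contDiffAt_const (c := 0)).congr_of_eventuallyEq ?_
        filter_upwards [notMem_tsupport_iff_eventuallyEq.1 h1] with z hz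
        rw [hz]; simp
    · by_cases hyV : y ∈ V
      · refine Submodule.smul_mem _ _ ?_
        rw [← (hX' y hyV).2]
        exact Submodule.subset_span ⟨a, rfl⟩
      · have h1 : f y = 0 := by
          by_contra h
          have : y ∈ Function.support f := h
          rw [f.support_eq] at this
          exact hyV (hrV (Metric.ball_subset_closedBall this))
        change f y • X a y ∈ D y
        rw [h1, zero_smul]; exact Submodule.zero_mem _
  refine ⟨⟨fun a => X a q, fun a => fderiv ℝ (X a) q, (hX' q hqV).1, (hX' q hqV).2,
    fun p hp u => ?_⟩⟩
  simp only [tangentAnn, Submodule.mem_iInf, LinearMap.mem_ker, ContinuousLinearMap.coe_coe]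
  constructor
  · intro h a
    have h1 := h _ (hsec a)
    have h2 : HasFDerivAt (fun y => f y • X a y) (fderiv ℝ (X a) q) q :=
      (hXd a).congr_of_eventuallyEq (by
        filter_upwards [f.eventuallyEq_one] with y hy
        rw [hy]; simp)
    rw [fderiv_impulse h2] at h1
    rwa [f.eventuallyEq_one.eq_of_nhds, Pi.one_apply, one_smul] at h1
  · intro h Y hY
    have hY1 : HasFDerivAt Y (fderiv ℝ Y q) q :=
      ((hY.1.contDiffAt (Filter.mem_of_superset (hV.mem_nhds hqV) hVU)).differentiableAt
        (by simp)).hasFDerivAt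
    obtain ⟨c, hc, hYc⟩ := exists_continuousAt_coeff (X := X) (fun a => (hXd a).continuousAt)
      hY1.continuousAt (hX' q hqV).1 (by
        filter_upwards [hV.mem_nhds hqV] with y hy
        rw [(hX' y hy).2]
        exact hY.2 y (hVU hy))
    -- Since `p` annihilates the distribution at `q`, derivatives of the coefficients do not
    -- contribute.
    have h1 : HasFDerivAt (fun y => p (Y y)) (∑ a, c a q • p.comp (fderiv ℝ (X a) q)) q := by
      have h2 : HasFDerivAt (fun y => ∑ a, c a y * p (X a y))
          (∑ a, c a q • p.comp (fderiv ℝ (X a) q)) q := by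
        refine HasFDerivAt.fun_sum fun a _ => hasFDerivAt_mul_of_eq_zero (hc a)
          (p.hasFDerivAt.comp q (hXd a)) (hp _ ?_)
        rw [← (hX' q hqV).2]
        exact Submodule.subset_span ⟨a, rfl⟩
      refine h2.congr_of_eventuallyEq ?_
      filter_upwards [hYc] with y hy
      rw [hy]; simp
    have h2 : p (fderiv ℝ Y q u.1) = ∑ a, c a q * p (fderiv ℝ (X a) q u.1) := by
      have h3 := (p.hasFDerivAt.comp q hY1).unique h1
      have h4 := congrArg (fun T => T u.1) h3
      simpa using h4
    rw [fderiv_impulse hY1, h2, hYc.self_of_nhds, map_sum, ← Finset.sum_add_distrib]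
    refine Finset.sum_eq_zero fun a _ => ?_
    rw [map_smul, smul_eq_mul, ← mul_add, h a, mul_zero]

end LocalDist

/-! ### Skew-orthogonality in $TD^\perp$ and the characteristic kernel -/

namespace LocalDist

theorem finrank_map_add_finrank_inf_ker {V W : Type*} [AddCommGroup V] [Module ℝ V]
    [FiniteDimensional ℝ V] [AddCommGroup W] [Module ℝ W] (N : Submodule ℝ V) (f : V →ₗ[ℝ] W) :
    Module.finrank ℝ (N.map f) + Module.finrank ℝ (N ⊓ LinearMap.ker f : Submodule ℝ V) =
      Module.finrank ℝ N := by
  rw [← LinearMap.finrank_range_add_finrank_ker (f.domRestrict N), LinearMap.range_domRestrict]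
  congr 1
  have h : LinearMap.ker (f.domRestrict N) =
      (N ⊓ LinearMap.ker f : Submodule ℝ V).submoduleOf N := by
    ext x; simp [Submodule.submoduleOf]
  rw [h]
  exact (Submodule.submoduleOfEquivOfLe inf_le_left).finrank_eq.symm

theorem sympl_apply {n : ℕ} (u u' : Cot n) : sympl n u u' = u.2 u'.1 - u'.2 u.1 := rfl

namespace FrameJet

variable {n : ℕ} {U : Set (EuclideanSpace ℝ (Fin n))}
  {D : EuclideanSpace ℝ (Fin n) → Submodule ℝ (EuclideanSpace ℝ (Fin n))}
  {q : EuclideanSpace ℝ (Fin n)} (J : FrameJet U D q)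

theorem exists_coframe : ∃ θ : Fin 3 → (EuclideanSpace ℝ (Fin n) →L[ℝ] ℝ),
    ∀ a b, θ a (J.x b) = if a = b then 1 else 0 := by
  obtain ⟨L, hL⟩ := LinearMap.exists_leftInverse_of_injective
    (Fintype.linearCombination ℝ J.x)
    (LinearMap.ker_eq_bot.2 J.linearIndependent.fintypeLinearCombination_injective)
  refine ⟨fun a => LinearMap.toContinuousLinearMap (LinearMap.proj a ∘ₗ L), fun a b => ?_⟩
  have := congrFun (LinearMap.congr_fun hL (Pi.single b 1)) a
  simpa [Pi.single_apply] using this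

theorem x_mem (a : Fin 3) : J.x a ∈ D q := by
  rw [← J.span_eq]; exact Submodule.subset_span ⟨a, rfl⟩

theorem forall_mem_iff {w : EuclideanSpace ℝ (Fin n) →L[ℝ] ℝ} :
    (∀ v ∈ D q, w v = 0) ↔ ∀ a, w (J.x a) = 0 := by
  refine ⟨fun h a => h _ (J.x_mem a), fun h v hv => ?_⟩
  rw [← J.span_eq] at hv
  have : Submodule.span ℝ (Set.range J.x) ≤ LinearMap.ker (w : EuclideanSpace ℝ (Fin n) →ₗ[ℝ] ℝ) := by
    rw [Submodule.span_le]
    rintro _ ⟨a, rfl⟩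
    exact h a
  exact this hv

theorem exists_coeff {v : EuclideanSpace ℝ (Fin n)}
    (h : ∀ w : EuclideanSpace ℝ (Fin n) →L[ℝ] ℝ, (∀ a, w (J.x a) = 0) → w v = 0) :
    ∃ c : Fin 3 → ℝ, v = ∑ a, c a • J.x a := by
  obtain ⟨θ, hθ⟩ := J.exists_coframe
  refine ⟨fun a => θ a v, sub_eq_zero.1 (SeparatingDual.eq_zero_of_forall_dual_eq_zero (R := ℝ)
    fun f => ?_)⟩
  -- The correction by the dual coframe makes an arbitrary functional vanish on the frame.
  have := h (f - ∑ a, f (J.x a) • θ a) fun b => by simp [hθ]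
  simp only [sub_apply, sum_apply, smul_apply,
    smul_eq_mul] at this
  rw [map_sub, map_sum]
  simp only [map_smul, smul_eq_mul]
  rw [← this]
  simp only [mul_comm]

theorem exists_mem_tangentAnn (J : FrameJet U D q) {p : EuclideanSpace ℝ (Fin n) →L[ℝ] ℝ} (hp : ∀ v ∈ D q, p v = 0)
    (v : EuclideanSpace ℝ (Fin n)) : ∃ w, (v, w) ∈ tangentAnn U D (q, p) := by
  obtain ⟨θ, hθ⟩ := J.exists_coframe
  refine ⟨-∑ a, p (J.A a v) • θ a, (J.mem_tangentAnn p hp _).2 fun b => ?_⟩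
  simp [hθ]

theorem zero_mem_tangentAnn (J : FrameJet U D q) {p : EuclideanSpace ℝ (Fin n) →L[ℝ] ℝ} (hp : ∀ v ∈ D q, p v = 0)
    {w : EuclideanSpace ℝ (Fin n) →L[ℝ] ℝ} :
    ((0, w) : Cot n) ∈ tangentAnn U D (q, p) ↔ ∀ v ∈ D q, w v = 0 := by
  rw [J.mem_tangentAnn p hp, J.forall_mem_iff]
  simp

/-- The Hamiltonian vectors of the sections of `D`. -/
noncomputable def hamil (p : EuclideanSpace ℝ (Fin n) →L[ℝ] ℝ) : (Fin 3 → ℝ) →ₗ[ℝ] Cot n where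
  toFun c := (∑ a, c a • J.x a, -∑ a, c a • p.comp (J.A a))
  map_add' c c' := by simp [add_smul, Finset.sum_add_distrib, add_comm]
  map_smul' r c := by simp [mul_smul, Finset.smul_sum]

theorem hamil_fst (p : EuclideanSpace ℝ (Fin n) →L[ℝ] ℝ) (c : Fin 3 → ℝ) :
    (J.hamil p c).1 = ∑ a, c a • J.x a := rfl

theorem hamil_fst_mem (p : EuclideanSpace ℝ (Fin n) →L[ℝ] ℝ) (c : Fin 3 → ℝ) :
    (J.hamil p c).1 ∈ D q := by
  rw [hamil_fst]
  exact (D q).sum_mem fun a _ => (D q).smul_mem (c a) (J.x_mem a)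

theorem hamil_snd_apply (p : EuclideanSpace ℝ (Fin n) →L[ℝ] ℝ) (c : Fin 3 → ℝ) (v) :
    (J.hamil p c).2 v = -∑ a, c a * p (J.A a v) := by
  simp [hamil, sum_apply]

theorem hamil_eq_zero {p : EuclideanSpace ℝ (Fin n) →L[ℝ] ℝ} {c : Fin 3 → ℝ}
    (h : (J.hamil p c).1 = 0) : c = 0 :=
  funext (Fintype.linearIndependent_iff.1 J.linearIndependent c h)

/-- These are Hamiltonian vectors of the equations of $D^\perp$, so they are skew-orthogonal to its
tangent space. -/
theorem sympl_hamil {p : EuclideanSpace ℝ (Fin n) →L[ℝ] ℝ} (hp : ∀ v ∈ D q, p v = 0)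
    (c : Fin 3 → ℝ) {u : Cot n} (hu : u ∈ tangentAnn U D (q, p)) : sympl n (J.hamil p c) u = 0 := by
  rw [J.mem_tangentAnn p hp] at hu
  rw [sympl_apply, hamil_snd_apply, hamil_fst, map_sum, ← neg_add', ← Finset.sum_add_distrib,
    neg_eq_zero]
  refine Finset.sum_eq_zero fun a _ => ?_
  rw [map_smul, smul_eq_mul, ← mul_add, hu a, mul_zero]

/-- The structure of the brackets of the frame modulo the kernel of `p`. -/
noncomputable def curv (p : EuclideanSpace ℝ (Fin n) →L[ℝ] ℝ) (a b : Fin 3) : ℝ :=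
  p (J.A a (J.x b)) - p (J.A b (J.x a))

/-- Tangency of a Hamiltonian vector to $D^\perp$ is the vanishing of its Poisson brackets with the
equations, that is, its coefficients lie in the kernel of the skew matrix `curv p`. -/
theorem hamil_mem_iff {p : EuclideanSpace ℝ (Fin n) →L[ℝ] ℝ} (hp : ∀ v ∈ D q, p v = 0)
    (c : Fin 3 → ℝ) : J.hamil p c ∈ tangentAnn U D (q, p) ↔ ∀ b, ∑ a, c a * J.curv p b a = 0 := by
  rw [J.mem_tangentAnn p hp]
  refine forall_congr' fun b => ?_
  rw [hamil_fst, hamil_snd_apply]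
  simp only [map_sum, map_smul, smul_eq_mul, curv, mul_sub, Finset.sum_sub_distrib]
  rw [← sub_eq_add_neg]

/-- Testing against vertical covectors that annihilate $D$ forces the base component into $D$; after
removal of the Hamiltonian vector, testing against lifts of vectors of $D$ forces the remaining
covector to annihilate $D$. -/
theorem exists_of_sympl_lift (J : FrameJet U D q) {p : EuclideanSpace ℝ (Fin n) →L[ℝ] ℝ} (hp : ∀ v ∈ D q, p v = 0)
    {u : Cot n} (hu : u ∈ tangentAnn U D (q, p)) (h : ∀ u' ∈ lift U D (q, p), sympl n u u' = 0) :
    ∃ c w, J.hamil p c ∈ tangentAnn U D (q, p) ∧ (∀ v ∈ D q, w v = 0) ∧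
      u = J.hamil p c + (0, w) := by
  obtain ⟨c, hc⟩ := J.exists_coeff (v := u.1) fun w hw => by
    have h1 := h (0, w) ⟨(J.zero_mem_tangentAnn hp).2 (J.forall_mem_iff.2 hw),
      Submodule.zero_mem (D q)⟩
    rw [sympl_apply] at h1
    simpa using h1
  have hu' : u = J.hamil p c + (0, u.2 - (J.hamil p c).2) := by
    refine Prod.ext ?_ ?_
    · rw [Prod.fst_add, hamil_fst, ← hc, add_zero]
    · exact (add_sub_cancel _ _).symm
  have hw : ∀ v ∈ D q, (u.2 - (J.hamil p c).2) v = 0 := fun v hv => by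
    obtain ⟨w', hw'⟩ := J.exists_mem_tangentAnn hp v
    have h1 := h (v, w') ⟨hw', hv⟩
    rw [hu', map_add, LinearMap.add_apply, J.sympl_hamil hp c hw', zero_add, sympl_apply] at h1
    simpa using h1
  refine ⟨c, _, ?_, hw, hu'⟩
  have h2 : J.hamil p c = u - (0, u.2 - (J.hamil p c).2) := by
    rw [eq_sub_iff_add_eq, ← hu']
  rw [h2]
  exact Submodule.sub_mem _ hu ((J.zero_mem_tangentAnn hp).2 hw)

theorem mem_charKer_iff {p : EuclideanSpace ℝ (Fin n) →L[ℝ] ℝ} (hp : ∀ v ∈ D q, p v = 0)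
    {u : Cot n} : u ∈ charKer U D (q, p) ↔
      ∃ c, J.hamil p c ∈ tangentAnn U D (q, p) ∧ u = J.hamil p c := by
  constructor
  · rintro ⟨hu, h⟩
    obtain ⟨c, w, hc, hw, rfl⟩ := J.exists_of_sympl_lift hp hu fun u' hu' => h u' hu'.1
    refine ⟨c, hc, ?_⟩
    suffices h0 : w = 0 by rw [h0]; exact add_zero _
    ext v
    obtain ⟨w', hw'⟩ := J.exists_mem_tangentAnn hp v
    have h1 := h _ hw'
    rw [map_add, LinearMap.add_apply, J.sympl_hamil hp c hw', zero_add, sympl_apply] at h1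
    simpa using h1
  · rintro ⟨c, hc, rfl⟩
    exact ⟨hc, fun u' hu' => J.sympl_hamil hp c hu'⟩

/-- The kernel of a skew $3\times3$ matrix is everything if the matrix is zero and a line otherwise.
Regularity of a covector thereby becomes the nonvanishing of a function linear in `p`, as needed for
genericity. -/
theorem finrank_charKer_eq_one_iff {p : EuclideanSpace ℝ (Fin n) →L[ℝ] ℝ}
    (hp : ∀ v ∈ D q, p v = 0) :
    Module.finrank ℝ (charKer U D (q, p)) = 1 ↔ ∃ a b, J.curv p a b ≠ 0 := by
  have hinj : Function.Injective (J.hamil p) := by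
    refine (injective_iff_map_eq_zero _).2 fun c hc => J.hamil_eq_zero (p := p) ?_
    rw [hc]; rfl
  constructor
  · intro h
    by_contra! h0
    have e : charKer U D (q, p) = LinearMap.range (J.hamil p) := by
      ext u
      rw [J.mem_charKer_iff hp]
      constructor
      · rintro ⟨c, -, rfl⟩; exact ⟨c, rfl⟩
      · rintro ⟨c, rfl⟩
        exact ⟨c, (J.hamil_mem_iff hp c).2 fun b => by simp [h0], rfl⟩
    rw [e, LinearMap.finrank_range_of_inj hinj] at h
    simp at h
  · rintro ⟨a₀, b₀, h0⟩
    have hskew : ∀ a b, J.curv p a b = -J.curv p b a := fun a b => by simp [curv]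
    have hdiag : ∀ a, J.curv p a a = 0 := fun a => sub_self _
    -- The axial vector of the skew matrix: applying the matrix to `c` amounts to the cross product
    -- of `c` and `z`, up to sign.
    let z : Fin 3 → ℝ := ![J.curv p 1 2, J.curv p 2 0, J.curv p 0 1]
    have hz : z ≠ 0 := by
      intro hz
      have e0 : J.curv p 1 2 = 0 := congrFun hz 0
      have e1 : J.curv p 2 0 = 0 := congrFun hz 1
      have e2 : J.curv p 0 1 = 0 := congrFun hz 2
      apply h0
      have e0' := hskew 2 1
      have e1' := hskew 0 2
      have e2' := hskew 1 0
      rw [e0, neg_zero] at e0'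
      rw [e1, neg_zero] at e1'
      rw [e2, neg_zero] at e2'
      fin_cases a₀ <;> fin_cases b₀ <;> first | exact hdiag _ | assumption
    have key : ∀ c : Fin 3 → ℝ, J.hamil p c ∈ tangentAnn U D (q, p) ↔ ∃ r : ℝ, c = r • z := by
      intro c
      rw [J.hamil_mem_iff hp]
      simp only [Fin.sum_univ_three]
      constructor
      · intro h
        have h1 := h 0
        have h2 := h 1
        have h3 := h 2
        rw [hdiag, hskew 0 2] at h1
        rw [hdiag, hskew 1 0] at h2
        rw [hdiag, hskew 2 1] at h3
        have hn : 0 < z 0 ^ 2 + z 1 ^ 2 + z 2 ^ 2 := by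
          by_contra hn
          apply hz
          have := sq_nonneg (z 0); have := sq_nonneg (z 1); have := sq_nonneg (z 2)
          funext i
          fin_cases i
          · exact pow_eq_zero_iff two_ne_zero |>.1 (show z 0 ^ 2 = 0 by linarith)
          · exact pow_eq_zero_iff two_ne_zero |>.1 (show z 1 ^ 2 = 0 by linarith)
          · exact pow_eq_zero_iff two_ne_zero |>.1 (show z 2 ^ 2 = 0 by linarith)
        -- Coefficient of the orthogonal projection of `c` to `z`, the cross product of the two
        -- being zero.
        refine ⟨(c 0 * z 0 + c 1 * z 1 + c 2 * z 2) / (z 0 ^ 2 + z 1 ^ 2 + z 2 ^ 2), ?_⟩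
        have g1 : c 1 * z 2 = c 2 * z 1 := by simp only [z]; simp; linarith
        have g2 : c 2 * z 0 = c 0 * z 2 := by simp only [z]; simp; linarith
        have g3 : c 0 * z 1 = c 1 * z 0 := by simp only [z]; simp; linarith
        funext i
        rw [Pi.smul_apply, smul_eq_mul, div_mul_eq_mul_div, eq_div_iff hn.ne']
        fin_cases i
        · change c 0 * _ = _ * z 0
          linear_combination z 1 * g3 - z 2 * g2
        · change c 1 * _ = _ * z 1
          linear_combination z 2 * g1 - z 0 * g3
        · change c 2 * _ = _ * z 2
          linear_combination z 0 * g2 - z 1 * g1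
      · rintro ⟨r, rfl⟩ b
        simp only [Pi.smul_apply, smul_eq_mul, z]
        fin_cases b <;> simp [hdiag]
        · rw [hskew 0 2]; ring
        · rw [hskew 1 0]; ring
        · rw [hskew 2 1]; ring
    have e : charKer U D (q, p) = Submodule.span ℝ {J.hamil p z} := by
      ext u
      rw [J.mem_charKer_iff hp, Submodule.mem_span_singleton]
      constructor
      · rintro ⟨c, hc, rfl⟩
        obtain ⟨r, rfl⟩ := (key c).1 hc
        exact ⟨r, (map_smul _ _ _).symm⟩
      · rintro ⟨r, rfl⟩
        exact ⟨r • z, (key _).2 ⟨r, rfl⟩, (map_smul _ _ _).symm⟩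
    rw [e]
    refine finrank_span_singleton fun h => hz ?_
    rw [← map_zero (J.hamil p)] at h
    exact hinj h

theorem ne_zero_of_finrank (J : FrameJet U D q) {p : EuclideanSpace ℝ (Fin n) →L[ℝ] ℝ}
    (hp : ∀ v ∈ D q, p v = 0) (h : Module.finrank ℝ (charKer U D (q, p)) = 1) : p ≠ 0 := by
  rintro rfl
  obtain ⟨a, b, hab⟩ := (J.finrank_charKer_eq_one_iff hp).1 h
  simp [curv] at hab

/-- Testing only on the kernel of the Liouville form leaves a vertical covector that vanishes on
$\ker p$, hence a multiple of $p$. So on the contact hyperplane only the directions killed by the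
quotient map are degenerate. -/
theorem mem_of_sympl_liouvilleKer (J : FrameJet U D q) {p : EuclideanSpace ℝ (Fin n) →L[ℝ] ℝ} (hp : ∀ v ∈ D q, p v = 0)
    (hp0 : p ≠ 0) {u : Cot n} (hu : u ∈ tangentAnn U D (q, p))
    (h : ∀ u' ∈ liouvilleKer U D (q, p), sympl n u u' = 0) :
    u ∈ charKer U D (q, p) ⊔ Submodule.span ℝ {((0, p) : Cot n)} := by
  obtain ⟨c, w, hc, hw, rfl⟩ := J.exists_of_sympl_lift hp hu fun u' hu' =>
    h u' ⟨hu'.1, hp _ hu'.2⟩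
  refine Submodule.add_mem_sup ((J.mem_charKer_iff hp).2 ⟨c, hc, rfl⟩)
    (Submodule.mem_span_singleton.2 ?_)
  obtain ⟨v₀, hv₀⟩ : ∃ v, p v ≠ 0 := by
    by_contra! h0
    exact hp0 (ContinuousLinearMap.ext h0)
  have hker : ∀ v, p v = 0 → w v = 0 := fun v hv => by
    obtain ⟨w', hw'⟩ := J.exists_mem_tangentAnn hp v
    have h1 := h _ ⟨hw', hv⟩
    rw [map_add, LinearMap.add_apply, J.sympl_hamil hp c hw', zero_add, sympl_apply] at h1
    simpa using h1
  refine ⟨w v₀ / p v₀, Prod.ext (smul_zero _) ?_⟩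
  ext v
  have h1 := hker (v - (p v / p v₀) • v₀) (by simp [hv₀])
  rw [map_sub, map_smul, smul_eq_mul, sub_eq_zero] at h1
  rw [h1]
  change w v₀ / p v₀ * p v = _
  ring

end FrameJet

end LocalDist

/-! ### Dimensions of the lift of $D$ and of its skew complement -/

namespace LocalDist

namespace FrameJet

variable {n : ℕ} {U : Set (EuclideanSpace ℝ (Fin n))}
  {D : EuclideanSpace ℝ (Fin n) → Submodule ℝ (EuclideanSpace ℝ (Fin n))}
  {q : EuclideanSpace ℝ (Fin n)} (J : FrameJet U D q)

/-- The annihilator of `D q`. -/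
noncomputable def annihilator : Submodule ℝ (EuclideanSpace ℝ (Fin n) →L[ℝ] ℝ) :=
  LinearMap.ker (LinearMap.pi fun a => ContinuousLinearMap.coeLM ℝ |>.flip (J.x a))

theorem mem_annihilator {w} : w ∈ J.annihilator ↔ ∀ v ∈ D q, w v = 0 := by
  rw [J.forall_mem_iff, annihilator, LinearMap.mem_ker, funext_iff]
  rfl

theorem finrank_annihilator : Module.finrank ℝ J.annihilator + 3 = n := by
  have h := LinearMap.finrank_range_add_finrank_ker (LinearMap.pi fun a =>
    (ContinuousLinearMap.coeLM ℝ : (EuclideanSpace ℝ (Fin n) →L[ℝ] ℝ) →ₗ[ℝ] _).flip (J.x a))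
  have h1 : Module.finrank ℝ (EuclideanSpace ℝ (Fin n) →L[ℝ] ℝ) = n := by
    rw [← (LinearMap.toContinuousLinearMap (𝕜 := ℝ) (E := EuclideanSpace ℝ (Fin n))
      (F' := ℝ)).finrank_eq]
    exact Subspace.dual_finrank_eq.trans finrank_euclideanSpace_fin
  rw [h1, LinearMap.range_eq_top.2, finrank_top, Module.finrank_fin_fun] at h
  · rw [annihilator]; omega
  · intro c
    obtain ⟨θ, hθ⟩ := J.exists_coframe
    refine ⟨∑ a, c a • θ a, ?_⟩
    funext b
    change (∑ a, c a • θ a) (J.x b) = c b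
    simp [sum_apply, hθ]

/-- If the vertical part of a subspace is the whole fibre direction of $D^\perp$, of dimension
$n-3$, only the dimension of the projection to the base remains to be found. -/
theorem finrank_eq_of_annihilator {N : Submodule ℝ (Cot n)}
    (hN : ∀ w, ((0, w) : Cot n) ∈ N ↔ ∀ v ∈ D q, w v = 0) :
    Module.finrank ℝ N = Module.finrank ℝ (N.map (LinearMap.fst ℝ (EuclideanSpace ℝ (Fin n))
      (EuclideanSpace ℝ (Fin n) →L[ℝ] ℝ))) + Module.finrank ℝ J.annihilator := by
  rw [← finrank_map_add_finrank_inf_ker N (LinearMap.fst ℝ (EuclideanSpace ℝ (Fin n))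
      (EuclideanSpace ℝ (Fin n) →L[ℝ] ℝ))]
  congr 1
  have h : (N ⊓ LinearMap.ker (LinearMap.fst ℝ (EuclideanSpace ℝ (Fin n))
      (EuclideanSpace ℝ (Fin n) →L[ℝ] ℝ)) : Submodule ℝ (Cot n)) =
      J.annihilator.map (LinearMap.inr ℝ (EuclideanSpace ℝ (Fin n))
      (EuclideanSpace ℝ (Fin n) →L[ℝ] ℝ)) := by
    ext ⟨v, w⟩
    constructor
    · rintro ⟨h1, h2⟩
      obtain rfl : v = 0 := h2
      exact ⟨w, J.mem_annihilator.2 ((hN w).1 h1), rfl⟩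
    · rintro ⟨w', hw', h2⟩
      obtain ⟨rfl, rfl⟩ := Prod.mk.inj h2
      exact ⟨(hN _).2 (J.mem_annihilator.1 hw'), rfl⟩
  rw [h]
  exact (Submodule.equivMapOfInjective _ LinearMap.inr_injective _).finrank_eq.symm

theorem finrank_lift (J : FrameJet U D q) {p : EuclideanSpace ℝ (Fin n) →L[ℝ] ℝ} (hp : ∀ v ∈ D q, p v = 0) :
    Module.finrank ℝ (lift U D (q, p)) = n := by
  rw [J.finrank_eq_of_annihilator fun w => ?_]
  · have h : (lift U D (q, p)).map (LinearMap.fst ℝ (EuclideanSpace ℝ (Fin n))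
        (EuclideanSpace ℝ (Fin n) →L[ℝ] ℝ)) = D q := by
      ext v
      constructor
      · rintro ⟨u, hu, rfl⟩; exact hu.2
      · intro hv
        obtain ⟨w, hw⟩ := J.exists_mem_tangentAnn hp v
        exact ⟨(v, w), ⟨hw, hv⟩, rfl⟩
    rw [h, ← J.span_eq, finrank_span_eq_card J.linearIndependent, Fintype.card_fin, add_comm,
      J.finrank_annihilator]
  · rw [← J.zero_mem_tangentAnn hp]
    exact ⟨fun h => h.1, fun h => ⟨h, (D q).zero_mem⟩⟩

end FrameJet

section

variable {n : ℕ} (U : Set (EuclideanSpace ℝ (Fin n)))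
  (D : EuclideanSpace ℝ (Fin n) → Submodule ℝ (EuclideanSpace ℝ (Fin n)))

/-- The tangent vectors of `D^⊥` which are skew-orthogonal to the lift of `D`. -/
noncomputable def liftCompl (μ : Cot n) : Submodule ℝ (Cot n) :=
  tangentAnn U D μ ⊓ ⨅ u' ∈ lift U D μ, LinearMap.ker ((sympl n).flip u')

variable {U D}

theorem mem_liftCompl {μ u : Cot n} : u ∈ liftCompl U D μ ↔
    u ∈ tangentAnn U D μ ∧ ∀ u' ∈ lift U D μ, sympl n u u' = 0 := by
  simp [liftCompl]

end

namespace FrameJet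

variable {n : ℕ} {U : Set (EuclideanSpace ℝ (Fin n))}
  {D : EuclideanSpace ℝ (Fin n) → Submodule ℝ (EuclideanSpace ℝ (Fin n))}
  {q : EuclideanSpace ℝ (Fin n)} (J : FrameJet U D q)
  {p : EuclideanSpace ℝ (Fin n) →L[ℝ] ℝ}

theorem liftCompl_le_lift (J : FrameJet U D q) (hp : ∀ v ∈ D q, p v = 0) :
    liftCompl U D (q, p) ≤ lift U D (q, p) := by
  intro u hu
  rw [mem_liftCompl] at hu
  obtain ⟨c, w, -, -, rfl⟩ := J.exists_of_sympl_lift hp hu.1 hu.2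
  refine ⟨hu.1, ?_⟩
  change (J.hamil p c).1 + 0 ∈ D q
  rw [add_zero]
  exact J.hamil_fst_mem p c

theorem lift_le_liouvilleKer (hp : ∀ v ∈ D q, p v = 0) :
    lift U D (q, p) ≤ liouvilleKer U D (q, p) := fun u hu => ⟨hu.1, hp u.1 hu.2⟩

theorem charKer_le_liftCompl : charKer U D (q, p) ≤ liftCompl U D (q, p) := fun _ hu =>
  mem_liftCompl.2 ⟨hu.1, fun u' hu' => hu.2 u' hu'.1⟩

theorem euler_mem_liftCompl (J : FrameJet U D q) (hp : ∀ v ∈ D q, p v = 0) :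
    ((0, p) : Cot n) ∈ liftCompl U D (q, p) := by
  refine mem_liftCompl.2 ⟨(J.zero_mem_tangentAnn hp).2 hp, fun u' hu' => ?_⟩
  rw [sympl_apply]
  simp [hp u'.1 hu'.2]

theorem finrank_map_fst_charKer (J : FrameJet U D q) (hp : ∀ v ∈ D q, p v = 0) :
    Module.finrank ℝ ((charKer U D (q, p)).map (LinearMap.fst ℝ (EuclideanSpace ℝ (Fin n))
      (EuclideanSpace ℝ (Fin n) →L[ℝ] ℝ))) = Module.finrank ℝ (charKer U D (q, p)) := by
  rw [← finrank_map_add_finrank_inf_ker (charKer U D (q, p))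
    (LinearMap.fst ℝ (EuclideanSpace ℝ (Fin n)) (EuclideanSpace ℝ (Fin n) →L[ℝ] ℝ))]
  have h : (charKer U D (q, p) ⊓ LinearMap.ker (LinearMap.fst ℝ (EuclideanSpace ℝ (Fin n))
      (EuclideanSpace ℝ (Fin n) →L[ℝ] ℝ)) : Submodule ℝ (Cot n)) = ⊥ := by
    rw [eq_bot_iff]
    rintro u ⟨hu, h0⟩
    obtain ⟨c, -, rfl⟩ := (J.mem_charKer_iff hp).1 hu
    rw [J.hamil_eq_zero (p := p) h0, map_zero]
    exact Submodule.zero_mem _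
  rw [h, finrank_bot, add_zero]

/-- The projection to the base is that of the characteristic line, so the dimension is $1+(n-3)$. -/
theorem finrank_liftCompl (J : FrameJet U D q) (hp : ∀ v ∈ D q, p v = 0)
    (h1 : Module.finrank ℝ (charKer U D (q, p)) = 1) :
    Module.finrank ℝ (liftCompl U D (q, p)) + 2 = n := by
  rw [J.finrank_eq_of_annihilator fun w => ?_]
  · have h : (liftCompl U D (q, p)).map (LinearMap.fst ℝ (EuclideanSpace ℝ (Fin n))
        (EuclideanSpace ℝ (Fin n) →L[ℝ] ℝ)) = (charKer U D (q, p)).map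
          (LinearMap.fst ℝ (EuclideanSpace ℝ (Fin n)) (EuclideanSpace ℝ (Fin n) →L[ℝ] ℝ)) := by
      apply le_antisymm
      · rintro _ ⟨u, hu, rfl⟩
        rw [SetLike.mem_coe, mem_liftCompl] at hu
        obtain ⟨c, w, hc, -, rfl⟩ := J.exists_of_sympl_lift hp hu.1 hu.2
        exact ⟨J.hamil p c, (J.mem_charKer_iff hp).2 ⟨c, hc, rfl⟩, (add_zero _).symm⟩
      · exact Submodule.map_mono charKer_le_liftCompl
    rw [h, J.finrank_map_fst_charKer hp, h1]
    have := J.finrank_annihilator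
    omega
  · rw [mem_liftCompl, J.zero_mem_tangentAnn hp]
    refine ⟨fun h => h.1, fun h => ⟨h, fun u' hu' => ?_⟩⟩
    rw [sympl_apply]
    simp [h u'.1 hu'.2]

/-- The Euler vector is vertical while the characteristic line projects injectively to the base, so
the two are independent. -/
theorem finrank_charKer_sup (J : FrameJet U D q) (hp : ∀ v ∈ D q, p v = 0)
    (h1 : Module.finrank ℝ (charKer U D (q, p)) = 1) :
    Module.finrank ℝ (charKer U D (q, p) ⊔ Submodule.span ℝ {((0, p) : Cot n)} :
      Submodule ℝ (Cot n)) = 2 := by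
  have hp0 := J.ne_zero_of_finrank hp h1
  have h := Submodule.finrank_sup_add_finrank_inf_eq (charKer U D (q, p))
    (Submodule.span ℝ {((0, p) : Cot n)})
  have hb : charKer U D (q, p) ⊓ Submodule.span ℝ {((0, p) : Cot n)} = ⊥ := by
    rw [eq_bot_iff]
    rintro u ⟨hu, hu'⟩
    obtain ⟨c, -, rfl⟩ := (J.mem_charKer_iff hp).1 hu
    obtain ⟨r, hr⟩ := Submodule.mem_span_singleton.1 hu'
    have : (J.hamil p c).1 = 0 := by rw [← hr]; exact smul_zero r
    rw [J.hamil_eq_zero this, map_zero]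
    exact Submodule.zero_mem _
  rw [hb, finrank_bot, h1, finrank_span_singleton fun h0 => hp0 (congrArg Prod.snd h0)] at h
  exact h

end FrameJet

/-! ### Dimensions in the flag of the extended Jacobi curve -/

namespace ExtremalChart

variable {n : ℕ} {U : Set (EuclideanSpace ℝ (Fin n))}
  {D : EuclideanSpace ℝ (Fin n) → Submodule ℝ (EuclideanSpace ℝ (Fin n))}

section

variable {μ₀ : Cot n} (C : ExtremalChart U D μ₀)

theorem zero_mem_Ioo : (0 : ℝ) ∈ Set.Ioo (-C.ε) C.ε := ⟨neg_lt_zero.2 C.ε_pos, C.ε_pos⟩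

theorem mem_O_inter : μ₀ ∈ C.O ∩ regularSet U D := by
  have := C.γ_mem 0 C.zero_mem_Ioo
  rwa [C.γ_zero] at this

theorem jacobi_zero : C.jacobi 0 =
    (lift U D μ₀).map (fderiv ℝ C.Ψ μ₀ : Cot n →ₗ[ℝ] EuclideanSpace ℝ (Fin C.m)) := by
  rw [jacobi, C.γ_zero]

theorem osculating_zero : osculating (Set.Ioo (-C.ε) C.ε) C.jacobi 0 0 = C.jacobi 0 := by
  refine le_antisymm (sup_le le_rfl (Submodule.span_le.2 ?_)) le_sup_left
  rintro _ ⟨v, hv, i, hi, rfl⟩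
  obtain rfl : i = 0 := Nat.le_zero.1 hi
  rw [iteratedDeriv_zero]
  exact hv.2 0 C.zero_mem_Ioo

theorem osculating_mono {i j : ℕ} (h : i ≤ j) (t : ℝ) :
    osculating (Set.Ioo (-C.ε) C.ε) C.jacobi i t ≤ osculating (Set.Ioo (-C.ε) C.ε) C.jacobi j t := by
  refine sup_le_sup_left (Submodule.span_mono ?_) _
  rintro _ ⟨v, hv, k, hk, rfl⟩
  exact ⟨v, hv, k, hk.trans h, rfl⟩

theorem skewCompl_anti {A B : Submodule ℝ (EuclideanSpace ℝ (Fin C.m))} (h : A ≤ B) :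
    C.skewCompl B ≤ C.skewCompl A := fun _ ha => ⟨ha.1, fun b hb => ha.2 b (h hb)⟩

theorem flag_of_nonpos {i : ℤ} (h : i ≤ 0) (t : ℝ) :
    C.flag i t = osculating (Set.Ioo (-C.ε) C.ε) C.jacobi (-i).toNat t := if_pos h

theorem flag_of_pos {i : ℤ} (h : 0 < i) (t : ℝ) :
    C.flag i t = C.skewCompl (osculating (Set.Ioo (-C.ε) C.ε) C.jacobi (i - 1).toNat t) :=
  if_neg (not_le.2 h)

theorem flag_zero : C.flag 0 0 = C.jacobi 0 :=
  (C.flag_of_nonpos le_rfl 0).trans C.osculating_zero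

theorem flag_one : C.flag 1 0 = C.skewCompl (C.jacobi 0) := by
  rw [C.flag_of_pos one_pos, sub_self, Int.toNat_zero, C.osculating_zero]

theorem flag_anti {i j : ℤ} (hi : 0 < i) (hij : i ≤ j) : C.flag j 0 ≤ C.flag i 0 := by
  rw [C.flag_of_pos hi, C.flag_of_pos (hi.trans_le hij)]
  exact C.skewCompl_anti (C.osculating_mono (by omega) 0)

end

section

variable {q : EuclideanSpace ℝ (Fin n)} {p : EuclideanSpace ℝ (Fin n) →L[ℝ] ℝ}
  (C : ExtremalChart U D (q, p)) (J : FrameJet U D q)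

theorem vanishing (C : ExtremalChart U D (q, p)) : ∀ v ∈ D q, p v = 0 := C.mem_O_inter.2.1.2

/-- The passage to the space of extremals divides by exactly two dimensions, the characteristic line
and the Euler direction. -/
theorem finrank_map_fderiv (J : FrameJet U D q) {N : Submodule ℝ (Cot n)}
    (hN : N ≤ tangentAnn U D (q, p))
    (hN' : charKer U D (q, p) ⊔ Submodule.span ℝ {((0, p) : Cot n)} ≤ N) :
    Module.finrank ℝ (N.map (fderiv ℝ C.Ψ (q, p) : Cot n →ₗ[ℝ] EuclideanSpace ℝ (Fin C.m))) + 2 =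
      Module.finrank ℝ N := by
  rw [← finrank_map_add_finrank_inf_ker N (fderiv ℝ C.Ψ (q, p) : Cot n →ₗ[ℝ] EuclideanSpace ℝ (Fin C.m))]
  have h : (N ⊓ LinearMap.ker (fderiv ℝ C.Ψ (q, p) : Cot n →ₗ[ℝ] EuclideanSpace ℝ (Fin C.m)) :
      Submodule ℝ (Cot n)) = charKer U D (q, p) ⊔ Submodule.span ℝ {((0, p) : Cot n)} := by
    ext u
    constructor
    · rintro ⟨h1, h2⟩
      exact (C.ker_Ψ _ C.mem_O_inter u (hN h1)).1 h2
    · exact fun h => ⟨hN' h, (C.ker_Ψ _ C.mem_O_inter u (hN (hN' h))).2 h⟩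
  rw [h, J.finrank_charKer_sup C.vanishing C.mem_O_inter.2.2]

theorem sup_le_liftCompl (C : ExtremalChart U D (q, p)) (J : FrameJet U D q) :
    charKer U D (q, p) ⊔ Submodule.span ℝ {((0, p) : Cot n)} ≤ liftCompl U D (q, p) :=
  sup_le FrameJet.charKer_le_liftCompl (by
    rw [Submodule.span_singleton_le_iff_mem]
    exact J.euler_mem_liftCompl C.vanishing)

theorem finrank_flag_zero (J : FrameJet U D q) : Module.finrank ℝ (C.flag 0 0) + 2 = n := by
  rw [flag_zero, jacobi_zero, C.finrank_map_fderiv J (N := lift U D (q, p)) inf_le_left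
    ((C.sup_le_liftCompl J).trans (J.liftCompl_le_lift C.vanishing)), J.finrank_lift C.vanishing]

theorem flag_one_eq (J : FrameJet U D q) : C.flag 1 0 = (liftCompl U D (q, p)).map
    (fderiv ℝ C.Ψ (q, p) : Cot n →ₗ[ℝ] EuclideanSpace ℝ (Fin C.m)) := by
  have hL := FrameJet.lift_le_liouvilleKer (U := U) C.vanishing
  rw [flag_one, jacobi_zero]
  ext a
  constructor
  · rintro ⟨⟨u, hu, rfl⟩, h⟩
    refine ⟨u, mem_liftCompl.2 ⟨hu.1, fun u' hu' => ?_⟩, rfl⟩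
    rw [← C.form_eq u hu u' (hL hu')]
    exact h _ ⟨u', hu', rfl⟩
  · rintro ⟨u, hu, rfl⟩
    have hu1 := hL (J.liftCompl_le_lift C.vanishing hu)
    refine ⟨⟨u, hu1, rfl⟩, ?_⟩
    rintro _ ⟨u', hu', rfl⟩
    exact (C.form_eq u hu1 u' (hL hu')).trans ((mem_liftCompl.1 hu).2 u' hu')

/-- Against $\dim J^0=n-2$ this makes the graded piece of degree zero two-dimensional, which later
leaves room for a single summand in a rectangular diagram. -/
theorem finrank_flag_one (J : FrameJet U D q) : Module.finrank ℝ (C.flag 1 0) + 4 = n := by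
  have h := C.finrank_map_fderiv J (N := liftCompl U D (q, p)) inf_le_left (C.sup_le_liftCompl J)
  have h' := J.finrank_liftCompl C.vanishing C.mem_O_inter.2.2
  rw [← h, ← C.flag_one_eq J] at h'
  omega

theorem flag_one_le (J : FrameJet U D q) : C.flag 1 0 ≤ C.flag 0 0 := by
  rw [C.flag_one_eq J, flag_zero, jacobi_zero]
  exact Submodule.map_mono (J.liftCompl_le_lift C.vanishing)

theorem flag_succ_le (J : FrameJet U D q) (i : ℕ) : C.flag ((i : ℤ) + 1) 0 ≤ C.flag i 0 := by
  rcases Nat.eq_zero_or_pos i with rfl | hi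
  · simpa using C.flag_one_le J
  · exact C.flag_anti (by exact_mod_cast hi) (by omega)

/-- Nondegeneracy of the form on the contact hyperplane: degenerate directions upstairs are
precisely killed by the differential of the quotient map. -/
theorem skewCompl_contact (J : FrameJet U D q) : C.skewCompl C.contact = ⊥ := by
  rw [eq_bot_iff]
  rintro _ ⟨⟨u, hu, rfl⟩, h⟩
  refine (C.ker_Ψ _ C.mem_O_inter u hu.1).2 (J.mem_of_sympl_liouvilleKer C.vanishing
    (J.ne_zero_of_finrank C.vanishing C.mem_O_inter.2.2) hu.1 fun u' hu' => ?_)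
  rw [← C.form_eq u hu u' hu']
  exact h _ ⟨u', hu', rfl⟩

/-- If $J^\nu=\Delta$ with $\nu\le0$, duality gives $J^{1-\nu}=\Delta^\angle=0$. A positive $\nu$ is
impossible, since then $J^0\subset\Delta=J^\nu\subset J^1$ against the dimensions $n-2$ and $n-4$.
-/
theorem exists_flag_eq_bot (J : FrameJet U D q) (h : C.IsMaximalClassPoint) :
    ∃ N : ℕ, ∀ i : ℤ, N < i → C.flag i 0 = ⊥ := by
  obtain ⟨i, hi⟩ := h
  rcases le_or_gt i 0 with h0 | h0
  · refine ⟨(-i).toNat, fun j hj => eq_bot_iff.2 ?_⟩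
    have h1 : C.flag (((-i).toNat : ℤ) + 1) 0 = ⊥ := by
      rw [C.flag_of_pos (by omega), add_sub_cancel_right, Int.toNat_natCast,
        ← C.flag_of_nonpos h0, hi, C.skewCompl_contact J]
    rw [← h1]
    exact C.flag_anti (by omega) (by omega)
  · exfalso
    have h1 : C.flag 0 0 ≤ C.flag 1 0 := by
      refine le_trans ?_ (C.flag_anti one_pos (Int.add_one_le_iff.2 h0))
      rw [hi, flag_zero, jacobi_zero]
      exact Submodule.map_mono (FrameJet.lift_le_liouvilleKer C.vanishing)
    have h2 := Submodule.finrank_mono h1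
    have h3 := C.finrank_flag_zero J
    have h4 := C.finrank_flag_one J
    omega

/-- Restricting to nonnegative degrees is enough for the dimension count and avoids computing any
proper osculating subspaces. -/
theorem finrank_gr (J : FrameJet U D q) {S : FlagSymbol} (h : C.HasFlagSymbol S) (i : ℕ) :
    Module.finrank ℝ (S.gr i) + Module.finrank ℝ (C.flag ((i : ℤ) + 1) 0) =
      Module.finrank ℝ (C.flag i 0) := by
  obtain ⟨φ, -⟩ := h
  rw [(φ i).finrank_eq, ← (Submodule.submoduleOfEquivOfLe (C.flag_succ_le J i)).finrank_eq]
  exact Submodule.finrank_quotient_add_finrank _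

end

end ExtremalChart

end LocalDist

/-! ### Rectangular diagrams -/

/-- The dimension of a column is its number of boxes. -/
theorem YoungBox.finrank_column {k : ℕ} {l : Fin k → ℕ} (s : Fin k → ℕ) (i : ℤ) :
    Module.finrank ℝ (YoungBox.column (l := l) s i) =
      Fintype.card {b : YoungBox l // b.weight s = i} := by
  classical
  let f : YoungBox.column (l := l) s i ≃ₗ[ℝ] ({b : YoungBox l // b.weight s = i} → ℝ) :=
    { toFun := fun g b => g.1 b.1
      map_add' := fun g h => rfl
      map_smul' := fun c g => rfl
      invFun := fun g => ⟨fun b => if h : b.weight s = i then g ⟨b, h⟩ else 0,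
        fun b hb => dif_neg hb⟩
      left_inv := fun g => by
        ext b
        by_cases h : b.weight s = i
        · simp [h]
        · simp [h, g.2 b h]
      right_inv := fun g => by
        funext b
        simp [b.2] }
  rw [f.finrank_eq, Module.finrank_fintype_fun_eq_card]

theorem youngSymbol_finrank_gr (k s i : ℕ) :
    Module.finrank ℝ ((youngSymbol (fun _ : Fin k => s) (fun _ => 2 * s)).gr i) =
      if i ≤ s then 2 * k else 0 := by
  refine (YoungBox.finrank_column (l := fun _ : Fin k => 2 * s) (fun _ => s) i).trans ?_
  have hw : ∀ b : YoungBox (fun _ : Fin k => 2 * s), b.weight (fun _ => s) = i ↔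
      (b.2.2 : ℕ) + i = s := by
    rintro ⟨j, e, a⟩
    cases e <;> simp [YoungBox.weight] <;> omega
  split_ifs with h
  · have e : {b : YoungBox (fun _ : Fin k => 2 * s) // b.weight (fun _ => s) = i} ≃ Fin k × Bool :=
      { toFun := fun b => (b.1.1, b.1.2.1)
        invFun := fun c => ⟨⟨c.1, c.2, ⟨s - i, by change _ < 2 * s + 1; omega⟩⟩,
          (hw _).2 (by change s - i + i = s; omega)⟩
        left_inv := by
          rintro ⟨⟨j, e, a⟩, hb⟩
          have h1 : (a : ℕ) + i = s := (hw _).1 hb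
          have h2 : a = ⟨s - i, by change _ < 2 * s + 1; omega⟩ :=
            Fin.ext (by change (a : ℕ) = s - i; omega)
          simp [h2]
        right_inv := fun c => rfl }
    rw [Fintype.card_congr e]
    simp [mul_comm]
  · rw [Fintype.card_eq_zero_iff]
    refine ⟨fun b => h ?_⟩
    have := (hw _).1 b.2
    omega

/-- Comparing the right ends of the two rows of one summand gives $s\le l-s$, hence $l=2s$;
comparing the right ends for different summands makes $s$ constant. For the empty diagram any value
of $s$ serves. -/
theorem FlagSymbol.IsRectangular.exists_iso {S : FlagSymbol} (h : S.IsRectangular) :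
    ∃ k s : ℕ, Nonempty (FlagSymbol.Iso (youngSymbol (fun _ : Fin k => s) (fun _ => 2 * s)) S) := by
  obtain ⟨k, s, l, hl, he, C, hC⟩ := h
  have hrow : ∀ j, (∀ x : ℤ, x ∈ C ↔ (s j : ℤ) - l j ≤ x ∧ x ≤ s j) ∧
      (∀ x : ℤ, x ∈ C ↔ -(s j : ℤ) ≤ x ∧ x ≤ l j - s j) := fun j => by
    refine ⟨fun x => ?_, fun x => ?_⟩
    · rw [← hC j true, rowColumns, if_pos rfl, Finset.mem_Icc]
    · rw [← hC j false, rowColumns, if_neg (by simp), Finset.mem_Icc]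
  have hls : ∀ j, l j = 2 * s j := fun j => by
    have h1 := ((hrow j).2 (s j)).1 (((hrow j).1 (s j)).2 (by omega))
    have h2 := hl j
    omega
  have hss : ∀ j j', s j ≤ s j' := fun j j' => by
    have h1 := ((hrow j').1 (s j)).1 (((hrow j).1 (s j)).2 (by omega))
    omega
  obtain ⟨s₀, hs₀⟩ : ∃ s₀, ∀ j, s j = s₀ := by
    rcases Nat.eq_zero_or_pos k with rfl | hk
    · exact ⟨0, fun j => j.elim0⟩
    · exact ⟨s ⟨0, hk⟩, fun j => le_antisymm (hss _ _) (hss _ _)⟩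
  obtain rfl : s = fun _ => s₀ := funext hs₀
  obtain rfl : l = fun _ => 2 * s₀ := funext hls
  exact ⟨k, s₀, he⟩

theorem FlagSymbol.Iso.finrank_gr {S T : FlagSymbol} (e : FlagSymbol.Iso S T) (i : ℤ) :
    Module.finrank ℝ (T.gr i) = Module.finrank ℝ (S.gr i) := by
  rw [← e.map_gr]
  exact (LinearEquiv.finrank_eq (e.toEquiv.submoduleMap (S.gr i))).symm

/-! ### Identification of the symbol, a common generic covector, and the main theorem -/

namespace LocalDist

variable {n : ℕ} {U : Set (EuclideanSpace ℝ (Fin n))}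
  {D : EuclideanSpace ℝ (Fin n) → Submodule ℝ (EuclideanSpace ℝ (Fin n))}
  {q : EuclideanSpace ℝ (Fin n)}

/-- A rectangular symbol of a point of maximal class of a rank three distribution. -/
theorem ExtremalChart.exists_iso_of_isRectangular {p : EuclideanSpace ℝ (Fin n) →L[ℝ] ℝ}
    (C : ExtremalChart U D (q, p)) (J : FrameJet U D q) (hC : C.IsMaximalClassPoint)
    {S : FlagSymbol} (h : C.HasFlagSymbol S) (hS : S.IsRectangular) :
    ∃ s : ℕ, n = 2 * s + 4 ∧ Nonempty (FlagSymbol.Iso (indecSymbol s (2 * s)) S) := by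
  obtain ⟨k, s, ⟨e⟩⟩ := hS.exists_iso
  have hgr : ∀ i : ℕ, Module.finrank ℝ (S.gr i) = if i ≤ s then 2 * k else 0 := fun i => by
    rw [e.finrank_gr, youngSymbol_finrank_gr]
  have hd := fun i : ℕ => C.finrank_gr J h i
  have h0 := C.finrank_flag_zero J
  have h1 := C.finrank_flag_one J
  obtain ⟨N, hN⟩ := C.exists_flag_eq_bot J hC
  -- The degree zero column contains $2k$ boxes and corresponds to $J^0/J^1$, of dimension
  -- $(n-2)-(n-4)$.
  have hk : k = 1 := by
    have h2 := hd 0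
    rw [hgr, if_pos (Nat.zero_le _), Nat.cast_zero, zero_add] at h2
    omega
  subst hk
  have hle : ∀ i : ℕ, i ≤ s + 1 → Module.finrank ℝ (C.flag i 0) + 2 * i =
      Module.finrank ℝ (C.flag 0 0) := by
    intro i
    induction i with
    | zero => intro _; rfl
    | succ i ih =>
      intro hi
      have h2 := hd i
      rw [hgr, if_pos (by omega)] at h2
      have h3 := ih (by omega)
      push_cast
      omega
  -- Beyond degree $s$ the graded pieces vanish, so the flag is constant from degree $s+1$ on;
  -- maximal class makes it zero there, and the $s+1$ drops by two account for $n-2$.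
  have hge : ∀ i : ℕ, Module.finrank ℝ (C.flag ((s + 1 + i : ℕ) : ℤ) 0) =
      Module.finrank ℝ (C.flag ((s + 1 : ℕ) : ℤ) 0) := by
    intro i
    induction i with
    | zero => rfl
    | succ i ih =>
      have h2 := hd (s + 1 + i)
      rw [hgr, if_neg (by omega), zero_add, ih] at h2
      exact_mod_cast h2
  have h4 := hle (s + 1) le_rfl
  rw [← hge N, hN _ (by push_cast; omega), finrank_bot] at h4
  exact ⟨s, by omega, ⟨e⟩⟩

/-- Both nonvanishing conditions are restricted to the affine line through a witness of each. There
they are nonzero polynomials in one variable, and finitely many such polynomials have a common point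
of nonvanishing. -/
theorem Generically.exists_and (J : FrameJet U D q) {Q Q' : Cot n → Prop}
    (h : Generically U D q Q) (h' : Generically U D q Q') : ∃ p, Q (q, p) ∧ Q' (q, p) := by
  obtain ⟨d, F, -, ⟨p₁, hp₁, hF⟩, hQ⟩ := h
  obtain ⟨d', F', -, ⟨p₂, hp₂, hF'⟩, hQ'⟩ := h'
  let r : ℝ → (EuclideanSpace ℝ (Fin n) →L[ℝ] ℝ) := fun t => p₁ + t • (p₂ - p₁)
  have hr0 : r 0 = p₁ := by simp [r]
  have hr1 : r 1 = p₂ := by simp [r]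
  have hann : ∀ t, ∀ v ∈ D q, r t v = 0 := fun t v hv => by
    simp [r, hp₁.1.2 v hv, hp₂.1.2 v hv]
  obtain ⟨a, b, hab⟩ := (J.finrank_charKer_eq_one_iff hp₁.1.2).1 hp₁.2
  have hpoly : ∀ G : MvPolynomial (Fin n) ℝ, ∃ P : Polynomial ℝ, ∀ t, P.eval t =
      MvPolynomial.eval (fun a => r t (EuclideanSpace.single a 1)) G := fun G => by
    refine ⟨MvPolynomial.aeval (fun a => Polynomial.C (p₁ (EuclideanSpace.single a 1)) +
      Polynomial.X * Polynomial.C ((p₂ - p₁) (EuclideanSpace.single a 1))) G, fun t => ?_⟩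
    rw [← Polynomial.coe_aeval_eq_eval, MvPolynomial.comp_aeval_apply, ← MvPolynomial.coe_aeval_eq_eval,
      RingHom.coe_coe]
    simp [r]
  obtain ⟨P, hP⟩ := hpoly F
  obtain ⟨P', hP'⟩ := hpoly F'
  -- Points of the line annihilate $D$ but need not be regular; this third polynomial, an entry of
  -- the bracket matrix that is nonzero at `p₁`, secures regularity.
  let R : Polynomial ℝ := Polynomial.C (J.curv p₁ a b) +
    Polynomial.X * Polynomial.C (J.curv (p₂ - p₁) a b)
  have hR : ∀ t, R.eval t = J.curv (r t) a b := fun t => by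
    simp [R, r, FrameJet.curv]
    ring
  obtain ⟨t, ht⟩ : ∃ t, (P * P' * R).eval t ≠ 0 := by
    by_contra! h0
    have h1 : P * P' * R = 0 := Polynomial.funext fun t => by rw [h0, Polynomial.eval_zero]
    rcases mul_eq_zero.1 h1 with h2 | h2
    · rcases mul_eq_zero.1 h2 with h3 | h3
      · apply hF
        have := hP 0
        rw [h3, hr0, Polynomial.eval_zero] at this
        exact this.symm
      · apply hF'
        have := hP' 1
        rw [h3, hr1, Polynomial.eval_zero] at this
        exact this.symm
    · apply hab
      have := hR 0
      rw [h2, hr0, Polynomial.eval_zero] at this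
      exact this.symm
  rw [Polynomial.eval_mul, Polynomial.eval_mul, hP, hP', hR] at ht
  have hreg : (q, r t) ∈ regularSet U D := ⟨⟨hp₁.1.1, hann t⟩,
    (J.finrank_charKer_eq_one_iff (hann t)).2 ⟨a, b, right_ne_zero_of_mul ht⟩⟩
  exact ⟨r t, hQ _ hreg (left_ne_zero_of_mul (left_ne_zero_of_mul ht)),
    hQ' _ hreg (right_ne_zero_of_mul (left_ne_zero_of_mul ht))⟩

end LocalDist

theorem mainTheorem8 {n : ℕ} {M : Type*} [TopologicalSpace M]
    [ChartedSpace (EuclideanSpace ℝ (Fin n)) M] [IsManifold (𝓡 n) ∞ M]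
    (D : ∀ x : M, Submodule ℝ (TangentSpace (𝓡 n) x)) (hD : IsDistributionOfRank D 3)
    (q : M) (hsq : Module.finrank ℝ (squareAt D q) = 6) (hmax : IsOfMaximalClass D q)
    (S : FlagSymbol) (hS : HasJacobiSymbol D q S) (hrect : S.IsRectangular) :
    Even n ∧ ∃ s : ℕ, n = 2 * s + 4 ∧
      ∃ (e : FlagSymbol.Iso (indecSymbol s (2 * s)) S)
        (ρ : LieAlgebra.SpecialLinear.sl (Fin 2) ℝ →ₗ⁅ℝ⁆ Module.End ℝ (Fin (2 * s + 1) → ℝ))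
        (Ξ : (Fin (2 * s + 1) → ℝ) ⊗[ℝ] (Fin 2 → ℝ) ≃ₗ[ℝ] S.X)
        (Θ : (LieAlgebra.SpecialLinear.sl (Fin 2) ℝ × Matrix (Fin 2) (Fin 2) ℝ) ≃ₗ⁅ℝ⁆ S.uF),
        (∀ a, Ξ (Pi.single a 1 ⊗ₜ[ℝ] Pi.single 0 1) = e.toEquiv (eBox a)) ∧
        (∀ a, Ξ (Pi.single a 1 ⊗ₜ[ℝ] Pi.single 1 1) = e.toEquiv (fBox a)) ∧
        (∀ W : Submodule ℝ (Fin (2 * s + 1) → ℝ), (∀ a, ∀ w ∈ W, ρ a w ∈ W) → W = ⊥ ∨ W = ⊤) ∧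
        (∀ a b x v, (Θ (a, b) : Module.End ℝ S.X) (Ξ (x ⊗ₜ[ℝ] v)) =
          Ξ (ρ a x ⊗ₜ[ℝ] v + x ⊗ₜ[ℝ] b.mulVec v)) ∧
        (n = 6 → S.IsUniversalProlongation S.uF (LieAlgebra.Orthogonal.so' (Fin 4) (Fin 3) ℝ)) ∧
        (6 < n → S.firstProlongation S.uF = ⊥ ∧
          ∃ ψ : (LieAlgebra.SpecialLinear.sl (Fin 2) ℝ × Matrix (Fin 2) (Fin 2) ℝ) →ₗ⁅ℝ⁆
              LieDerivation ℝ S.Heis S.Heis,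
            (∀ a x, ψ a (FlagSymbol.Heis.ofX S x) =
              FlagSymbol.Heis.ofX S ((Θ a : Module.End ℝ S.X) x)) ∧
            S.IsUniversalProlongation S.uF
              (LieAlgebra.SemiDirectSum S.Heis
                (LieAlgebra.SpecialLinear.sl (Fin 2) ℝ × Matrix (Fin 2) (Fin 2) ℝ) ψ)) := by
  have hq := mem_extChartAt_target (I := 𝓡 n) q
  obtain ⟨J⟩ := LocalDist.exists_frameJet (hD q) hq
  unfold IsOfMaximalClass LocalDist.IsOfMaximalClassAt at hmax
  unfold HasJacobiSymbol LocalDist.HasJacobiSymbolAt at hS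
  obtain ⟨p, hC, C, -, hCS⟩ := LocalDist.Generically.exists_and J hmax hS
  obtain ⟨s, hn, ⟨e⟩⟩ := C.exists_iso_of_isRectangular J (hC C) hCS hrect
  -- The six-dimensional $D^2(q)$ sits in an $n$-dimensional space; this rules out the degenerate
  -- case $s=0$.
  have h6 : 6 ≤ n := by
    have h := Submodule.finrank_le (squareAt D q)
    rwa [hsq, finrank_euclideanSpace_fin] at h
  exact ⟨⟨s + 2, by omega⟩, s, hn, conclusion_of_iso S (by omega) hn e⟩
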